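/- **Setting.** Let $X\subset\mathbb R^n$ be convex and compact, $\|\cdot\|$ a norm on $\mathbb R^n$ with dual norm $\|\cdot\|_*$. Consider $$\min_{x\in X}\psi_0(x)\quad\text{s.t. }\psi_i(x)\le 0,\ i=1,\dots,m,\qquad \psi_i=f_i+\chi_i ,$$ where each $f_i:X\to\mathbb R$ is Lipschitz smooth with $f_i(x)\ge f_i(y)+\langle\nabla f_i(y),x-y\rangle-\frac{\mu_i}{2}\|x-y\|^2$ on $X$, $\mu_0>0$, $\mu_i\ge 0$; $\chi_0:X\to\mathbb R$ is convex and lower semicontinuous and $\chi_1,\dots,\chi_m$ are convex and continuous. Let $\omega$ be differentiable and $1$-strongly convex on $X$ with $L_\omega$-Lipschitz gradient (from $\|\cdot\|$ to $\|\cdot\|_*$, $L_\omega>0$), $W(y,x)=\omega(y)-\omega(x)-\langle\nabla\omega(x),y-x\rangle$ and $D_X=\max_{x,y\in X}\sqrt{2W(x,y)}$. For convex $h:X\to\mathbb R$, $\partial h(x)$ is, for $x$ in the relative interior of $X$, the set of subgradients lying in the linear span of $X-X$, and, for other $x\in X$, the set of limits of such subgradients along relative interior points converging to $x$. Put $\partial\psi_i(x)=\{\nabla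 f_i(x)\}+\partial\chi_i(x)$, let $N_X$ be the normal cone, and for a set $A$ of gradient vectors let $d(A,0)=\inf_{g\in A}\|g\|_*$. For $z\in X$ the subproblem with centre $z$ is $\min_{x\in X}\psi_0(x;z)$ s.t. $\psi_i(x;z)\le0$ $(i\ge1)$, where $\psi_i(x;z)=\psi_i(x)+2\mu_iW(x,z)$. A random $x\in X$ is a *stochastic $(\delta,\bar\delta)$-optimal solution* of it (the centre may be random) if $\mathbb E[\psi_0(x;z)-\psi_0^*(z)]\le\delta$ and $\mathbb E\|[\psi(x;z)]_+\|_2\le\bar\delta$, where $\psi_0^*(z)$ is its optimal value. A random $\hat x\in X$ is a *stochastic $(\varepsilon,\bar\varepsilon)$-KKT point* if there are random $\bar x\in X$, $\bar y\ge0$ with $\psi_i(\bar x)\le0$ for all $i\ge1$ and $$\mathbb E\sum_{i=1}^m|\bar y^{(i)}\psi_i(\bar x)|\le\varepsilon,\quad \mathbb E\Big[d\Big(\partial\psi_0(\bar x)+\sum_{i=1}^m\bar y^{(i)}\partial\psi_i(\bar x)+N_X(\bar x),0\Big)^2\Big]\le\varepsilon,\quad \mathbb E\|\hat x-\bar x\|^2\le\bar\varepsilon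 .$$ *Inexact proximal point method:* from $x_0\in X$, for $k=1,\dots,K$ let $x_k$ be an approximate solution of the subproblem with centre $x_{k-1}$; output $x_{\hat k}$ with $\hat k$ uniform on $\{1,\dots,K\}$ and independent of everything else. Assume that each of these subproblems has an optimal primal–dual (KKT) pair $(x_k^*,y_k^*)$, chosen measurably, with $\|y_k^*\|_1\le B$, where $B>0$ is a constant. Let $\mu_{\max}=\max_{1\le i\le m}\mu_i$, $\Delta=\psi_0(x_0)-\min_X\psi_0$, $\bar\Delta_0=\|[\psi(x_0)]_+\|_2$, $c>0$, $$c_1=\max\{2L_\omega,\,8L_\omega^2(\mu_0+\mu_{\max}B)\},\qquad c_2=c+B,\qquad \bar\delta=\frac{\varepsilon}{2c_1c_2},\qquad \delta=c\,\bar\delta .$$ **Statement. (a)** Let $\varepsilon>0$. If every $x_k$ is a stochastic $(\delta,\bar\delta)$-optimal solution of its subproblem and $K\ge1$ is an integer with $K\ge 2c_1(\Delta+B\bar\Delta_0)/\varepsilon$ (for instance the bound rounded up), then $x_{\hat k}$ is a stochastic $\big(\varepsilon,\frac{2\varepsilon}{\mu_0c_1}\big)$-KKT point. **(b)** Suppose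 $X$ has at least two points, and let $Y\ge0$ with $\|y_k^*\|_2\le Y$ for all $k$ and $B\ge Y+1$. Split $\chi_i=\chi_i^s+\chi_i^n$ on $X$ into convex functions, with $\chi_0^s$ lower semicontinuous and the other parts continuous, and write $\psi_i(\cdot;z)=\tilde f_i+\tilde\chi_i$ with $\tilde f_i=f_i+\chi_i^n+\mu_iW(\cdot,z)$ and $\tilde\chi_i=\chi^s_i+\mu_iW(\cdot,z)$. Assume, with nonnegative constants uniform in $z\in X$, for all $x_1,x_2\in X$ and $g\in\partial\tilde f_i(x_2)$, $\tilde f_i(x_1)-\tilde f_i(x_2)-\langle g,x_1-x_2\rangle\le\frac{L_i}{2}\|x_1-x_2\|^2+H_i\|x_1-x_2\|$ $(0\le i\le m)$, and for $1\le i\le m$ that $\tilde f_i$ and $\tilde\chi_i$ are Lipschitz with constants $M_{f,i}$, $M_{\chi,i}$. Assume a stochastic oracle returning unbiased estimates $G_i(x,\xi)$ of an element of $\partial\tilde f_i(x)$ and $F_i(x,\xi)$ of $\tilde f_i(x)$ ($i\ge1$), with $\mathbb E\|G_i-\mathbb EG_i\|_*^2\le\sigma_i^2$ and $\mathbb E\|F-\mathbb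 EF\|_2^2\le\sigma_f^2$. Let $L_f,H_f,M_f,M_\chi,\|\sigma\|_2$ be the Euclidean norms of the vectors of the constants with $1\le i\le m$, and $$\alpha_0=\mu_0,\quad \mathcal M=\max\{2M_f,M_\chi+M_f\},\quad \sigma_{X,f}=(\sigma_f^2+D_X^2\|\sigma\|_2^2)^{1/2},\quad t_0=\tfrac{4(L_0+BL_f)}{\alpha_0}+2,$$ $$\mathcal H_*=H_0+(Y+1)H_f+\tfrac12L_fD_X[Y+1-B]_+,$$ $$\zeta=2e\Big\{\sigma_0^2+12(t_0+3)\|\sigma\|_2^2Y^2+96(t_0+2)B^2\|\sigma\|_2^2+\tfrac{\mathcal H_*^2}{2}+\tfrac{3\alpha_0B\sigma_{X,f}(t_0+2)^{3/2}}{2}\Big\}^{1/2},$$ $$T_\varepsilon=\max\Big\{\Big(\tfrac{5\alpha_0(t_0+2)(t_0+1)D_X^2}{\varepsilon}+\tfrac{960(t_0+2)(Y+1)^2\mathcal M^2}{\alpha_0\varepsilon}\Big)^{1/2},\Big(\tfrac{65B\sigma_{X,f}(t_0+2)^{3/2}}{\varepsilon}\Big)^{2/3},\tfrac{80(\zeta^2+\mathcal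 H_*^2+144(t_0+2)(Y+1)^2\|\sigma\|_2^2)}{\alpha_0\varepsilon},$$ $$\Big(\tfrac{30(Y+1)^2\sigma_{X,f}}{B}\Big)^2\tfrac{t_0+2}{\varepsilon^2},\Big(\tfrac{130B\sigma_{X,f}}{3}\Big)^2\tfrac{t_0+2}{\varepsilon^2}\Big\}.$$ *ConEx* with $T$ iterations on the subproblem with centre $z$: start from $u_0\in X$ (a measurable function of $z$) and $y_0=0$; let $h_0=\tilde\chi(u_0)+F(u_0,\bar\xi_0)$, $h_{-1}=h_0$, $h_{t+1}=\tilde\chi(u_{t+1})+F(u_t,\bar\xi_t)+(\langle G_i(u_t,\bar\xi_t),u_{t+1}-u_t\rangle)_{i\ge1}$, and for $t=0,\dots,T-1$ $$y_{t+1}=\big[y_t+\tfrac1{\tau_t}\big((1+\theta_t)h_t-\theta_th_{t-1}\big)\big]_+,$$ $$u_{t+1}=\operatorname*{argmin}_{x\in X}\ \tilde\chi_0(x)+\sum_{i\ge1}y_{t+1}^{(i)}\tilde\chi_i(x)+\Big\langle G_0(u_t,\xi_t)+\sum_{i\ge1}y^{(i)}_{t+1}G_i(u_t,\xi_t),x\Big\rangle+\eta_tW(x,u_t);$$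 return $\sum_{t<T}\gamma_tu_{t+1}/\sum_{t<T}\gamma_t$, where $\gamma_t=t+t_0+2$, $\eta_t=\frac{\alpha_0(t+t_0+1)}2$, $\theta_t=\frac{t+t_0+1}{t+t_0+2}$, $\tau_t=\frac1{t+1}\max\big\{\frac{32\mathcal M^2}{\alpha_0},\frac{384\|\sigma\|_2^2T}{\alpha_0},\frac{\sigma_{X,f}T^{3/2}}{B(t_0+2)^{1/2}}\big\}$ (with $1/\tau_t:=0$ in the degenerate case $\tau_t=0$), and all samples, over all subproblems, are i.i.d. Then there is a constant $C>0$, depending on the problem data, $x_0,B,Y,c$ and the constants above but neither on $\varepsilon$ nor on the oracle, such that for every $\varepsilon\in(0,1]$, with $K=\max\{1,\lceil 2c_1(\Delta+B\bar\Delta_0)/\varepsilon\rceil\}$, there is an integer $T\ge1$ with $$K\,T\le C\,\frac{T_\varepsilon}{\varepsilon}$$ and such that, if every subproblem is treated by $T$ iterations of ConEx, every $x_k$ is a stochastic $(\delta,\bar\delta)$-optimal solution of its subproblem and $x_{\hat k}$ is a stochastic $\big(\varepsilon,\frac{2\varepsilon}{\mu_0c_1}\big)$-KKT point. That is, the total number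 of ConEx iterations is $O(T_\varepsilon/\varepsilon)$. -/

import Mathlib

open MeasureTheory ProbabilityTheory
open scoped ENNReal RealInnerProductSpace

noncomputable section

/-- `ℝⁿ` with its standard inner product. -/
abbrev Rn (n : ℕ) := EuclideanSpace ℝ (Fin n)

/-- The dual norm `‖z‖_* = sup {zᵀx : ‖x‖ ≤ 1}` of a norm `nrm` on `ℝⁿ`. -/
def dualNorm {n : ℕ} (nrm : Seminorm ℝ (Rn n)) (z : Rn n) : ℝ :=
  sSup {r | ∃ x : Rn n, nrm x ≤ 1 ∧ r = ⟪z, x⟫}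

/-- The distance, in the dual norm, of a set of (sub)gradient vectors to the zero vector
(`∞` for the empty set). -/
def distZero {n : ℕ} (nrm : Seminorm ℝ (Rn n)) (S : Set (Rn n)) : ℝ≥0∞ :=
  ⨅ g ∈ S, ENNReal.ofReal (dualNorm nrm g)

/-- The normal cone `N_X(x)`. -/
def normalCone {n : ℕ} (X : Set (Rn n)) (x : Rn n) : Set (Rn n) :=
  {u | ∀ y ∈ X, ⟪u, y - x⟫ ≤ 0}

/-- Subgradients at `x` of `h : X → ℝ` that lie in the linear span of `X - X`. -/
def spanSubgrad {n : ℕ} (X : Set (Rn n)) (h : Rn n → ℝ) (x : Rn n) : Set (Rn n) :=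
  {g | g ∈ vectorSpan ℝ X ∧ ∀ y ∈ X, h x + ⟪g, y - x⟫ ≤ h y}

/-- The subdifferential of a convex function `h : X → ℝ`: at a point of the relative interior of
`X`, the subgradients in the linear span of `X - X`; at the other points of `X`, the limits of such
subgradients along sequences of relative interior points converging to the point. -/
def subdiff {n : ℕ} (X : Set (Rn n)) (h : Rn n → ℝ) (x : Rn n) : Set (Rn n) :=
  {g | (x ∈ intrinsicInterior ℝ X ∧ g ∈ spanSubgrad X h x) ∨
    (x ∈ X \ intrinsicInterior ℝ X ∧ ∃ (xi gi : ℕ → Rn n),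
      (∀ j, xi j ∈ intrinsicInterior ℝ X ∧ gi j ∈ spanSubgrad X h (xi j)) ∧
      Filter.Tendsto xi Filter.atTop (nhds x) ∧ Filter.Tendsto gi Filter.atTop (nhds g))}

/-- Data of the problem `min_{x ∈ X} ψ₀(x)` s.t. `ψᵢ(x) ≤ 0`, `ψᵢ = fᵢ + χᵢ`. Index `0` is the
objective and the indices `i.succ`, `i : Fin m`, are the constraints. All functions matter on `X`
only. `dgf` is the distance generating function `ω`. -/
structure Problem (n m : ℕ) where
  X : Set (Rn n)
  nrm : Seminorm ℝ (Rn n)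
  f : Fin (m + 1) → Rn n → ℝ
  gradf : Fin (m + 1) → Rn n → Rn n
  χ : Fin (m + 1) → Rn n → ℝ
  μ : Fin (m + 1) → ℝ
  dgf : Rn n → ℝ
  gradDgf : Rn n → Rn n
  Lω : ℝ

namespace Problem

variable {n m : ℕ} (p : Problem n m)

/-- Standing assumptions: `X` is compact and convex, `‖·‖` is a norm, the `fᵢ` are Lipschitz smooth
with lower curvature `μᵢ`, `χ₀` is convex and lower semicontinuous, the other `χᵢ` are convex and
continuous, `ω` is `1`-strongly convex with `Lω`-Lipschitz gradient. -/
structure Standing : Prop where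
  convex_X : Convex ℝ p.X
  compact_X : IsCompact p.X
  norm_definite : ∀ x, p.nrm x = 0 → x = 0
  hasGrad_f : ∀ i, ∀ x ∈ p.X, HasGradientWithinAt (p.f i) (p.gradf i x) p.X x
  smooth_f : ∀ i, ∃ l : ℝ, ∀ x ∈ p.X, ∀ y ∈ p.X,
    dualNorm p.nrm (p.gradf i x - p.gradf i y) ≤ l * p.nrm (x - y)
  curvature_f : ∀ i, ∀ x ∈ p.X, ∀ y ∈ p.X,
    p.f i y + ⟪p.gradf i y, x - y⟫ - p.μ i / 2 * p.nrm (x - y) ^ 2 ≤ p.f i x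
  convex_χ : ∀ i, ConvexOn ℝ p.X (p.χ i)
  lsc_χ : LowerSemicontinuousOn (p.χ 0) p.X
  cont_χ : ∀ i : Fin m, ContinuousOn (p.χ i.succ) p.X
  μ_zero : 0 < p.μ 0
  μ_succ : ∀ i : Fin m, 0 ≤ p.μ i.succ
  hasGrad_dgf : ∀ x ∈ p.X, HasGradientWithinAt p.dgf (p.gradDgf x) p.X x
  smooth_dgf : ∀ x ∈ p.X, ∀ y ∈ p.X,
    dualNorm p.nrm (p.gradDgf x - p.gradDgf y) ≤ p.Lω * p.nrm (x - y)
  strong_dgf : ∀ x ∈ p.X, ∀ y ∈ p.X,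
    p.dgf y + ⟪p.gradDgf y, x - y⟫ + 1 / 2 * p.nrm (x - y) ^ 2 ≤ p.dgf x
  Lω_pos : 0 < p.Lω

/-- The prox-function `W(y, x) = ω(y) - ω(x) - ⟨∇ω(x), y - x⟩`. -/
def W (y x : Rn n) : ℝ := p.dgf y - p.dgf x - ⟪p.gradDgf x, y - x⟫

/-- `D_X = max_{x, y ∈ X} √(2 W(x, y))`. -/
def DX : ℝ := sSup {r | ∃ x ∈ p.X, ∃ y ∈ p.X, r = Real.sqrt (2 * p.W x y)}

/-- `ψᵢ = fᵢ + χᵢ`. -/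
def ψ (i : Fin (m + 1)) (x : Rn n) : ℝ := p.f i x + p.χ i x

/-- `∂ψᵢ(x) = {∇fᵢ(x)} + ∂χᵢ(x)`. -/
def subψ (i : Fin (m + 1)) (x : Rn n) : Set (Rn n) :=
  {g | ∃ v ∈ subdiff p.X (p.χ i) x, g = p.gradf i x + v}

/-- Functions of the proximal subproblem with centre `z`: `ψᵢ(x; z) = ψᵢ(x) + 2 μᵢ W(x, z)`. The
subproblem is `min_{x ∈ X} ψ₀(x; z)` s.t. `ψᵢ(x; z) ≤ 0`. -/
def ψc (z : Rn n) (i : Fin (m + 1)) (x : Rn n) : ℝ := p.ψ i x + 2 * p.μ i * p.W x z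

/-- `∂ψᵢ(x; z) = ∂ψᵢ(x) + 2 μᵢ (∇ω(x) - ∇ω(z))`. -/
def subψc (z : Rn n) (i : Fin (m + 1)) (x : Rn n) : Set (Rn n) :=
  {g | ∃ v ∈ p.subψ i x, g = v + (2 * p.μ i) • (p.gradDgf x - p.gradDgf z)}

/-- The Minkowski sum `S₀ + ∑ᵢ y⁽ⁱ⁾ Sᵢ + N_X(x)`. -/
def lagrangianSet (S : Fin (m + 1) → Set (Rn n)) (x : Rn n) (y : Fin m → ℝ) : Set (Rn n) :=
  {g | ∃ v : Fin (m + 1) → Rn n, (∀ i, v i ∈ S i) ∧ ∃ u ∈ normalCone p.X x,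
    g = v 0 + ∑ i : Fin m, y i • v i.succ + u}

/-- `(x, y)` is a KKT pair (optimal primal-dual pair) of the subproblem with centre `z`. -/
structure IsSubKKT (z x : Rn n) (y : Fin m → ℝ) : Prop where
  mem : x ∈ p.X
  feasible : ∀ i : Fin m, p.ψc z i.succ x ≤ 0
  nonneg : ∀ i, 0 ≤ y i
  compl : ∀ i : Fin m, y i * p.ψc z i.succ x = 0
  stationary : distZero p.nrm (p.lagrangianSet (fun i => p.subψc z i x) x y) = 0

/-- Optimal value of the subproblem with centre `z`. -/
def subOpt (z : Rn n) : ℝ :=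
  sInf (p.ψc z 0 '' {x | x ∈ p.X ∧ ∀ i : Fin m, p.ψc z i.succ x ≤ 0})

/-- `‖[ψ(x; z)]₊‖₂`, the constraint violation for the subproblem with centre `z`. -/
def subViol (z x : Rn n) : ℝ := Real.sqrt (∑ i : Fin m, (max (p.ψc z i.succ x) 0) ^ 2)

/-- `x` is a stochastic `(δo, δc)`-optimal solution of the subproblem with (random) centre `z`. -/
structure IsStochSubOpt {Ω : Type*} [MeasurableSpace Ω] (P : Measure Ω) (δo δc : ℝ)
    (z x : Ω → Rn n) : Prop where
  mem : ∀ a, x a ∈ p.X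
  integrable_gap : Integrable (fun a => p.ψc (z a) 0 (x a) - p.subOpt (z a)) P
  gap_le : ∫ a, (p.ψc (z a) 0 (x a) - p.subOpt (z a)) ∂P ≤ δo
  integrable_viol : Integrable (fun a => p.subViol (z a) (x a)) P
  viol_le : ∫ a, p.subViol (z a) (x a) ∂P ≤ δc

end Problem

/-- Expectation of a `[0, ∞]`-valued function. It is written as the upper integral, so that it makes
sense, and is not underestimated, without any measurability; for measurable `h` it is `∫⁻ h`. -/
def upperExp {Ω : Type*} [MeasurableSpace Ω] (P : Measure Ω) (h : Ω → ℝ≥0∞) : ℝ≥0∞ :=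
  ⨅ (g : Ω → ℝ≥0∞) (_ : Measurable g) (_ : ∀ a, h a ≤ g a), ∫⁻ a, g a ∂P

namespace Problem

variable {n m : ℕ} (p : Problem n m)

/-- The random point `xhat` is a stochastic `(ε, δ)`-KKT point of the problem. -/
def IsStochKKT {Ω : Type*} [MeasurableSpace Ω] (P : Measure Ω) (ε δ : ℝ)
    (xhat : Ω → Rn n) : Prop :=
  Measurable xhat ∧ (∀ a, xhat a ∈ p.X) ∧
  ∃ (x : Ω → Rn n) (y : Ω → Fin m → ℝ), Measurable x ∧ Measurable y ∧
    (∀ a, x a ∈ p.X ∧ (∀ i : Fin m, p.ψ i.succ (x a) ≤ 0) ∧ ∀ i, 0 ≤ y a i) ∧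
    upperExp P (fun a => ENNReal.ofReal (∑ i : Fin m, |y a i * p.ψ i.succ (x a)|))
      ≤ ENNReal.ofReal ε ∧
    upperExp P (fun a =>
      distZero p.nrm (p.lagrangianSet (fun i => p.subψ i (x a)) (x a) (y a)) ^ 2)
      ≤ ENNReal.ofReal ε ∧
    upperExp P (fun a => ENNReal.ofReal (p.nrm (xhat a - x a) ^ 2)) ≤ ENNReal.ofReal δ

/-- `K` outer iterations of the inexact proximal point method from `x0`, with iterates `x k`, a
random index `khat` uniform on `{1, …, K}` and drawn independently, and with the optimal primal-dual
pairs `(xs (k+1), ys (k+1))` of the subproblems (centre `x k`), whose dual parts satisfy the uniform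
bound `‖ys (k+1)‖₁ ≤ B`. How `x (k+1)` solves its subproblem is prescribed separately. -/
structure IsProxRun {Ω : Type*} [MeasurableSpace Ω] (P : Measure Ω) (x0 : Rn n) (B : ℝ) (K : ℕ)
    (x xs : ℕ → Ω → Rn n) (ys : ℕ → Ω → Fin m → ℝ) (khat : Ω → ℕ) : Prop where
  meas_x : ∀ k, Measurable (x k)
  meas_xs : ∀ k, Measurable (xs k)
  meas_ys : ∀ k, Measurable (ys k)
  start : ∀ a, x 0 a = x0
  kkt : ∀ k < K, ∀ a, p.IsSubKKT (x k a) (xs (k + 1) a) (ys (k + 1) a)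
  dual_bound : ∀ k < K, ∀ a, ∑ i, |ys (k + 1) a i| ≤ B
  meas_khat : Measurable khat
  khat_mem : ∀ a, khat a ∈ Finset.Icc 1 K
  khat_uniform : ∀ k ∈ Finset.Icc 1 K, P {a | khat a = k} = (K : ℝ≥0∞)⁻¹
  khat_indep : IndepFun khat (fun a k => (x k a, xs k a, ys k a)) P

/-- `μ_max = max_{1 ≤ i ≤ m} μᵢ`. -/
def μmax : ℝ := ⨆ i : Fin m, p.μ i.succ

/-- `c₁ = max {2 Lω, 8 Lω² (μ₀ + μ_max B)}`. -/
def c1 (B : ℝ) : ℝ := max (2 * p.Lω) (8 * p.Lω ^ 2 * (p.μ 0 + p.μmax * B))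

/-- `Δ = ψ₀(x₀) - min_X ψ₀`. -/
def Δ (x0 : Rn n) : ℝ := p.ψ 0 x0 - sInf (p.ψ 0 '' p.X)

/-- `Δbar = ‖[ψ(x₀)]₊‖₂`. -/
def Δbar (x0 : Rn n) : ℝ := Real.sqrt (∑ i : Fin m, (max (p.ψ i.succ x0) 0) ^ 2)

/-- The number `2 c₁ (Δ + B Δbar) / ε` of outer iterations (before rounding). -/
def outerBound (B ε : ℝ) (x0 : Rn n) : ℝ := 2 * p.c1 B * (p.Δ x0 + B * p.Δbar x0) / ε

/-- The accuracy `ε / (2 c₁ c₂)`, `c₂ = c + B`. -/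
def acc (B c ε : ℝ) : ℝ := ε / (2 * p.c1 B * (c + B))

end Problem

/-- How the subproblems are presented to ConEx. A part `χn` of each `χᵢ` is treated as a possibly
nonsmooth function together with `fᵢ`, the part `χs` is handled by the prox operator. The remaining
fields are the smoothness, Lipschitz and noise constants. -/
structure ConExSetup (n m : ℕ) where
  p : Problem n m
  χs : Fin (m + 1) → Rn n → ℝ
  χn : Fin (m + 1) → Rn n → ℝ
  L : Fin (m + 1) → ℝ
  H : Fin (m + 1) → ℝ
  Mf : Fin m → ℝ
  Mχ : Fin m → ℝ
  σ : Fin (m + 1) → ℝ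
  σf : ℝ

namespace ConExSetup

variable {n m : ℕ} (S : ConExSetup n m)

/-- The convex function `fᵢ + χnᵢ + μᵢ W(·, z)`. -/
def fc (z : Rn n) (i : Fin (m + 1)) (x : Rn n) : ℝ :=
  S.p.f i x + S.χn i x + S.p.μ i * S.p.W x z

/-- The simple function `χsᵢ + μᵢ W(·, z)`, strongly convex with modulus `μᵢ` w.r.t. `W`. -/
def χc (z : Rn n) (i : Fin (m + 1)) (x : Rn n) : ℝ := S.χs i x + S.p.μ i * S.p.W x z

/-- Assumptions on the presentation of the subproblems, uniform in the centre `z ∈ X`. -/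
structure Valid : Prop where
  split : ∀ i, ∀ x ∈ S.p.X, S.p.χ i x = S.χs i x + S.χn i x
  convex_χs : ∀ i, ConvexOn ℝ S.p.X (S.χs i)
  convex_χn : ∀ i, ConvexOn ℝ S.p.X (S.χn i)
  lsc_χs : LowerSemicontinuousOn (S.χs 0) S.p.X
  cont_χs : ∀ i : Fin m, ContinuousOn (S.χs i.succ) S.p.X
  cont_χn : ∀ i, ContinuousOn (S.χn i) S.p.X
  smooth : ∀ z ∈ S.p.X, ∀ i, ∀ x₁ ∈ S.p.X, ∀ x₂ ∈ S.p.X, ∀ g ∈ subdiff S.p.X (S.fc z i) x₂,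
    S.fc z i x₁ - S.fc z i x₂ - ⟪g, x₁ - x₂⟫
      ≤ S.L i / 2 * S.p.nrm (x₁ - x₂) ^ 2 + S.H i * S.p.nrm (x₁ - x₂)
  lip_f : ∀ z ∈ S.p.X, ∀ i : Fin m, ∀ x₁ ∈ S.p.X, ∀ x₂ ∈ S.p.X,
    S.fc z i.succ x₁ - S.fc z i.succ x₂ ≤ S.Mf i * S.p.nrm (x₁ - x₂)
  lip_χ : ∀ z ∈ S.p.X, ∀ i : Fin m, ∀ x₁ ∈ S.p.X, ∀ x₂ ∈ S.p.X,
    S.χc z i.succ x₁ - S.χc z i.succ x₂ ≤ S.Mχ i * S.p.nrm (x₁ - x₂)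
  L_nonneg : ∀ i, 0 ≤ S.L i
  H_nonneg : ∀ i, 0 ≤ S.H i
  Mf_nonneg : ∀ i, 0 ≤ S.Mf i
  Mχ_nonneg : ∀ i, 0 ≤ S.Mχ i
  σ_nonneg : ∀ i, 0 ≤ S.σ i
  σf_nonneg : 0 ≤ S.σf

/-- Stochastic oracle for the subproblems: for a centre `z`, a search point `x` and a sample `s ∼ ν`
it returns `G z i x s`, an unbiased estimate with variance at most `σᵢ²` of a subgradient of
`fc z i` at `x`, and `F z i x s`, `i : Fin m`, unbiased estimates of the constraint values
`fc z i.succ x` with total variance at most `σf²`. -/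
structure IsOracle {Ξ : Type*} [MeasurableSpace Ξ] (ν : Measure Ξ)
    (G : Rn n → Fin (m + 1) → Rn n → Ξ → Rn n) (F : Rn n → Fin m → Rn n → Ξ → ℝ) : Prop where
  meas_G : ∀ i, Measurable (fun q : Rn n × Rn n × Ξ => G q.1 i q.2.1 q.2.2)
  meas_F : ∀ i, Measurable (fun q : Rn n × Rn n × Ξ => F q.1 i q.2.1 q.2.2)
  integrable_G : ∀ z ∈ S.p.X, ∀ i, ∀ x ∈ S.p.X, Integrable (G z i x) ν
  integrable_F : ∀ z ∈ S.p.X, ∀ i, ∀ x ∈ S.p.X, Integrable (F z i x) ν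
  mean_G : ∀ z ∈ S.p.X, ∀ i, ∀ x ∈ S.p.X, ∫ s, G z i x s ∂ν ∈ subdiff S.p.X (S.fc z i) x
  mean_F : ∀ z ∈ S.p.X, ∀ i, ∀ x ∈ S.p.X, ∫ s, F z i x s ∂ν = S.fc z i.succ x
  var_G : ∀ z ∈ S.p.X, ∀ i, ∀ x ∈ S.p.X,
    ∫⁻ s, ENNReal.ofReal (dualNorm S.p.nrm (G z i x s - ∫ s', G z i x s' ∂ν) ^ 2) ∂ν
      ≤ ENNReal.ofReal (S.σ i ^ 2)
  var_F : ∀ z ∈ S.p.X, ∀ x ∈ S.p.X,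
    ∫⁻ s, ENNReal.ofReal (∑ i, (F z i x s - S.fc z i.succ x) ^ 2) ∂ν
      ≤ ENNReal.ofReal (S.σf ^ 2)

/-! Aggregate constants. The modulus of strong convexity `α₀` of the subproblem is `μ₀`. -/

def α₀ : ℝ := S.p.μ 0
def Lf : ℝ := Real.sqrt (∑ i : Fin m, S.L i.succ ^ 2)
def Hf : ℝ := Real.sqrt (∑ i : Fin m, S.H i.succ ^ 2)
def Mft : ℝ := Real.sqrt (∑ i : Fin m, S.Mf i ^ 2)
def Mχt : ℝ := Real.sqrt (∑ i : Fin m, S.Mχ i ^ 2)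
/-- `‖σ‖₂` for `σ = (σ₁, …, σ_m)`. -/
def σt : ℝ := Real.sqrt (∑ i : Fin m, S.σ i.succ ^ 2)
def σXf : ℝ := Real.sqrt (S.σf ^ 2 + S.p.DX ^ 2 * S.σt ^ 2)
def Mcal : ℝ := max (2 * S.Mft) (S.Mχt + S.Mft)
def t₀ (B : ℝ) : ℝ := 4 * (S.L 0 + B * S.Lf) / S.α₀ + 2

/-! Stepsizes for `T` iterations. -/

def γ (B : ℝ) (t : ℕ) : ℝ := t + S.t₀ B + 2
def η (B : ℝ) (t : ℕ) : ℝ := S.α₀ * (t + S.t₀ B + 1) / 2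
def θ (B : ℝ) (t : ℕ) : ℝ := (t + S.t₀ B + 1) / (t + S.t₀ B + 2)
def τ (B : ℝ) (T t : ℕ) : ℝ :=
  1 / ((t : ℝ) + 1) *
    max (max (32 * S.Mcal ^ 2 / S.α₀) (384 * S.σt ^ 2 * T / S.α₀))
      (S.σXf * (T : ℝ) ^ (3 / 2 : ℝ) / (B * Real.sqrt (S.t₀ B + 2)))

section Method

variable {Ξ : Type*} (G : Rn n → Fin (m + 1) → Rn n → Ξ → Rn n) (F : Rn n → Fin m → Rn n → Ξ → ℝ)

/-- `χᵢ(u_t) + ℓ_{F,i}(u_t)`, where `ℓ_F(u_{t+1}) = F(u_t, s̄_t) + G(u_t, s̄_t)ᵀ(u_{t+1} - u_t)` and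
`ℓ_F(u_0) = F(u_0, s̄_0)`. -/
def linVal (z : Rn n) (sbar : ℕ → Ξ) (u : ℕ → Rn n) (i : Fin m) : ℕ → ℝ
  | 0 => S.χc z i.succ (u 0) + F z i (u 0) (sbar 0)
  | t + 1 => S.χc z i.succ (u (t + 1)) + (F z i (u t) (sbar t)
      + ⟪G z i.succ (u t) (sbar t), u (t + 1) - u t⟫)

/-- `T` iterations of ConEx on the subproblem with centre `z`, from the primal point `u₀` and the dual
point `0`, using the samples `s`, `sbar`. At `t = 0`, `t - 1` is `0` in `ℕ`, which is the convention
`u_{-1} = u_0`, `ℓ_F(u_{-1}) = ℓ_F(u_0)`. -/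
structure IsConExTrace (B : ℝ) (T : ℕ) (z u₀ : Rn n) (s sbar : ℕ → Ξ) (u : ℕ → Rn n)
    (y : ℕ → Fin m → ℝ) : Prop where
  init_primal : u 0 = u₀
  init_dual : y 0 = 0
  dual_step : ∀ t < T, ∀ i, y (t + 1) i =
    max (y t i + 1 / S.τ B T t *
      ((1 + S.θ B t) * S.linVal G F z sbar u i t
        - S.θ B t * S.linVal G F z sbar u i (t - 1))) 0
  primal_mem : ∀ t < T, u (t + 1) ∈ S.p.X
  primal_step : ∀ t < T, IsMinOn (fun x => S.χc z 0 x + ∑ i : Fin m, y (t + 1) i * S.χc z i.succ x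
      + ⟪G z 0 (u t) (s t) + ∑ i : Fin m, y (t + 1) i • G z i.succ (u t) (s t), x⟫
      + S.η B t * S.p.W x (u t)) S.p.X (u (t + 1))

/-- `xout` is the output (weighted average of the primal iterates) of `T` iterations of ConEx. -/
def IsConExOutput (B : ℝ) (T : ℕ) (z u₀ : Rn n) (s sbar : ℕ → Ξ) (xout : Rn n) : Prop :=
  ∃ (u : ℕ → Rn n) (y : ℕ → Fin m → ℝ), S.IsConExTrace G F B T z u₀ s sbar u y ∧
    xout = (∑ t ∈ Finset.range T, S.γ B t)⁻¹ • ∑ t ∈ Finset.range T, S.γ B t • u (t + 1)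

end Method

/-! The iteration bound `T_ε` of ConEx; `Y` stands for the bound on the Euclidean norm of the optimal
dual solution. -/

def Hstar (B Y : ℝ) : ℝ :=
  S.H 0 + (Y + 1) * S.Hf + S.Lf * S.p.DX * max (Y + 1 - B) 0 / 2

def ζ (B Y : ℝ) : ℝ :=
  2 * Real.exp 1 * Real.sqrt (S.σ 0 ^ 2 + 12 * (S.t₀ B + 3) * S.σt ^ 2 * Y ^ 2
    + 96 * (S.t₀ B + 2) * B ^ 2 * S.σt ^ 2 + S.Hstar B Y ^ 2 / 2
    + 3 * S.α₀ * B * S.σXf * (S.t₀ B + 2) ^ (3 / 2 : ℝ) / 2)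

def Teps (B Y ε : ℝ) : ℝ :=
  max (max (max (max
    (Real.sqrt (5 * S.α₀ * (S.t₀ B + 2) * (S.t₀ B + 1) * S.p.DX ^ 2 / ε
      + 960 * (S.t₀ B + 2) * (Y + 1) ^ 2 * S.Mcal ^ 2 / (S.α₀ * ε)))
    ((65 * B * S.σXf * (S.t₀ B + 2) ^ (3 / 2 : ℝ) / ε) ^ (2 / 3 : ℝ)))
    (80 * (S.ζ B Y ^ 2 + S.Hstar B Y ^ 2 + 144 * (S.t₀ B + 2) * (Y + 1) ^ 2 * S.σt ^ 2)
      / (S.α₀ * ε)))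
    ((30 * (Y + 1) ^ 2 * S.σXf / B) ^ 2 * ((S.t₀ B + 2) / ε ^ 2)))
    ((130 * B * S.σXf / 3) ^ 2 * ((S.t₀ B + 2) / ε ^ 2))

end ConExSetup

end

/-!
# The inexact proximal point method with ConEx as inner solver

**The proximal point method.** Adding `2 μᵢ W(·, z)` to `ψᵢ` turns weak convexity into strong
convexity, so at a KKT pair `(x*, y*)` of the subproblem with centre `z` the Lagrangian grows
quadratically, with modulus `μ₀ + ∑ᵢ yᵢ* μᵢ`. Half this modulus times `‖z - x*‖²` is called
`Problem.proxGap`. Testing the growth at the centre, where the distance terms vanish, bounds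
`proxGap` by the decrease `ψ₀(z) - ψ₀*(z)` plus `B` times the violation at `z`
(`IsSubKKT.proxGap_le`). Since `ψᵢ ≤ ψᵢ(·; z)`, the decreases telescope along the method up to the
errors `δ` and `B δ̄` of the subproblems (`IsProxRun.sum_proxGap_le`). Conversely all residuals of
the original KKT conditions at `(x*, y*)` are multiples of `proxGap`: the pair satisfies the KKT
conditions of the subproblem exactly, and what remains comes from the distance terms, whose gradient
is Lipschitz and vanishes at the centre (`IsSubKKT.complementarity_le`,
`IsSubKKT.distZero_sq_le`). Testing the growth at the approximate solution bounds its distance to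
`x*` (`IsSubKKT.half_sq_le`). Averaging over the independent uniform index gives the first claim,
`IsProxRun.isStochKKT`.

**One run of ConEx, pathwise.** A run is an instance of a primal-dual scheme with extrapolation of
the linearized constraints. The three-point inequalities of the primal and of the dual step,
weighted by `γₜ`, telescope; the extrapolation cancels the coupling terms up to differences of
linearizations that the quadratic terms absorb (`ExtrapolationScheme.sum_gap_le`). Applied with the
saddle point, and with a multiplier of norm `Y + 1` pointing along the violation, this bounds the
optimality gap and the violation of the averaged output, and the distances `‖y* - yₜ‖²`, by one
quantity, `remainder` (`IsConExTrace.residuals_le`).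

**Expectations.** In the expectation of `remainder` the terms linear in the noise vanish, because
a fresh sample is independent of the iterates; the exception is the first constraint sample, which
is used twice and is estimated directly. The quadratic terms involve the second moment `yM` of the
dual iterates, which yields `remainderBound` (`StochasticTrace.integral_remainderVec_le`). The same
inequality bounds `yM` in terms of itself (`StochasticTrace.exists_dual_moment_bound`), and this
closes as soon as `T` exceeds a constant, since the dual step weight is of order `T^{3/2}` when the
constraints are noisy. Hence the expected remainder is `O(T^{3/2})` with noisy constraints and
`O(1) + O(T)` without, where the coefficient of `T` is controlled by `ε` times the third entry of
`T_ε`, while the total weight satisfies `Γ ≥ T² / 2`. So a fixed multiple of `T_ε` iterations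
suffices
(`exists_remainderBound_le`).

**Measurability.** Independence requires that the iterates be measurable functions of the samples
used so far, although a minimizer is not given by a formula. By strong convexity, the solution of a
subproblem and the solution of a primal step depend on their data in a Hölder continuous way
(`Standing.exists_sq_dist_subKKT_le`, `Valid.exists_sq_dist_prox_le`), and a function whose
squared increments are dominated by the increments of measurable data is measurable
(`measurable_of_sq_dist_le`).
-/

noncomputable section

/-! ### Norms and dual norms on `ℝⁿ` -/

section DualNorm

variable {n : ℕ} {nrm : Seminorm ℝ (Rn n)}

lemma seminorm_continuous (nrm : Seminorm ℝ (Rn n)) : Continuous nrm := by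
  have h := (nrm.convexOn).continuousOn isOpen_univ
  exact continuousOn_univ.mp h

lemma exists_norm_le_seminorm (hn : ∀ x, nrm x = 0 → x = 0) :
    ∃ c : ℝ, 0 < c ∧ ∀ x, ‖x‖ ≤ c * nrm x := by
  by_cases hne : (Metric.sphere (0 : Rn n) 1).Nonempty
  · obtain ⟨x0, hx0, hmin⟩ := (isCompact_sphere (0 : Rn n) 1).exists_isMinOn hne
      (seminorm_continuous nrm).continuousOn
    have hpos : 0 < nrm x0 := by
      rcases (apply_nonneg nrm x0).eq_or_lt with h | h
      · have := hn x0 h.symm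
        simp [this] at hx0
      · exact h
    refine ⟨(nrm x0)⁻¹, inv_pos.mpr hpos, fun x => ?_⟩
    rcases eq_or_ne x 0 with rfl | hx
    · simp
    have hx' : 0 < ‖x‖ := norm_pos_iff.mpr hx
    have h1 : nrm x0 ≤ nrm ((‖x‖)⁻¹ • x) := hmin (by simp [norm_smul, hx'.ne'])
    rw [map_smul_eq_mul, norm_inv, norm_norm] at h1
    rw [inv_mul_eq_div, le_div_iff₀ hpos]
    calc ‖x‖ * nrm x0 ≤ ‖x‖ * (‖x‖⁻¹ * nrm x) := by gcongr
      _ = nrm x := by field_simp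
  · refine ⟨1, one_pos, fun x => ?_⟩
    rcases eq_or_ne x 0 with rfl | hx
    · simp
    · exact absurd ⟨(‖x‖)⁻¹ • x, by simp [norm_smul, hx]⟩ hne

lemma exists_seminorm_le_norm (nrm : Seminorm ℝ (Rn n)) :
    ∃ c : ℝ, 0 < c ∧ ∀ x, nrm x ≤ c * ‖x‖ :=
  nrm.bound_of_continuous_normedSpace (seminorm_continuous nrm)

lemma dualNorm_bddAbove (hn : ∀ x, nrm x = 0 → x = 0) (z : Rn n) :
    BddAbove {r | ∃ x : Rn n, nrm x ≤ 1 ∧ r = ⟪z, x⟫} := by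
  obtain ⟨c, hc, h⟩ := exists_norm_le_seminorm hn
  refine ⟨‖z‖ * c, ?_⟩
  rintro _ ⟨x, hx, rfl⟩
  calc ⟪z, x⟫ ≤ ‖z‖ * ‖x‖ := real_inner_le_norm z x
    _ ≤ ‖z‖ * c := by
      gcongr
      exact (h x).trans (by nlinarith)

lemma dualNorm_nonneg (hn : ∀ x, nrm x = 0 → x = 0) (z : Rn n) : 0 ≤ dualNorm nrm z :=
  le_csSup (dualNorm_bddAbove hn z) ⟨0, by simp, by simp⟩

lemma inner_le_dualNorm_mul (hn : ∀ x, nrm x = 0 → x = 0) (z x : Rn n) :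
    ⟪z, x⟫ ≤ dualNorm nrm z * nrm x := by
  rcases (apply_nonneg nrm x).eq_or_lt with h | h
  · simp [hn x h.symm]
  · have h1 : ⟪z, (nrm x)⁻¹ • x⟫ ≤ dualNorm nrm z :=
      le_csSup (dualNorm_bddAbove hn z) ⟨_, by
        rw [map_smul_eq_mul, norm_inv, Real.norm_of_nonneg h.le, inv_mul_cancel₀ h.ne'], rfl⟩
    rw [real_inner_smul_right, inv_mul_le_iff₀ h] at h1
    linarith

lemma abs_inner_le_dualNorm_mul (hn : ∀ x, nrm x = 0 → x = 0) (z x : Rn n) :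
    |⟪z, x⟫| ≤ dualNorm nrm z * nrm x := by
  refine abs_le.mpr ⟨?_, inner_le_dualNorm_mul hn z x⟩
  have := inner_le_dualNorm_mul hn z (-x)
  rw [inner_neg_right, map_neg_eq_map] at this
  linarith

lemma dualNorm_le {z : Rn n} {c : ℝ} (h : ∀ x, nrm x ≤ 1 → ⟪z, x⟫ ≤ c) : dualNorm nrm z ≤ c := by
  refine csSup_le ⟨0, 0, by simp, by simp⟩ ?_
  rintro _ ⟨x, hx, rfl⟩
  exact h x hx

lemma dualNorm_add_le (hn : ∀ x, nrm x = 0 → x = 0) (z w : Rn n) :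
    dualNorm nrm (z + w) ≤ dualNorm nrm z + dualNorm nrm w := by
  refine dualNorm_le fun x hx => ?_
  rw [inner_add_left]
  have h1 := inner_le_dualNorm_mul hn z x
  have h2 := inner_le_dualNorm_mul hn w x
  have h3 := dualNorm_nonneg hn z
  have h4 := dualNorm_nonneg hn w
  nlinarith [apply_nonneg nrm x]

lemma dualNorm_smul_le (hn : ∀ x, nrm x = 0 → x = 0) (c : ℝ) (z : Rn n) :
    dualNorm nrm (c • z) ≤ |c| * dualNorm nrm z := by
  refine dualNorm_le fun x hx => ?_
  rw [real_inner_smul_left]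
  calc c * ⟪z, x⟫ ≤ |c * ⟪z, x⟫| := le_abs_self _
    _ = |c| * |⟪z, x⟫| := abs_mul _ _
    _ ≤ |c| * (dualNorm nrm z * 1) := by
      gcongr
      exact (abs_inner_le_dualNorm_mul hn z x).trans
        (mul_le_mul_of_nonneg_left hx (dualNorm_nonneg hn z))
    _ = |c| * dualNorm nrm z := by ring

@[simp] lemma dualNorm_zero : dualNorm nrm (0 : Rn n) = 0 := by
  apply le_antisymm
  · exact dualNorm_le fun x _ => by simp
  · refine le_csSup ⟨0, ?_⟩ ⟨0, by simp, by simp⟩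
    rintro _ ⟨x, _, rfl⟩
    simp

lemma dualNorm_sum_le (hn : ∀ x, nrm x = 0 → x = 0) {ι : Type*} (s : Finset ι) (g : ι → Rn n) :
    dualNorm nrm (∑ i ∈ s, g i) ≤ ∑ i ∈ s, dualNorm nrm (g i) := by
  classical
  induction s using Finset.induction_on with
  | empty => simp
  | insert i s hi ih =>
    rw [Finset.sum_insert hi, Finset.sum_insert hi]
    exact (dualNorm_add_le hn _ _).trans (by gcongr)

lemma exists_dualNorm_le_norm (hn : ∀ x, nrm x = 0 → x = 0) :
    ∃ c : ℝ, 0 < c ∧ ∀ z : Rn n, dualNorm nrm z ≤ c * ‖z‖ := by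
  obtain ⟨c, hc, h⟩ := exists_norm_le_seminorm hn
  refine ⟨c, hc, fun z => dualNorm_le fun x hx => ?_⟩
  calc ⟪z, x⟫ ≤ ‖z‖ * ‖x‖ := real_inner_le_norm z x
    _ ≤ ‖z‖ * c := by
      gcongr
      exact (h x).trans (by nlinarith)
    _ = c * ‖z‖ := mul_comm _ _

lemma exists_norm_le_dualNorm (hn : ∀ x, nrm x = 0 → x = 0) :
    ∃ c : ℝ, 0 < c ∧ ∀ z : Rn n, ‖z‖ ≤ c * dualNorm nrm z := by
  obtain ⟨c, hc, h⟩ := exists_seminorm_le_norm nrm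
  refine ⟨c, hc, fun z => ?_⟩
  rcases eq_or_ne z 0 with rfl | hz
  · simp
  have hz' : 0 < ‖z‖ := norm_pos_iff.mpr hz
  have h1 := inner_le_dualNorm_mul hn z z
  rw [real_inner_self_eq_norm_sq] at h1
  have h2 : dualNorm nrm z * nrm z ≤ dualNorm nrm z * (c * ‖z‖) :=
    mul_le_mul_of_nonneg_left (h z) (dualNorm_nonneg hn z)
  have h3 : ‖z‖ * ‖z‖ ≤ (c * dualNorm nrm z) * ‖z‖ := by nlinarith
  exact le_of_mul_le_mul_right h3 hz'

lemma continuous_dualNorm (hn : ∀ x, nrm x = 0 → x = 0) : Continuous (dualNorm nrm) := by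
  obtain ⟨c, hc, h⟩ := exists_dualNorm_le_norm hn
  refine (LipschitzWith.of_le_add_mul (Real.toNNReal c) fun x y => ?_).continuous
  rw [Real.coe_toNNReal c hc.le, dist_eq_norm]
  have h1 := dualNorm_add_le hn y (x - y)
  rw [add_sub_cancel] at h1
  linarith [h (x - y)]

end DualNorm

/-! ### Subgradients and the proximal subproblems -/

section Subdifferential

variable {n : ℕ} {X : Set (Rn n)} {h : Rn n → ℝ}

/-- Every element of `subdiff X h x` is a subgradient of `h` at `x`; at relative boundary points the
limit of subgradients is again one because `h` is lower semicontinuous. -/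
lemma subgradient_of_mem_subdiff (hl : LowerSemicontinuousOn h X) {x g : Rn n}
    (hg : g ∈ subdiff X h x) {y : Rn n} (hy : y ∈ X) : h x + ⟪g, y - x⟫ ≤ h y := by
  rcases hg with ⟨_, hg⟩ | ⟨hx, xi, gi, hi, hxi, hgi⟩
  · exact hg.2 y hy
  · by_contra! hlt
    obtain ⟨c, hc1, hc2⟩ := exists_between (sub_lt_iff_lt_add.mpr hlt)
    have hev := hl x hx.1 c hc2
    have ht : Filter.Tendsto xi Filter.atTop (nhdsWithin x X) :=
      tendsto_nhdsWithin_iff.mpr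
        ⟨hxi, Filter.Eventually.of_forall fun j => intrinsicInterior_subset (hi j).1⟩
    have hlim : Filter.Tendsto (fun j => h y - ⟪gi j, y - xi j⟫) Filter.atTop
        (nhds (h y - ⟪g, y - x⟫)) :=
      tendsto_const_nhds.sub (hgi.inner (tendsto_const_nhds.sub hxi))
    have : c ≤ h y - ⟪g, y - x⟫ := by
      refine ge_of_tendsto hlim ((ht.eventually hev).mono fun j hj => ?_)
      have := (hi j).2.2 y hy
      linarith
    linarith

lemma exists_pos_sub_smul_mem_of_mem_intrinsicInterior {x y : Rn n}
    (hx : x ∈ intrinsicInterior ℝ X) (hy : y ∈ X) : ∃ s : ℝ, 0 < s ∧ x - s • (y - x) ∈ X := by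
  obtain ⟨x', hx', rfl⟩ := mem_intrinsicInterior.mp hx
  let φ : ℝ → affineSpan ℝ X := fun s =>
    ⟨AffineMap.lineMap (x' : Rn n) y s,
      AffineMap.lineMap_mem s x'.2 (subset_affineSpan ℝ X hy)⟩
  have hφ : Continuous φ := Continuous.subtype_mk AffineMap.lineMap_continuous _
  have h0 : φ 0 = x' := Subtype.ext (by simp [φ])
  have hmem : φ ⁻¹' interior ((↑) ⁻¹' X : Set (affineSpan ℝ X)) ∈ nhds (0 : ℝ) :=
    (isOpen_interior.preimage hφ).mem_nhds (by simpa [h0] using hx')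
  obtain ⟨r, hr, hball⟩ := Metric.mem_nhds_iff.mp hmem
  have hm : φ (-(r / 2)) ∈ interior ((↑) ⁻¹' X : Set (affineSpan ℝ X)) :=
    hball (by rw [Metric.mem_ball, dist_zero_right, norm_neg, Real.norm_of_nonneg] <;> linarith)
  refine ⟨r / 2, by positivity, ?_⟩
  have h2 : φ (-(r / 2)) ∈ ((↑) ⁻¹' X : Set (affineSpan ℝ X)) := interior_subset hm
  have h2' : (φ (-(r / 2)) : Rn n) ∈ X := h2
  simpa [φ, AffineMap.lineMap_apply, sub_eq_add_neg, add_comm] using h2'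

/-- Subgradients in the linear span of `X - X` inherit the Lipschitz constant of the function, in
every direction pointing from `x` to a point of `X`. -/
lemma abs_inner_le_of_mem_subdiff {nrm : Seminorm ℝ (Rn n)} {M : ℝ}
    (hM : ∀ x₁ ∈ X, ∀ x₂ ∈ X, h x₁ - h x₂ ≤ M * nrm (x₁ - x₂)) {x g : Rn n}
    (hg : g ∈ subdiff X h x) {y : Rn n} (hy : y ∈ X) : |⟪g, y - x⟫| ≤ M * nrm (y - x) := by
  have key : ∀ x ∈ intrinsicInterior ℝ X, ∀ g ∈ spanSubgrad X h x,
      |⟪g, y - x⟫| ≤ M * nrm (y - x) := by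
    intro x hx g hg
    have hxX := intrinsicInterior_subset hx
    obtain ⟨s, hs, hm⟩ := exists_pos_sub_smul_mem_of_mem_intrinsicInterior hx hy
    refine abs_le.mpr ⟨?_, ?_⟩
    · have h1 := hg.2 _ hm
      have h2 := hM _ hm _ hxX
      have e : x - s • (y - x) - x = -(s • (y - x)) := by abel
      rw [e, inner_neg_right, real_inner_smul_right] at h1
      rw [e, map_neg_eq_map, map_smul_eq_mul, Real.norm_of_nonneg hs.le] at h2
      have h3 : s * (-(M * nrm (y - x))) ≤ s * ⟪g, y - x⟫ := by linarith
      exact le_of_mul_le_mul_left h3 hs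
    · have h1 := hg.2 _ hy
      have h2 := hM _ hy _ hxX
      linarith
  rcases hg with ⟨hx, hg⟩ | ⟨hx, xi, gi, hi, hxi, hgi⟩
  · exact key x hx g hg
  · have l1 : Filter.Tendsto (fun j => |⟪gi j, y - xi j⟫|) Filter.atTop (nhds |⟪g, y - x⟫|) :=
      (hgi.inner (tendsto_const_nhds.sub hxi)).abs
    have l2 : Filter.Tendsto (fun j => M * nrm (y - xi j)) Filter.atTop
        (nhds (M * nrm (y - x))) :=
      (((seminorm_continuous nrm).tendsto _).comp (tendsto_const_nhds.sub hxi)).const_mul M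
    exact le_of_tendsto_of_tendsto' l1 l2 fun j => key _ (hi j).1 _ (hi j).2

/-- A function that has a subgradient at every point of a convex set is convex there. -/
lemma convexOn_of_forall_exists_subgradient (hX : Convex ℝ X)
    (hs : ∀ y ∈ X, ∃ g : Rn n, ∀ x ∈ X, h y + ⟪g, x - y⟫ ≤ h x) : ConvexOn ℝ X h := by
  refine ⟨hX, fun x hx y hy a b ha hb hab => ?_⟩
  obtain ⟨g, hg⟩ := hs _ (hX hx hy ha hb hab)
  have h1 := mul_le_mul_of_nonneg_left (hg x hx) ha
  have h2 := mul_le_mul_of_nonneg_left (hg y hy) hb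
  have e : a * ⟪g, x - (a • x + b • y)⟫ + b * ⟪g, y - (a • x + b • y)⟫ = 0 := by
    have : a • (x - (a • x + b • y)) + b • (y - (a • x + b • y)) = 0 := by
      have : b = 1 - a := by linarith
      subst this
      module
    rw [← real_inner_smul_right, ← real_inner_smul_right, ← inner_add_right, this,
      inner_zero_right]
  simp only [smul_eq_mul]
  have : (a + b) * h (a • x + b • y) = h (a • x + b • y) := by rw [hab, one_mul]
  nlinarith

end Subdifferential

namespace Problem

variable {n m : ℕ} {p : Problem n m}

namespace Standing

lemma μ_nonneg (H : p.Standing) (i : Fin (m + 1)) : 0 ≤ p.μ i := by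
  refine Fin.cases H.μ_zero.le (fun i => H.μ_succ i) i

lemma continuousOn_f (H : p.Standing) (i : Fin (m + 1)) : ContinuousOn (p.f i) p.X :=
  fun x hx => (H.hasGrad_f i x hx).continuousWithinAt

lemma continuousOn_dgf (H : p.Standing) : ContinuousOn p.dgf p.X :=
  fun x hx => (H.hasGrad_dgf x hx).continuousWithinAt

lemma continuousOn_gradDgf (H : p.Standing) : ContinuousOn p.gradDgf p.X := by
  obtain ⟨c, hc, h⟩ := exists_norm_le_dualNorm H.norm_definite
  obtain ⟨d, hd, h'⟩ := exists_seminorm_le_norm p.nrm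
  refine (LipschitzOnWith.of_dist_le_mul (K := Real.toNNReal (c * (p.Lω * d)))
    fun x hx y hy => ?_).continuousOn
  have hL := H.Lω_pos
  rw [Real.coe_toNNReal _ (by positivity), dist_eq_norm, dist_eq_norm]
  calc ‖p.gradDgf x - p.gradDgf y‖ ≤ c * (p.Lω * p.nrm (x - y)) :=
        (h _).trans (by gcongr; exact H.smooth_dgf x hx y hy)
    _ ≤ c * (p.Lω * (d * ‖x - y‖)) := by gcongr; exact h' _
    _ = _ := by ring

lemma lsc_χ' (H : p.Standing) (i : Fin (m + 1)) : LowerSemicontinuousOn (p.χ i) p.X := by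
  refine Fin.cases H.lsc_χ (fun i => (H.cont_χ i).lowerSemicontinuousOn) i

lemma half_sq_le_W (H : p.Standing) {x z : Rn n} (hx : x ∈ p.X) (hz : z ∈ p.X) :
    1 / 2 * p.nrm (x - z) ^ 2 ≤ p.W x z := by
  have := H.strong_dgf x hx z hz
  unfold W
  linarith

lemma W_nonneg (H : p.Standing) {x z : Rn n} (hx : x ∈ p.X) (hz : z ∈ p.X) : 0 ≤ p.W x z :=
  le_trans (by positivity) (H.half_sq_le_W hx hz)

end Standing

lemma W_three_point (p : Problem n m) (x y z : Rn n) :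
    p.W x z = p.W y z + ⟪p.gradDgf y - p.gradDgf z, x - y⟫ + p.W x y := by
  have e : x - z = (x - y) + (y - z) := by abel
  unfold W
  rw [e, inner_add_right, inner_sub_left]
  ring

@[simp] lemma W_self (p : Problem n m) (x : Rn n) : p.W x x = 0 := by simp [W]

namespace Standing

/-- The upper quadratic bound that goes with a Lipschitz continuous gradient. -/
lemma W_le (H : p.Standing) {x z : Rn n} (hx : x ∈ p.X) (hz : z ∈ p.X) :
    p.W x z ≤ p.Lω / 2 * p.nrm (x - z) ^ 2 := by
  set d := x - z with hd
  have hmem : ∀ s ∈ Set.Icc (0 : ℝ) 1, z + s • d ∈ p.X := fun s hs =>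
    H.convex_X.add_smul_sub_mem hz hx hs
  have hline : ∀ s : ℝ, HasDerivAt (fun s : ℝ => z + s • d) d s := fun s => by
    simpa using ((hasDerivAt_id s).smul_const d).const_add z
  let q : ℝ → ℝ := fun s => p.dgf (z + s • d) - s * ⟪p.gradDgf z, d⟫
    - p.Lω / 2 * p.nrm d ^ 2 * s ^ 2
  have hder : ∀ s ∈ Set.Ioo (0 : ℝ) 1, HasDerivAt q
      (⟪p.gradDgf (z + s • d), d⟫ - 1 * ⟪p.gradDgf z, d⟫
        - p.Lω / 2 * p.nrm d ^ 2 * (((2 : ℕ) : ℝ) * s ^ (2 - 1))) s := by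
    intro s hs
    have hs' : s ∈ Set.Icc (0 : ℝ) 1 := ⟨hs.1.le, hs.2.le⟩
    have h1 : HasDerivWithinAt (fun s : ℝ => p.dgf (z + s • d)) ⟪p.gradDgf (z + s • d), d⟫
        (Set.Icc 0 1) s := by
      have := (H.hasGrad_dgf _ (hmem s hs')).hasFDerivWithinAt.comp_hasDerivWithinAt s
        (hline s).hasDerivWithinAt (fun s hs => hmem s hs)
      simpa [Function.comp_def] using this
    exact ((h1.hasDerivAt (Icc_mem_nhds hs.1 hs.2)).sub
      ((hasDerivAt_id s).mul_const _)).sub ((hasDerivAt_pow 2 s).const_mul _)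
  have hcont : ContinuousOn q (Set.Icc 0 1) := by
    refine ContinuousOn.sub (ContinuousOn.sub ?_ ?_) ?_
    · exact H.continuousOn_dgf.comp (by fun_prop) (fun s hs => hmem s hs)
    · fun_prop
    · fun_prop
  have hanti : AntitoneOn q (Set.Icc 0 1) := by
    refine antitoneOn_of_deriv_nonpos (convex_Icc 0 1) hcont ?_ ?_
    · rw [interior_Icc]
      exact fun s hs => (hder s hs).differentiableAt.differentiableWithinAt
    · rw [interior_Icc]
      intro s hs
      rw [(hder s hs).deriv]
      have hs' : s ∈ Set.Icc (0 : ℝ) 1 := ⟨hs.1.le, hs.2.le⟩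
      have h1 : ⟪p.gradDgf (z + s • d) - p.gradDgf z, d⟫ ≤ p.Lω * (s * p.nrm d) * p.nrm d := by
        refine (inner_le_dualNorm_mul H.norm_definite _ _).trans ?_
        gcongr
        refine (H.smooth_dgf _ (hmem s hs') _ hz).trans ?_
        rw [add_sub_cancel_left, map_smul_eq_mul, Real.norm_of_nonneg hs.1.le]
      rw [inner_sub_left] at h1
      norm_num
      nlinarith
  have := hanti (Set.left_mem_Icc.mpr zero_le_one) (Set.right_mem_Icc.mpr zero_le_one) zero_le_one
  simp only [q, one_smul, zero_smul, add_zero] at this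
  have e : z + d = x := by rw [hd]; abel
  rw [e] at this
  unfold W
  rw [← hd]
  linarith

/-- Subproblem functions are strongly convex: after adding `2 μᵢ W(·, z)` to a function of lower
curvature `μᵢ`, a modulus `μᵢ` is left. -/
lemma ψc_strong (H : p.Standing) {z x x' : Rn n} (hx : x ∈ p.X)
    (hx' : x' ∈ p.X) {i : Fin (m + 1)} {g : Rn n} (hg : g ∈ p.subψc z i x) :
    p.ψc z i x + ⟪g, x' - x⟫ + p.μ i / 2 * p.nrm (x' - x) ^ 2 ≤ p.ψc z i x' := by
  obtain ⟨_, ⟨v, hv, rfl⟩, rfl⟩ := hg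
  have h1 := subgradient_of_mem_subdiff (H.lsc_χ' i) hv hx'
  have h2 := H.curvature_f i x' hx' x hx
  have h3 := p.W_three_point x' x z
  have h4 := mul_le_mul_of_nonneg_left (H.half_sq_le_W hx' hx) (H.μ_nonneg i)
  unfold ψc ψ
  rw [inner_add_left, inner_add_left, real_inner_smul_left, h3]
  linarith

end Standing

/-- Strong convexity of the Lagrangian of a subproblem at a primal-dual pair. -/
lemma IsSubKKT.lagrangian_strong (H : p.Standing) {z x : Rn n} {y : Fin m → ℝ}
    (hk : p.IsSubKKT z x y) {x' : Rn n} (hx' : x' ∈ p.X) :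
    p.ψc z 0 x + (p.μ 0 + ∑ i : Fin m, y i * p.μ i.succ) / 2 * p.nrm (x' - x) ^ 2
      ≤ p.ψc z 0 x' + ∑ i : Fin m, y i * p.ψc z i.succ x' := by
  have hN : 0 ≤ p.nrm (x' - x) := apply_nonneg _ _
  -- the set of Lagrangian gradients is only known to have zero distance to the origin
  have key : ∀ e : ℝ, 0 < e →
      p.ψc z 0 x + (p.μ 0 + ∑ i : Fin m, y i * p.μ i.succ) / 2 * p.nrm (x' - x) ^ 2
      ≤ p.ψc z 0 x' + ∑ i : Fin m, y i * p.ψc z i.succ x' + e * p.nrm (x' - x) := by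
    intro e he
    have hlt : distZero p.nrm (p.lagrangianSet (fun i => p.subψc z i x) x y) < ENNReal.ofReal e := by
      rw [hk.stationary]; exact ENNReal.ofReal_pos.mpr he
    unfold distZero at hlt
    obtain ⟨g, hlt⟩ := iInf_lt_iff.mp hlt
    obtain ⟨hg, hge⟩ := iInf_lt_iff.mp hlt
    have hge' : dualNorm p.nrm g ≤ e := (ENNReal.ofReal_lt_ofReal_iff he).mp hge |>.le
    obtain ⟨v, hv, u, hu, rfl⟩ := hg
    have h0 := H.ψc_strong hk.mem hx' (hv 0)
    have hi : ∑ i : Fin m, y i * (p.ψc z i.succ x + ⟪v i.succ, x' - x⟫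
        + p.μ i.succ / 2 * p.nrm (x' - x) ^ 2) ≤ ∑ i : Fin m, y i * p.ψc z i.succ x' :=
      Finset.sum_le_sum fun i _ =>
        mul_le_mul_of_nonneg_left (H.ψc_strong hk.mem hx' (hv i.succ)) (hk.nonneg i)
    have hc : ∑ i : Fin m, y i * (p.ψc z i.succ x + ⟪v i.succ, x' - x⟫
        + p.μ i.succ / 2 * p.nrm (x' - x) ^ 2)
        = ∑ i : Fin m, y i * ⟪v i.succ, x' - x⟫
          + (∑ i : Fin m, y i * p.μ i.succ) / 2 * p.nrm (x' - x) ^ 2 := by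
      rw [Finset.sum_div, Finset.sum_mul, ← Finset.sum_add_distrib]
      refine Finset.sum_congr rfl fun i _ => ?_
      have := hk.compl i
      linear_combination this
    have hgi := abs_le.mp (abs_inner_le_dualNorm_mul H.norm_definite
      (v 0 + ∑ i : Fin m, y i • v i.succ + u) (x' - x)) |>.1
    have hu' := hu x' hx'
    rw [inner_add_left, inner_add_left, sum_inner] at hgi
    simp only [real_inner_smul_left] at hgi
    have := mul_le_mul_of_nonneg_right hge' hN
    linarith
  refine le_of_forall_pos_le_add fun e he => ?_
  have := key (e / (p.nrm (x' - x) + 1)) (by positivity)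
  have h2 : e / (p.nrm (x' - x) + 1) * p.nrm (x' - x) ≤ e := by
    rw [div_mul_eq_mul_div, div_le_iff₀ (by positivity)]
    nlinarith
  linarith

lemma IsSubKKT.sum_mul_nonneg (H : p.Standing) {z x : Rn n} {y : Fin m → ℝ}
    (hk : p.IsSubKKT z x y) : 0 ≤ ∑ i : Fin m, y i * p.μ i.succ :=
  Finset.sum_nonneg fun i _ => mul_nonneg (hk.nonneg i) (H.μ_succ i)

/-- The primal part of a primal-dual pair solves the subproblem. -/
lemma IsSubKKT.subOpt_eq (H : p.Standing) {z x : Rn n} {y : Fin m → ℝ}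
    (hk : p.IsSubKKT z x y) : p.subOpt z = p.ψc z 0 x := by
  refine IsLeast.csInf_eq ⟨⟨x, ⟨hk.mem, hk.feasible⟩, rfl⟩, ?_⟩
  rintro _ ⟨x', ⟨hx', hf⟩, rfl⟩
  have h1 := hk.lagrangian_strong H hx'
  have h2 : ∑ i : Fin m, y i * p.ψc z i.succ x' ≤ 0 :=
    Finset.sum_nonpos fun i _ => mul_nonpos_of_nonneg_of_nonpos (hk.nonneg i) (hf i)
  have h3 := hk.sum_mul_nonneg H
  have h4 := H.μ_zero
  have : 0 ≤ (p.μ 0 + ∑ i : Fin m, y i * p.μ i.succ) / 2 * p.nrm (x' - x) ^ 2 := by positivity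
  linarith

lemma sum_mul_le_sqrt_sum_max_sq {ι : Type*} [Fintype ι] {y : ι → ℝ} (hy : ∀ i, 0 ≤ y i)
    (v : ι → ℝ) : ∑ i, y i * v i ≤ Real.sqrt (∑ i, y i ^ 2) * Real.sqrt (∑ i, (max (v i) 0) ^ 2) :=
  (Finset.sum_le_sum fun i _ => mul_le_mul_of_nonneg_left (le_max_left (v i) 0) (hy i)).trans
    (Real.sum_mul_le_sqrt_mul_sqrt _ _ _)

lemma sqrt_sum_sq_le_sum_abs {ι : Type*} [Fintype ι] (y : ι → ℝ) :
    Real.sqrt (∑ i, y i ^ 2) ≤ ∑ i, |y i| := by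
  refine Real.sqrt_le_iff.mpr ⟨Finset.sum_nonneg fun i _ => abs_nonneg _, ?_⟩
  calc ∑ i, y i ^ 2 = ∑ i, |y i| ^ 2 := by simp
    _ ≤ (∑ i, |y i|) ^ 2 := Finset.sum_sq_le_sq_sum_of_nonneg fun i _ => abs_nonneg _

end Problem

/-! ### The inexact proximal point method -/

lemma upperExp_le {Ω : Type*} [MeasurableSpace Ω] {P : Measure Ω} {h g : Ω → ℝ≥0∞}
    (hg : Measurable g) (hle : ∀ a, h a ≤ g a) : upperExp P h ≤ ∫⁻ a, g a ∂P :=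
  iInf_le_of_le g (iInf_le_of_le hg (iInf_le_of_le hle le_rfl))

/-- Expectation of a quantity read off at an independent, uniformly distributed time. -/
lemma lintegral_comp_uniform_index {Ω α : Type*} [MeasurableSpace Ω] [MeasurableSpace α]
    {P : Measure Ω} {K : ℕ} {khat : Ω → ℕ} {Z : Ω → α}
    (hk : Measurable khat) (hZ : Measurable Z)
    (hmem : ∀ a, khat a ∈ Finset.Icc 1 K)
    (hunif : ∀ k ∈ Finset.Icc 1 K, P {a | khat a = k} = (K : ℝ≥0∞)⁻¹)
    (hind : IndepFun khat Z P) {φ : ℕ → α → ℝ≥0∞} (hφ : ∀ k, Measurable (φ k)) :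
    ∫⁻ a, φ (khat a) (Z a) ∂P = (K : ℝ≥0∞)⁻¹ * ∑ k ∈ Finset.Icc 1 K, ∫⁻ a, φ k (Z a) ∂P := by
  classical
  let ι : ℕ → ℕ → ℝ≥0∞ := fun k j => if j = k then 1 else 0
  have hsplit : ∀ a, φ (khat a) (Z a) = ∑ k ∈ Finset.Icc 1 K, ι k (khat a) * φ k (Z a) := by
    intro a
    rw [Finset.sum_eq_single_of_mem _ (hmem a)]
    · simp [ι]
    · intro k _ hne
      simp [ι, hne.symm]
  have hι : ∀ k, Measurable (ι k) := fun k => measurable_from_top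
  simp_rw [hsplit]
  have hterm : ∀ k, Measurable fun a => ι k (khat a) * φ k (Z a) := fun k =>
    ((hι k).comp hk).mul ((hφ k).comp hZ)
  rw [lintegral_finsetSum _ fun k _ => hterm k, Finset.mul_sum]
  refine Finset.sum_congr rfl fun k hkK => ?_
  have h1 := lintegral_mul_eq_lintegral_mul_lintegral_of_indepFun ((hι k).comp hk)
    ((hφ k).comp hZ) (hind.comp (hι k) (hφ k))
  simp only [Function.comp_def, Pi.mul_apply] at h1
  rw [h1, ← hunif k hkK]
  congr 1
  have : (fun a => ι k (khat a)) = Set.indicator {a | khat a = k} 1 := by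
    ext a
    simp [ι, Set.indicator_apply]
  rw [this]
  exact lintegral_indicator_one (hk (measurableSet_singleton k))

namespace Problem

variable {n m : ℕ} {p : Problem n m}

lemma μ_le_μmax (p : Problem n m) (i : Fin m) : p.μ i.succ ≤ p.μmax :=
  le_ciSup (f := fun i : Fin m => p.μ i.succ) (Set.finite_range _).bddAbove i

lemma Standing.μmax_nonneg (H : p.Standing) : 0 ≤ p.μmax :=
  Real.iSup_nonneg fun i => H.μ_succ i

lemma Standing.c1_pos (H : p.Standing) (B : ℝ) : 0 < p.c1 B :=
  lt_max_of_lt_left (by linarith [H.Lω_pos])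

lemma Standing.ψ_le_ψc (H : p.Standing) {z x : Rn n} (hz : z ∈ p.X) (hx : x ∈ p.X)
    (i : Fin (m + 1)) : p.ψ i x ≤ p.ψc z i x := by
  have := mul_nonneg (H.μ_nonneg i) (H.W_nonneg hx hz)
  unfold ψc
  linarith

lemma Standing.Δbar_le_subViol (H : p.Standing) {z x : Rn n} (hz : z ∈ p.X) (hx : x ∈ p.X) :
    p.Δbar x ≤ p.subViol z x := by
  unfold Δbar subViol
  gcongr with i
  exact H.ψ_le_ψc hz hx i.succ

@[simp] lemma ψc_self (p : Problem n m) (z : Rn n) (i : Fin (m + 1)) : p.ψc z i z = p.ψ i z := by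
  simp [ψc]

/-- Half the modulus of the Lagrangian times the squared distance between the centre and the
solution of its subproblem; it controls all residuals of the KKT conditions. -/
def proxGap (p : Problem n m) (z x : Rn n) (y : Fin m → ℝ) : ℝ :=
  (p.μ 0 + ∑ i : Fin m, y i * p.μ i.succ) / 2 * p.nrm (z - x) ^ 2

lemma IsSubKKT.proxGap_nonneg (H : p.Standing) {z x : Rn n} {y : Fin m → ℝ}
    (hk : p.IsSubKKT z x y) : 0 ≤ p.proxGap z x y := by
  have h3 := hk.sum_mul_nonneg H
  have h4 := H.μ_zero
  unfold proxGap
  positivity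

/-- Strong convexity of the Lagrangian, tested at the centre. The distance terms vanish there, so the
violation of the proximal constraints is that of the original ones. -/
lemma IsSubKKT.proxGap_le (H : p.Standing) {z x : Rn n} {y : Fin m → ℝ} {B : ℝ}
    (hk : p.IsSubKKT z x y) (hB : ∑ i, |y i| ≤ B) (hz : z ∈ p.X) :
    p.proxGap z x y ≤ p.ψ 0 z - p.subOpt z + B * p.Δbar z := by
  have h1 := hk.lagrangian_strong H hz
  have h2 := sum_mul_le_sqrt_sum_max_sq hk.nonneg (fun i => p.ψc z i.succ z)
  have h3 : Real.sqrt (∑ i, y i ^ 2) * p.Δbar z ≤ B * p.Δbar z :=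
    mul_le_mul_of_nonneg_right ((sqrt_sum_sq_le_sum_abs y).trans hB) (Real.sqrt_nonneg _)
  rw [hk.subOpt_eq H]
  simp only [ψc_self] at h1 h2
  unfold proxGap
  unfold Δbar at h3 ⊢
  linarith

/-- An approximate solution of the subproblem is close to its KKT point: strong convexity of the
Lagrangian, tested at the approximate solution. -/
lemma IsSubKKT.half_sq_le (H : p.Standing) {z x x' : Rn n} {y : Fin m → ℝ} {B : ℝ}
    (hk : p.IsSubKKT z x y) (hB : ∑ i, |y i| ≤ B) (hx' : x' ∈ p.X) :
    p.μ 0 / 2 * p.nrm (x' - x) ^ 2 ≤ p.ψc z 0 x' - p.subOpt z + B * p.subViol z x' := by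
  have h1 := hk.lagrangian_strong H hx'
  have h2 := sum_mul_le_sqrt_sum_max_sq hk.nonneg (fun i => p.ψc z i.succ x')
  have h3 : Real.sqrt (∑ i, y i ^ 2) * p.subViol z x' ≤ B * p.subViol z x' :=
    mul_le_mul_of_nonneg_right ((sqrt_sum_sq_le_sum_abs y).trans hB) (Real.sqrt_nonneg _)
  have h4 := mul_nonneg (hk.sum_mul_nonneg H) (sq_nonneg (p.nrm (x' - x)))
  rw [hk.subOpt_eq H]
  unfold subViol at h3 ⊢
  linarith

/-- Complementarity holds exactly for the proximal constraints, so for the original ones it fails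
only by the distance term. -/
lemma IsSubKKT.complementarity_le (H : p.Standing) {z x : Rn n} {y : Fin m → ℝ}
    (hk : p.IsSubKKT z x y) (hz : z ∈ p.X) :
    ∑ i : Fin m, |y i * p.ψ i.succ x| ≤ 2 * p.Lω * p.proxGap z x y := by
  have hW := H.W_le hk.mem hz
  have h1 : ∀ i : Fin m, |y i * p.ψ i.succ x| = 2 * (y i * p.μ i.succ) * p.W x z := by
    intro i
    have hc := hk.compl i
    have hn : 0 ≤ y i * p.μ i.succ * p.W x z :=
      mul_nonneg (mul_nonneg (hk.nonneg i) (H.μ_succ i)) (H.W_nonneg hk.mem hz)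
    have e : y i * p.ψ i.succ x = -(2 * (y i * p.μ i.succ) * p.W x z) := by
      unfold ψc at hc
      linear_combination hc
    rw [e, abs_neg, abs_of_nonneg (by linarith)]
  have h3 := hk.sum_mul_nonneg H
  have h4 := mul_le_mul_of_nonneg_left hW h3
  have h5 : 0 ≤ p.Lω * p.μ 0 * p.nrm (x - z) ^ 2 := by
    have := H.Lω_pos
    have := H.μ_zero
    positivity
  simp_rw [h1]
  rw [← Finset.sum_mul, ← Finset.mul_sum]
  unfold proxGap
  rw [map_sub_rev p.nrm z x]
  linarith

/-- Stationarity holds exactly for the proximal Lagrangian, so for the original one the residual is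
the gradient of the distance terms, which is Lipschitz and vanishes at the centre. -/
lemma IsSubKKT.distZero_sq_le (H : p.Standing) {z x : Rn n} {y : Fin m → ℝ} {B : ℝ}
    (hk : p.IsSubKKT z x y) (hB : ∑ i, |y i| ≤ B) (hz : z ∈ p.X) :
    distZero p.nrm (p.lagrangianSet (fun i => p.subψ i x) x y) ^ 2
      ≤ ENNReal.ofReal (8 * p.Lω ^ 2 * (p.μ 0 + p.μmax * B) * p.proxGap z x y) := by
  set s := ∑ i : Fin m, y i * p.μ i.succ with hs
  have hs0 : 0 ≤ s := hk.sum_mul_nonneg H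
  have hμ0 := H.μ_zero
  have hL := H.Lω_pos
  have hsB : s ≤ p.μmax * B := by
    calc s ≤ ∑ i : Fin m, |y i| * p.μmax := Finset.sum_le_sum fun i _ => by
            rw [abs_of_nonneg (hk.nonneg i)]
            exact mul_le_mul_of_nonneg_left (p.μ_le_μmax i) (hk.nonneg i)
      _ = p.μmax * ∑ i : Fin m, |y i| := by rw [← Finset.sum_mul, mul_comm]
      _ ≤ p.μmax * B := mul_le_mul_of_nonneg_left hB H.μmax_nonneg
  set R := 2 * (p.μ 0 + s) * (p.Lω * p.nrm (x - z)) with hR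
  have hR0 : 0 ≤ R := by positivity
  have hd : distZero p.nrm (p.lagrangianSet (fun i => p.subψ i x) x y) ≤ ENNReal.ofReal R := by
    refine ENNReal.le_of_forall_pos_le_add fun e he _ => ?_
    have hlt : distZero p.nrm (p.lagrangianSet (fun i => p.subψc z i x) x y)
        < ENNReal.ofReal (e : ℝ) := by
      rw [hk.stationary]; exact ENNReal.ofReal_pos.mpr he
    unfold distZero at hlt
    obtain ⟨g, hlt⟩ := iInf_lt_iff.mp hlt
    obtain ⟨hg, hge⟩ := iInf_lt_iff.mp hlt
    have hge' : dualNorm p.nrm g ≤ e := (ENNReal.ofReal_lt_ofReal_iff he).mp hge |>.le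
    obtain ⟨v, hv, u, hu, rfl⟩ := hg
    choose w hw hvw using hv
    have hmem : w 0 + ∑ i : Fin m, y i • w i.succ + u
        ∈ p.lagrangianSet (fun i => p.subψ i x) x y := ⟨w, hw, u, hu, rfl⟩
    have hwv : w 0 + ∑ i : Fin m, y i • w i.succ + u
        = (v 0 + ∑ i : Fin m, y i • v i.succ + u)
          + (-(2 * (p.μ 0 + s))) • (p.gradDgf x - p.gradDgf z) := by
      have e1 : ∀ i : Fin m, y i • v i.succ
          = y i • w i.succ + (2 * (y i * p.μ i.succ)) • (p.gradDgf x - p.gradDgf z) := by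
        intro i
        rw [hvw i.succ, smul_add, smul_smul]
        congr 2
        ring
      simp_rw [e1]
      rw [Finset.sum_add_distrib, ← Finset.sum_smul, ← Finset.mul_sum, ← hs, hvw 0]
      module
    calc distZero p.nrm (p.lagrangianSet (fun i => p.subψ i x) x y)
        ≤ ENNReal.ofReal (dualNorm p.nrm (w 0 + ∑ i : Fin m, y i • w i.succ + u)) :=
          iInf₂_le _ hmem
      _ ≤ ENNReal.ofReal (e + R) := by
          apply ENNReal.ofReal_le_ofReal
          rw [hwv]
          refine (dualNorm_add_le H.norm_definite _ _).trans (add_le_add hge' ?_)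
          refine (dualNorm_smul_le H.norm_definite _ _).trans ?_
          rw [abs_neg, abs_of_nonneg (by positivity)]
          exact mul_le_mul_of_nonneg_left (H.smooth_dgf x hk.mem z hz) (by positivity)
      _ = ENNReal.ofReal R + e := by
          rw [ENNReal.ofReal_add e.coe_nonneg hR0, add_comm, ENNReal.ofReal_coe_nnreal]
  calc distZero p.nrm (p.lagrangianSet (fun i => p.subψ i x) x y) ^ 2
      ≤ ENNReal.ofReal R ^ 2 := by gcongr
    _ = ENNReal.ofReal (R ^ 2) := (ENNReal.ofReal_pow hR0 2).symm
    _ ≤ _ := by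
      apply ENNReal.ofReal_le_ofReal
      have e : R ^ 2 = 8 * p.Lω ^ 2 * (p.μ 0 + s) * p.proxGap z x y := by
        rw [hR, proxGap, ← hs, map_sub_rev p.nrm z x]
        ring
      rw [e]
      have := hk.proxGap_nonneg H
      gcongr

lemma Standing.bddBelow_ψ (H : p.Standing) : BddBelow (p.ψ 0 '' p.X) := by
  have h : LowerSemicontinuousOn (p.ψ 0) p.X :=
    ((H.continuousOn_f 0).lowerSemicontinuousOn).add H.lsc_χ
  exact h.bddBelow_of_isCompact H.compact_X

section ProxRun

variable {Ω : Type*} [MeasurableSpace Ω] {P : Measure Ω} {x0 : Rn n} {B : ℝ} {K : ℕ}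
  {x xs : ℕ → Ω → Rn n} {ys : ℕ → Ω → Fin m → ℝ} {khat : Ω → ℕ}

/-- Telescoping the descent of the objective along the outer iterations. -/
lemma IsProxRun.sum_proxGap_le (H : p.Standing) (hx0 : x0 ∈ p.X) (hB : 0 < B)
    (R : p.IsProxRun P x0 B K x xs ys khat)
    (hmem : ∀ k < K, ∀ a, x (k + 1) a ∈ p.X) (a : Ω) :
    ∑ k ∈ Finset.range K, p.proxGap (x k a) (xs (k + 1) a) (ys (k + 1) a)
      ≤ p.Δ x0 + B * p.Δbar x0
        + ∑ k ∈ Finset.range K, ((p.ψc (x k a) 0 (x (k + 1) a) - p.subOpt (x k a))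
          + B * p.subViol (x k a) (x (k + 1) a)) := by
  have hX : ∀ k ≤ K, x k a ∈ p.X := by
    intro k hk
    rcases k with _ | k
    · rw [R.start]; exact hx0
    · exact hmem k hk a
  have key : ∀ N ≤ K, ∑ k ∈ Finset.range N, p.proxGap (x k a) (xs (k + 1) a) (ys (k + 1) a)
      + p.ψ 0 (x N a) + B * p.Δbar (x N a)
      ≤ p.ψ 0 x0 + B * p.Δbar x0
        + ∑ k ∈ Finset.range N, ((p.ψc (x k a) 0 (x (k + 1) a) - p.subOpt (x k a))
          + B * p.subViol (x k a) (x (k + 1) a)) := by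
    intro N
    induction N with
    | zero => intro _; simp [R.start]
    | succ N ih =>
      intro hN
      have h0 := ih (by omega)
      have hz := hX N (by omega)
      have hx := hX (N + 1) hN
      have h1 := (R.kkt N hN a).proxGap_le H (R.dual_bound N hN a) hz
      have h2 := H.ψ_le_ψc hz hx 0
      have h3 := mul_le_mul_of_nonneg_left (H.Δbar_le_subViol hz hx) hB.le
      rw [Finset.sum_range_succ, Finset.sum_range_succ]
      linarith
  have h1 := key K le_rfl
  have h2 : sInf (p.ψ 0 '' p.X) ≤ p.ψ 0 (x K a) :=
    csInf_le H.bddBelow_ψ ⟨_, hX K le_rfl, rfl⟩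
  have h3 : 0 ≤ B * p.Δbar (x K a) := mul_nonneg hB.le (Real.sqrt_nonneg _)
  unfold Δ
  linarith

lemma measurable_proxGap {α : Type*} [MeasurableSpace α] {z x : α → Rn n} {y : α → Fin m → ℝ}
    (hz : Measurable z) (hx : Measurable x) (hy : Measurable y) :
    Measurable fun a => p.proxGap (z a) (x a) (y a) := by
  unfold proxGap
  have h1 : Measurable fun a => p.nrm (z a - x a) :=
    (seminorm_continuous p.nrm).measurable.comp (hz.sub hx)
  have h2 : ∀ i : Fin m, Measurable fun a => y a i := fun i => (measurable_pi_apply i).comp hy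
  fun_prop

/-- Inexact proximal point method: with subproblem accuracies `(c κ, κ)`, `κ = ε / (2 c₁ (c + B))`,
and at least `2 c₁ (Δ + B Δbar) / ε` iterations, a random iterate is an approximate KKT point. -/
theorem IsProxRun.isStochKKT [IsProbabilityMeasure P] (H : p.Standing) (hx0 : x0 ∈ p.X)
    {c ε : ℝ} (hB : 0 < B) (hc : 0 < c) (hε : 0 < ε) (hK1 : 1 ≤ K)
    (hK : p.outerBound B ε x0 ≤ K) (R : p.IsProxRun P x0 B K x xs ys khat)
    (hopt : ∀ k < K, p.IsStochSubOpt P (c * p.acc B c ε) (p.acc B c ε) (x k) (x (k + 1))) :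
    p.IsStochKKT P ε (2 * ε / (p.μ 0 * p.c1 B)) (fun a => x (khat a) a) := by
  have hc1 := H.c1_pos B
  have hμ0 := H.μ_zero
  have hK0 : (0 : ℝ) < K := by exact_mod_cast hK1
  have hmem : ∀ k < K, ∀ a, x (k + 1) a ∈ p.X := fun k hk a => (hopt k hk).mem a
  have hX : ∀ k ≤ K, ∀ a, x k a ∈ p.X := by
    intro k hk a
    rcases k with _ | k
    · rw [R.start]; exact hx0
    · exact hmem k hk a
  have hkhat : ∀ a, 1 ≤ khat a ∧ khat a ≤ K := fun a => Finset.mem_Icc.mp (R.khat_mem a)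
  have hacc : (c + B) * p.acc B c ε = ε / (2 * p.c1 B) := by
    unfold acc
    field_simp
  -- expected size of one step of the inexact method, without the telescoped part
  let G : ℕ → Ω → ℝ := fun k a => (p.ψc (x k a) 0 (x (k + 1) a) - p.subOpt (x k a))
      + B * p.subViol (x k a) (x (k + 1) a)
  have hGi : ∀ k < K, Integrable (G k) P := fun k hk =>
    (hopt k hk).integrable_gap.add ((hopt k hk).integrable_viol.const_mul B)
  have hGe : ∀ k < K, ∫ a, G k a ∂P ≤ ε / (2 * p.c1 B) := by
    intro k hk
    have h1 := (hopt k hk).gap_le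
    have h2 := mul_le_mul_of_nonneg_left (hopt k hk).viol_le hB.le
    have h3 : ∫ a, G k a ∂P = ∫ a, (p.ψc (x k a) 0 (x (k + 1) a) - p.subOpt (x k a)) ∂P
        + B * ∫ a, p.subViol (x k a) (x (k + 1) a) ∂P := by
      rw [← integral_const_mul]
      exact integral_add (hopt k hk).integrable_gap ((hopt k hk).integrable_viol.const_mul B)
    rw [h3, ← hacc]
    linarith
  let Z : Ω → ℕ → Rn n × Rn n × (Fin m → ℝ) := fun a k => (x k a, xs k a, ys k a)
  have hZ : Measurable Z := measurable_pi_iff.mpr fun k =>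
    (R.meas_x k).prodMk ((R.meas_xs k).prodMk (R.meas_ys k))
  have hsel : ∀ {β : Type} [MeasurableSpace β] (f : ℕ → Ω → β), (∀ k, Measurable (f k)) →
      Measurable fun a => f (khat a) a := by
    intro β _ f hf
    have h2 : Measurable fun q : ℕ × Ω => f q.1 q.2 := measurable_from_prod_countable_right hf
    exact h2.comp (R.meas_khat.prodMk measurable_id)
  -- the expected residual at the random index
  let Q : ℕ → Ω → ℝ := fun k a => p.proxGap (x (k - 1) a) (xs k a) (ys k a)
  have hQm : ∀ k, Measurable (Q k) := fun k =>
    measurable_proxGap (R.meas_x _) (R.meas_xs k) (R.meas_ys k)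
  have hQ : ∫⁻ a, ENNReal.ofReal (Q (khat a) a) ∂P ≤ ENNReal.ofReal (ε / p.c1 B) := by
    let φ : ℕ → (ℕ → Rn n × Rn n × (Fin m → ℝ)) → ℝ≥0∞ := fun k w =>
      ENNReal.ofReal (p.proxGap (w (k - 1)).1 (w k).2.1 (w k).2.2)
    have hφ : ∀ k, Measurable (φ k) := fun k => ENNReal.measurable_ofReal.comp
      (measurable_proxGap (by fun_prop) (by fun_prop) (by fun_prop))
    have h1 := lintegral_comp_uniform_index R.meas_khat hZ R.khat_mem R.khat_uniform
      R.khat_indep hφ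
    have h2 : ∑ k ∈ Finset.Icc 1 K, ∫⁻ a, φ k (Z a) ∂P
        ≤ ENNReal.ofReal (K * (ε / p.c1 B)) := by
      have e1 : ∑ k ∈ Finset.Icc 1 K, ∫⁻ a, φ k (Z a) ∂P
          = ∑ k ∈ Finset.range K, ∫⁻ a, φ (k + 1) (Z a) ∂P := by
        rw [Finset.range_eq_Ico, Finset.sum_Ico_add' (fun k => ∫⁻ a, φ k (Z a) ∂P) 0 K 1]
        rfl
      have hterm : ∀ k, Measurable fun a => φ (k + 1) (Z a) := fun k => (hφ (k + 1)).comp hZ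
      rw [e1, ← lintegral_finsetSum _ fun k _ => hterm k]
      have e2 : ∀ a, ∑ k ∈ Finset.range K, φ (k + 1) (Z a) = ENNReal.ofReal
          (∑ k ∈ Finset.range K, p.proxGap (x k a) (xs (k + 1) a) (ys (k + 1) a)) := by
        intro a
        rw [ENNReal.ofReal_sum_of_nonneg fun k hk =>
          (R.kkt k (Finset.mem_range.mp hk) a).proxGap_nonneg H]
        rfl
      have hI : Integrable (fun a => p.Δ x0 + B * p.Δbar x0 + ∑ k ∈ Finset.range K, G k a) P :=
        (integrable_const _).add (integrable_finsetSum _ fun k hk =>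
          hGi k (Finset.mem_range.mp hk))
      have hle := R.sum_proxGap_le H hx0 hB hmem
      have hnn : ∀ a, 0 ≤ p.Δ x0 + B * p.Δbar x0 + ∑ k ∈ Finset.range K, G k a := fun a =>
        (Finset.sum_nonneg fun k hk =>
          (R.kkt k (Finset.mem_range.mp hk) a).proxGap_nonneg H).trans (hle a)
      calc ∫⁻ a, ∑ k ∈ Finset.range K, φ (k + 1) (Z a) ∂P
          ≤ ∫⁻ a, ENNReal.ofReal
              (p.Δ x0 + B * p.Δbar x0 + ∑ k ∈ Finset.range K, G k a) ∂P := by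
            refine lintegral_mono fun a => ?_
            rw [e2]
            exact ENNReal.ofReal_le_ofReal (hle a)
        _ = ENNReal.ofReal
              (∫ a, (p.Δ x0 + B * p.Δbar x0 + ∑ k ∈ Finset.range K, G k a) ∂P) :=
            (ofReal_integral_eq_lintegral_ofReal hI
              (Filter.Eventually.of_forall hnn)).symm
        _ ≤ ENNReal.ofReal (K * (ε / p.c1 B)) := by
            apply ENNReal.ofReal_le_ofReal
            rw [integral_add (integrable_const _) (integrable_finsetSum _ fun k hk =>
              hGi k (Finset.mem_range.mp hk)), integral_const,
              integral_finsetSum _ fun k hk => hGi k (Finset.mem_range.mp hk)]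
            have h3 : ∑ k ∈ Finset.range K, ∫ a, G k a ∂P
                ≤ ∑ k ∈ Finset.range K, ε / (2 * p.c1 B) :=
              Finset.sum_le_sum fun k hk => hGe k (Finset.mem_range.mp hk)
            rw [Finset.sum_const, Finset.card_range, nsmul_eq_mul] at h3
            have h4 : p.Δ x0 + B * p.Δbar x0 ≤ K * (ε / (2 * p.c1 B)) := by
              unfold outerBound at hK
              rw [div_le_iff₀ hε] at hK
              rw [mul_div_assoc', le_div_iff₀ (by positivity)]
              linarith
            have h5 : K * (ε / p.c1 B) = K * (ε / (2 * p.c1 B)) + K * (ε / (2 * p.c1 B)) := by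
              field_simp
              ring
            simp only [probReal_univ, one_smul]
            linarith
    have h3 : ∫⁻ a, ENNReal.ofReal (Q (khat a) a) ∂P = ∫⁻ a, φ (khat a) (Z a) ∂P := rfl
    rw [h3, h1]
    refine (mul_le_mul_right h2 _).trans (le_of_eq ?_)
    rw [ENNReal.ofReal_mul hK0.le, ENNReal.ofReal_natCast, ← mul_assoc,
      ENNReal.inv_mul_cancel (by exact_mod_cast (by omega : K ≠ 0)) (ENNReal.natCast_ne_top K),
      one_mul]
  have hQs : Measurable fun a => Q (khat a) a := hsel Q hQm
  have hkkt : ∀ a, p.IsSubKKT (x (khat a - 1) a) (xs (khat a) a) (ys (khat a) a) ∧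
      ∑ i, |ys (khat a) a i| ≤ B ∧ x (khat a - 1) a ∈ p.X := by
    intro a
    obtain ⟨h1, h2⟩ := hkhat a
    obtain ⟨k, hk⟩ := Nat.exists_eq_add_of_le' h1
    rw [hk, Nat.add_sub_cancel]
    exact ⟨R.kkt k (by omega) a, R.dual_bound k (by omega) a, hX k (by omega) a⟩
  have hbound : ∀ {h : Ω → ℝ≥0∞} {C : ℝ}, 0 ≤ C → C ≤ p.c1 B →
      (∀ a, h a ≤ ENNReal.ofReal (C * Q (khat a) a)) → upperExp P h ≤ ENNReal.ofReal ε := by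
    intro h C hC0 hC hle
    calc upperExp P h ≤ ∫⁻ a, ENNReal.ofReal (C * Q (khat a) a) ∂P :=
          upperExp_le (ENNReal.measurable_ofReal.comp (hQs.const_mul C)) hle
      _ = ENNReal.ofReal C * ∫⁻ a, ENNReal.ofReal (Q (khat a) a) ∂P := by
          simp_rw [ENNReal.ofReal_mul hC0]
          exact lintegral_const_mul _ (ENNReal.measurable_ofReal.comp hQs)
      _ ≤ ENNReal.ofReal (p.c1 B) * ENNReal.ofReal (ε / p.c1 B) := by gcongr
      _ = ENNReal.ofReal ε := by
          rw [← ENNReal.ofReal_mul hc1.le, mul_div_cancel₀ _ hc1.ne']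
  refine ⟨hsel x R.meas_x, fun a => ?_, fun a => xs (khat a) a, fun a => ys (khat a) a,
    hsel xs R.meas_xs, hsel ys R.meas_ys, fun a => ⟨(hkkt a).1.mem, fun i => ?_,
    (hkkt a).1.nonneg⟩, ?_, ?_, ?_⟩
  · exact hX _ (hkhat a).2 a
  · exact (H.ψ_le_ψc (hkkt a).2.2 (hkkt a).1.mem i.succ).trans ((hkkt a).1.feasible i)
  · refine hbound (C := 2 * p.Lω) (by linarith [H.Lω_pos]) (le_max_left _ _) fun a => ?_
    exact ENNReal.ofReal_le_ofReal ((hkkt a).1.complementarity_le H (hkkt a).2.2)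
  · refine hbound (C := 8 * p.Lω ^ 2 * (p.μ 0 + p.μmax * B)) ?_ (le_max_right _ _) fun a => ?_
    · have := H.μmax_nonneg
      positivity
    · exact (hkkt a).1.distZero_sq_le H (hkkt a).2.1 (hkkt a).2.2
  · let D : ℕ → Ω → ℝ := fun k a => p.nrm (x k a - xs k a) ^ 2
    have hDm : ∀ k, Measurable (D k) := fun k =>
      ((seminorm_continuous p.nrm).measurable.comp
        ((R.meas_x k).sub (R.meas_xs k))).pow_const 2
    have hsum := lintegral_comp_uniform_index (φ := fun k w =>
      ENNReal.ofReal (p.nrm ((w k).1 - (w k).2.1) ^ 2)) R.meas_khat hZ R.khat_mem R.khat_uniform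
      R.khat_indep (fun k => ENNReal.measurable_ofReal.comp
        (((seminorm_continuous p.nrm).measurable.comp (by fun_prop)).pow_const 2))
    have hstep : ∀ k ∈ Finset.Icc 1 K, ∫⁻ a, ENNReal.ofReal (p.nrm ((Z a k).1 - (Z a k).2.1) ^ 2) ∂P
        ≤ ENNReal.ofReal (2 * ε / (p.μ 0 * p.c1 B)) := by
      intro k hk
      obtain ⟨h1, h2⟩ := Finset.mem_Icc.mp hk
      obtain ⟨k, rfl⟩ := Nat.exists_eq_add_of_le' h1
      have hle : ∀ a, p.nrm (x (k + 1) a - xs (k + 1) a) ^ 2 ≤ 2 / p.μ 0 * G k a := by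
        intro a
        have := (R.kkt k h2 a).half_sq_le H (R.dual_bound k h2 a) (hmem k h2 a)
        have h3 : p.nrm (x (k + 1) a - xs (k + 1) a) ^ 2
            = 2 / p.μ 0 * (p.μ 0 / 2 * p.nrm (x (k + 1) a - xs (k + 1) a) ^ 2) := by
          field_simp
        rw [h3]
        exact mul_le_mul_of_nonneg_left this (by positivity)
      calc ∫⁻ a, ENNReal.ofReal (p.nrm (x (k + 1) a - xs (k + 1) a) ^ 2) ∂P
          ≤ ∫⁻ a, ENNReal.ofReal (2 / p.μ 0 * G k a) ∂P :=
            lintegral_mono fun a => ENNReal.ofReal_le_ofReal (hle a)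
        _ = ENNReal.ofReal (∫ a, 2 / p.μ 0 * G k a ∂P) :=
            (ofReal_integral_eq_lintegral_ofReal ((hGi k h2).const_mul _)
              (Filter.Eventually.of_forall fun a => (sq_nonneg _).trans (hle a))).symm
        _ ≤ ENNReal.ofReal (2 * ε / (p.μ 0 * p.c1 B)) := by
            apply ENNReal.ofReal_le_ofReal
            rw [integral_const_mul]
            calc 2 / p.μ 0 * ∫ a, G k a ∂P ≤ 2 / p.μ 0 * (ε / (2 * p.c1 B)) :=
                  mul_le_mul_of_nonneg_left (hGe k h2) (by positivity)
              _ ≤ 2 * ε / (p.μ 0 * p.c1 B) := by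
                  rw [div_mul_div_comm, div_le_div_iff₀ (by positivity) (by positivity)]
                  nlinarith [mul_pos hε (mul_pos hμ0 hc1)]
    refine (upperExp_le (ENNReal.measurable_ofReal.comp (hsel D hDm))
      (fun a => le_rfl)).trans ?_
    calc ∫⁻ a, ENNReal.ofReal (D (khat a) a) ∂P
        = (K : ℝ≥0∞)⁻¹ * ∑ k ∈ Finset.Icc 1 K,
            ∫⁻ a, ENNReal.ofReal (p.nrm ((Z a k).1 - (Z a k).2.1) ^ 2) ∂P := hsum
      _ ≤ (K : ℝ≥0∞)⁻¹ * ∑ k ∈ Finset.Icc 1 K, ENNReal.ofReal (2 * ε / (p.μ 0 * p.c1 B)) := by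
          gcongr with k hk
          exact hstep k hk
      _ = ENNReal.ofReal (2 * ε / (p.μ 0 * p.c1 B)) := by
          rw [Finset.sum_const, Nat.card_Icc, Nat.add_sub_cancel, nsmul_eq_mul, ← mul_assoc,
            ENNReal.inv_mul_cancel (by exact_mod_cast (by omega : K ≠ 0))
              (ENNReal.natCast_ne_top K), one_mul]

end ProxRun

end Problem

/-! ### A primal-dual extrapolation scheme -/

section Recursion

variable {V : Type*} [NormedAddCommGroup V] [InnerProductSpace ℝ V]

/-- Young's inequality with a weight `τ` that may vanish. -/
lemma inner_le_of_norm_sq_le {v b : V} {τ β : ℝ} (hτ : 0 ≤ τ) (hβ0 : 0 ≤ β)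
    (hb : ‖b‖ ^ 2 ≤ τ * β) {s : ℝ} (hs : 0 < s) :
    ⟪v, b⟫ ≤ s * τ * ‖v‖ ^ 2 + β / (4 * s) := by
  have h1 := real_inner_le_norm v b
  refine h1.trans ?_
  rcases hτ.eq_or_lt with rfl | hτ
  · have hb0 : ‖b‖ = 0 := by
      have : ‖b‖ ^ 2 ≤ 0 := by simpa using hb
      exact pow_eq_zero_iff (two_ne_zero) |>.mp (le_antisymm this (sq_nonneg _))
    rw [hb0]
    simp only [mul_zero, zero_mul, zero_add]
    positivity
  · have hβ : ‖b‖ ^ 2 / τ ≤ β := by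
      rw [div_le_iff₀ hτ]; linarith
    have h2 : ‖b‖ ^ 2 / τ / (4 * s) ≤ β / (4 * s) := by gcongr
    have h3 : s * τ * ‖v‖ ^ 2 + ‖b‖ ^ 2 / τ / (4 * s) - ‖v‖ * ‖b‖
        = s * τ * (‖v‖ - ‖b‖ / (2 * s * τ)) ^ 2 := by
      field_simp
      ring
    have h4 : 0 ≤ s * τ * (‖v‖ - ‖b‖ / (2 * s * τ)) ^ 2 := by positivity
    linarith

/-- The data of a primal-dual extrapolation scheme against a fixed comparison point: `gap t` bounds
the primal-dual gap of step `t`, `w t` the prox-distance of the comparison point, `a t` the length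
of the `t`-th primal move, `d t` and `ν t` the effect of the gradient noise, `h t` the extrapolated
constraint values with noise `e t`, and `y t` the dual iterates compared with `yc`. -/
structure ExtrapolationScheme (α t0 Mc Hs : ℝ) (η θ τ : ℕ → ℝ) (N : ℕ) (gap w a d ν E : ℕ → ℝ)
    (y h e : ℕ → V) (yc : V) : Prop where
  α_pos : 0 < α
  two_le : 2 ≤ t0
  η_eq : ∀ t, η t = α * (t + t0 + 1) / 2
  θ_eq : ∀ t, θ t = (t + t0 + 1) / (t + t0 + 2)
  τ_nonneg : ∀ t, 0 ≤ τ t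
  τ_anti : ∀ t, τ (t + 1) ≤ τ t
  γτ_anti : ∀ t : ℕ, (t + t0 + 3) * τ (t + 1) ≤ (t + t0 + 2) * τ t
  Mc_le : ∀ t : ℕ, 32 * Mc ^ 2 ≤ τ t * (α * (t + 1))
  w_nonneg : ∀ t ≤ N, 0 ≤ w t
  a_zero : a 0 = 0
  E_nonneg : ∀ t, 0 ≤ E t
  primal_step : ∀ t < N, gap t ≤ η t * w t - (α + η t) * w (t + 1)
    - α * (t + 3) / 4 * a (t + 1) ^ 2 + (Hs + d t) * a (t + 1) + ν t
    + ⟪yc - y (t + 1), h (t + 1)⟫ - ⟪yc - y (t + 1), e (t + 1)⟫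
  dual_step : ∀ t < N, ⟪yc - y (t + 1), (1 + θ t) • h t - θ t • h (t - 1)⟫
    ≤ τ t / 2 * (‖yc - y t‖ ^ 2 - ‖y (t + 1) - y t‖ ^ 2 - ‖yc - y (t + 1)‖ ^ 2)
  h_diff : ∀ t < N, ‖h (t + 1) - h t‖ ^ 2
    ≤ 4 * Mc ^ 2 * (a (t + 1) ^ 2 + a t ^ 2) + 2 * τ (t + 1) * E (t + 1)

namespace ExtrapolationScheme

variable {α t0 Mc Hs : ℝ} {η θ τ : ℕ → ℝ} {N : ℕ} {gap w a d ν E : ℕ → ℝ}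
  {y h e : ℕ → V} {yc : V}

/-- One step of the scheme, weighted by `γ t = t + t0 + 2`. -/
lemma one_step (S : ExtrapolationScheme α t0 Mc Hs η θ τ N gap w a d ν E y h e yc)
    {t : ℕ} (ht : t < N) :
    (t + t0 + 2) * gap t + α * (t + t0 + 3) * (t + t0 + 2) / 2 * w (t + 1)
      + 7 / 32 * (α * (t + 3)) * (t + t0 + 2) * a (t + 1) ^ 2
      + (t + t0 + 2) * τ t / 2 * (‖yc - y (t + 1)‖ ^ 2 + ‖y (t + 1) - y t‖ ^ 2)
    ≤ α * (t + t0 + 2) * (t + t0 + 1) / 2 * w t + (t + t0 + 2) * τ t / 2 * ‖yc - y t‖ ^ 2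
      + ((t + t0 + 2) * ν t - (t + t0 + 2) * ⟪yc - y (t + 1), e (t + 1)⟫
        + 16 * t0 / α * (Hs ^ 2 + d t ^ 2))
      + ((t + t0 + 2) * ⟪yc - y (t + 1), h (t + 1) - h t⟫
        - (t + t0 + 1) * ⟪yc - y (t + 1), h t - h (t - 1)⟫) := by
  have hα := S.α_pos
  have ht0 := S.two_le
  have hg : 0 < (t : ℝ) + t0 + 2 := by positivity
  have h1 := mul_le_mul_of_nonneg_left (S.primal_step t ht) hg.le
  have h2 := mul_le_mul_of_nonneg_left (S.dual_step t ht) hg.le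
  have e1 : (1 + θ t) • h t - θ t • h (t - 1) = h t + θ t • (h t - h (t - 1)) := by module
  rw [e1, inner_add_right, real_inner_smul_right, S.θ_eq] at h2
  rw [S.η_eq] at h1
  have e2 : ((t : ℝ) + t0 + 2) * ((t + t0 + 1) / (t + t0 + 2)) = t + t0 + 1 := by field_simp
  have e3 : ((t : ℝ) + t0 + 2) * (⟪yc - y (t + 1), h t⟫
      + (t + t0 + 1) / (t + t0 + 2) * ⟪yc - y (t + 1), h t - h (t - 1)⟫)
      = (t + t0 + 2) * ⟪yc - y (t + 1), h t⟫
        + (t + t0 + 1) * ⟪yc - y (t + 1), h t - h (t - 1)⟫ := by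
    rw [mul_add, ← mul_assoc, e2]
  rw [e3] at h2
  -- the linear term in `a (t + 1)` is absorbed by an eighth of the quadratic one
  have h3 : ((t : ℝ) + t0 + 2) * ((Hs + d t) * a (t + 1))
      ≤ (t + t0 + 2) * (α * (t + 3) / 32 * a (t + 1) ^ 2) + 16 * t0 / α * (Hs ^ 2 + d t ^ 2) := by
    have hq : (Hs + d t) * a (t + 1)
        ≤ α * (t + 3) / 32 * a (t + 1) ^ 2 + 8 / (α * (t + 3)) * (Hs + d t) ^ 2 := by
      have h4 : α * (t + 3) / 32 * a (t + 1) ^ 2 + 8 / (α * (t + 3)) * (Hs + d t) ^ 2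
          - (Hs + d t) * a (t + 1)
          = α * (t + 3) / 32 * (a (t + 1) - 16 / (α * (t + 3)) * (Hs + d t)) ^ 2 := by
        field_simp
        ring
      have h5 : 0 ≤ α * (t + 3) / 32 * (a (t + 1) - 16 / (α * (t + 3)) * (Hs + d t)) ^ 2 := by
        positivity
      linarith
    have hr : ((t : ℝ) + t0 + 2) * (8 / (α * (t + 3)) * (Hs + d t) ^ 2)
        ≤ 16 * t0 / α * (Hs ^ 2 + d t ^ 2) := by
      have hc : ((t : ℝ) + t0 + 2) * (8 / (α * (t + 3))) ≤ 8 * t0 / α := by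
        rw [mul_div_assoc', div_le_div_iff₀ (by positivity) hα]
        have : (0 : ℝ) ≤ t * (t0 - 1) := mul_nonneg (Nat.cast_nonneg t) (by linarith)
        have h6 : (t : ℝ) + t0 + 2 ≤ t0 * (t + 3) := by nlinarith
        nlinarith [mul_le_mul_of_nonneg_right h6 hα.le]
      have hs : (Hs + d t) ^ 2 ≤ 2 * (Hs ^ 2 + d t ^ 2) := by nlinarith [sq_nonneg (Hs - d t)]
      calc ((t : ℝ) + t0 + 2) * (8 / (α * (t + 3)) * (Hs + d t) ^ 2)
          = ((t : ℝ) + t0 + 2) * (8 / (α * (t + 3))) * (Hs + d t) ^ 2 := by ring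
        _ ≤ 8 * t0 / α * (2 * (Hs ^ 2 + d t ^ 2)) := by gcongr
        _ = _ := by ring
    have := mul_le_mul_of_nonneg_left hq hg.le
    linarith
  rw [inner_sub_right (yc - y (t + 1)) (h (t + 1)) (h t)]
  linarith

lemma h_diff_le (S : ExtrapolationScheme α t0 Mc Hs η θ τ N gap w a d ν E y h e yc)
    {t : ℕ} (ht : t < N) {s : ℕ} (hs : s ≤ t + 1) :
    ‖h (t + 1) - h t‖ ^ 2
      ≤ τ s * (α * (s + 1) / 8 * (a (t + 1) ^ 2 + a t ^ 2) + 2 * E (t + 1)) := by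
  have h1 := S.h_diff t ht
  have h2 := mul_le_mul_of_nonneg_right (S.Mc_le s)
    (by positivity : 0 ≤ (a (t + 1) ^ 2 + a t ^ 2))
  have h3 : τ (t + 1) * E (t + 1) ≤ τ s * E (t + 1) :=
    mul_le_mul_of_nonneg_right (antitone_nat_of_succ_le S.τ_anti hs) (S.E_nonneg _)
  nlinarith

/-- The telescoped inequality, up to the pending extrapolation term. The quadratic terms in
`a (N + 1)` and `a N` are kept in reserve for that term. -/
lemma telescope (S : ExtrapolationScheme α t0 Mc Hs η θ τ N gap w a d ν E y h e yc) :
    ∀ n < N, ∑ t ∈ Finset.range (n + 1), ((t : ℝ) + t0 + 2) * gap t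
      + α * (n + t0 + 3) * (n + t0 + 2) / 2 * w (n + 1)
      + 7 / 32 * (α * (n + 3)) * (n + t0 + 2) * a (n + 1) ^ 2
      + 5 / 32 * (α * (n + 2)) * (n + t0 + 1) * a n ^ 2
      + (n + t0 + 2) * τ n / 2 * ‖yc - y (n + 1)‖ ^ 2
    ≤ α * (t0 + 2) * (t0 + 1) / 2 * w 0 + (t0 + 2) * τ 0 / 2 * ‖yc - y 0‖ ^ 2
      + ∑ t ∈ Finset.range (n + 1), (((t : ℝ) + t0 + 2) * ν t
        - (t + t0 + 2) * ⟪yc - y (t + 1), e (t + 1)⟫ + 16 * t0 / α * (Hs ^ 2 + d t ^ 2))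
      + ∑ t ∈ Finset.range n, ((t : ℝ) + t0 + 2) * E (t + 1)
      + (n + t0 + 2) * ⟪yc - y (n + 1), h (n + 1) - h n⟫ := by
  have hα := S.α_pos
  have ht0 := S.two_le
  intro n
  induction n with
  | zero =>
    intro hN
    have h1 := S.one_step hN
    have h2 : 0 ≤ (t0 + 2) * τ 0 / 2 * ‖y 1 - y 0‖ ^ 2 := by
      have := S.τ_nonneg 0
      positivity
    simp only [zero_add, Finset.range_one, Finset.sum_singleton, Finset.range_zero,
      Finset.sum_empty, S.a_zero, CharP.cast_eq_zero, Nat.zero_sub, sub_self,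
      inner_zero_right, mul_zero] at h1 ⊢
    linarith
  | succ n ih =>
    intro hN
    have h0 := ih (by omega)
    have h1 := S.one_step hN
    rw [Finset.sum_range_succ _ (n + 1), Finset.sum_range_succ _ (n + 1),
      Finset.sum_range_succ (fun t : ℕ => ((t : ℝ) + t0 + 2) * E (t + 1)) n]
    simp only [Nat.add_sub_cancel] at h1
    push_cast at h1 ⊢
    have hτ := S.τ_nonneg (n + 1)
    have hE := S.E_nonneg (n + 1)
    have hY := inner_le_of_norm_sq_le (v := y (n + 1 + 1) - y (n + 1)) hτ
      (by positivity) (S.h_diff_le (t := n) (by omega) (s := n + 1) le_rfl)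
      (show (0 : ℝ) < 1 / 2 by norm_num)
    have hY' := mul_le_mul_of_nonneg_left hY (by positivity : (0 : ℝ) ≤ n + t0 + 2)
    have hinner : ⟪yc - y (n + 1), h (n + 1) - h n⟫ - ⟪yc - y (n + 1 + 1), h (n + 1) - h n⟫
        = ⟪y (n + 1 + 1) - y (n + 1), h (n + 1) - h n⟫ := by
      rw [← inner_sub_left]
      congr 1
      abel
    have h2 : (n + t0 + 2) * (τ (n + 1) * ‖y (n + 1 + 1) - y (n + 1)‖ ^ 2)
        ≤ (n + t0 + 3) * (τ (n + 1) * ‖y (n + 1 + 1) - y (n + 1)‖ ^ 2) :=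
      mul_le_mul_of_nonneg_right (by linarith) (by positivity)
    have h3 := mul_le_mul_of_nonneg_right (S.γτ_anti n) (sq_nonneg ‖yc - y (n + 1)‖)
    have h4 : (n + t0 + 2) * (α * (n + 2) / 16 * a n ^ 2)
        ≤ 5 / 32 * (α * (n + 2)) * (n + t0 + 1) * a n ^ 2 := by
      have : (0 : ℝ) ≤ (α * (n + 2) * a n ^ 2) * (3 * (n + t0) + 1) := by positivity
      linarith
    have h5 : (n + t0 + 2) * (α * (n + 2) / 16 * a (n + 1) ^ 2)
        + 5 / 32 * (α * (n + 3)) * (n + t0 + 2) * a (n + 1) ^ 2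
        ≤ 7 / 32 * (α * (n + 3)) * (n + t0 + 2) * a (n + 1) ^ 2 := by
      have : (0 : ℝ) ≤ (n + t0 + 2) * α * a (n + 1) ^ 2 := by positivity
      linarith
    push_cast at hY'
    have hinner' := congrArg (fun r => ((n : ℝ) + t0 + 2) * r) hinner
    linarith

/-- The gap bound for the whole scheme, uniform in the comparison point. -/
theorem sum_gap_le (S : ExtrapolationScheme α t0 Mc Hs η θ τ N gap w a d ν E y h e yc)
    {n : ℕ} (hn : n < N) :
    ∑ t ∈ Finset.range (n + 1), ((t : ℝ) + t0 + 2) * gap t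
      + (n + t0 + 2) * τ n / 4 * ‖yc - y (n + 1)‖ ^ 2
    ≤ α * (t0 + 2) * (t0 + 1) / 2 * w 0 + (t0 + 2) * τ 0 / 2 * ‖yc - y 0‖ ^ 2
      + ∑ t ∈ Finset.range (n + 1), (((t : ℝ) + t0 + 2) * ν t
        - (t + t0 + 2) * ⟪yc - y (t + 1), e (t + 1)⟫ + 16 * t0 / α * (Hs ^ 2 + d t ^ 2))
      + 2 * ∑ t ∈ Finset.range (n + 1), ((t : ℝ) + t0 + 2) * E (t + 1) := by
  have hα := S.α_pos
  have ht0 := S.two_le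
  have h0 := S.telescope n hn
  have hτ := S.τ_nonneg n
  have hE := S.E_nonneg (n + 1)
  have hY := inner_le_of_norm_sq_le (v := yc - y (n + 1)) hτ
    (by positivity) (S.h_diff_le hn (s := n) (by omega)) (show (0 : ℝ) < 1 / 4 by norm_num)
  have hY' := mul_le_mul_of_nonneg_left hY (by positivity : (0 : ℝ) ≤ n + t0 + 2)
  have hw : 0 ≤ α * (n + t0 + 3) * (n + t0 + 2) / 2 * w (n + 1) :=
    mul_nonneg (by positivity) (S.w_nonneg _ hn)
  have h4 : (n + t0 + 2) * (α * (n + 1) / 8 * a n ^ 2)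
      ≤ 5 / 32 * (α * (n + 2)) * (n + t0 + 1) * a n ^ 2 := by
    have h6 : (0 : ℝ) ≤ 5 * (n + 2) * (n + t0 + 1) - 4 * (n + 1) * (n + t0 + 2) := by
      have h7 : (0 : ℝ) ≤ n * (t0 - 2) := mul_nonneg (Nat.cast_nonneg n) (by linarith)
      nlinarith [sq_nonneg (n : ℝ), (Nat.cast_nonneg n : (0 : ℝ) ≤ n)]
    have : (0 : ℝ) ≤ (5 * (n + 2) * (n + t0 + 1) - 4 * (n + 1) * (n + t0 + 2)) * (α * a n ^ 2) :=
      mul_nonneg h6 (by positivity)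
    linarith
  have h5 : (n + t0 + 2) * (α * (n + 1) / 8 * a (n + 1) ^ 2)
      ≤ 7 / 32 * (α * (n + 3)) * (n + t0 + 2) * a (n + 1) ^ 2 := by
    have : (0 : ℝ) ≤ (n + t0 + 2) * α * a (n + 1) ^ 2 * (3 * n + 17) := by positivity
    linarith
  have h6 : 0 ≤ ∑ t ∈ Finset.range n, ((t : ℝ) + t0 + 2) * E (t + 1) :=
    Finset.sum_nonneg fun t _ => mul_nonneg (by positivity) (S.E_nonneg _)
  rw [Finset.sum_range_succ (fun t : ℕ => ((t : ℝ) + t0 + 2) * E (t + 1)) n]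
  linarith

end ExtrapolationScheme

end Recursion

/-! ### The primal step of ConEx -/

namespace Problem

variable {n m : ℕ} {p : Problem n m}

namespace Standing

lemma bddAbove_DX (H : p.Standing) :
    BddAbove {r | ∃ x ∈ p.X, ∃ y ∈ p.X, r = Real.sqrt (2 * p.W x y)} := by
  obtain ⟨c, hc, h⟩ := exists_seminorm_le_norm p.nrm
  obtain ⟨D, hD⟩ := H.compact_X.isBounded.subset_closedBall 0
  refine ⟨Real.sqrt (p.Lω * (c * (D + D)) ^ 2), ?_⟩
  rintro _ ⟨x, hx, y, hy, rfl⟩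
  apply Real.sqrt_le_sqrt
  have h1 := H.W_le hx hy
  have h2 : p.nrm (x - y) ≤ c * (D + D) := by
    refine (h _).trans ?_
    gcongr
    refine (norm_sub_le _ _).trans ?_
    have := hD hx
    have := hD hy
    simp only [Metric.mem_closedBall, dist_zero_right] at *
    linarith
  have h3 : p.nrm (x - y) ^ 2 ≤ (c * (D + D)) ^ 2 := by
    gcongr
  nlinarith [H.Lω_pos]

lemma two_W_le_DX_sq (H : p.Standing) {x z : Rn n} (hx : x ∈ p.X) (hz : z ∈ p.X) :
    2 * p.W x z ≤ p.DX ^ 2 := by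
  have h1 : Real.sqrt (2 * p.W x z) ≤ p.DX := le_csSup H.bddAbove_DX ⟨x, hx, z, hz, rfl⟩
  calc 2 * p.W x z = Real.sqrt (2 * p.W x z) ^ 2 :=
        (Real.sq_sqrt (by linarith [H.W_nonneg hx hz])).symm
    _ ≤ p.DX ^ 2 := by gcongr

lemma DX_nonneg (_H : p.Standing) : 0 ≤ p.DX := by
  refine Real.sSup_nonneg ?_
  rintro _ ⟨x, _, y, _, rfl⟩
  exact Real.sqrt_nonneg _

lemma nrm_le_DX (H : p.Standing) {x z : Rn n} (hx : x ∈ p.X) (hz : z ∈ p.X) :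
    p.nrm (x - z) ≤ p.DX := by
  have h1 := H.two_W_le_DX_sq hx hz
  have h2 := H.half_sq_le_W hx hz
  exact (sq_le_sq₀ (apply_nonneg _ _) H.DX_nonneg).mp (by linarith)

lemma DX_pos (H : p.Standing) (hX : p.X.Nontrivial) : 0 < p.DX := by
  obtain ⟨x, hx, y, hy, hne⟩ := hX
  refine lt_of_lt_of_le ?_ (H.nrm_le_DX hx hy)
  exact lt_of_le_of_ne (apply_nonneg _ _) fun h =>
    hne (sub_eq_zero.mp (H.norm_definite _ h.symm))

/-- The proximal three-point inequality: a minimizer over `X` of the sum of a convex function, a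
linear function and a multiple of the distance generating function. -/
lemma prox_three_point (H : p.Standing) {φ : Rn n → ℝ} (hφ : ConvexOn ℝ p.X φ) {κ : ℝ}
    (hκ : 0 ≤ κ) {v u x : Rn n} (hu : u ∈ p.X) (hx : x ∈ p.X)
    (hmin : ∀ x ∈ p.X, φ u + ⟪v, u⟫ + κ * p.dgf u ≤ φ x + ⟪v, x⟫ + κ * p.dgf x) :
    φ u + ⟪v, u⟫ + κ * p.dgf u + κ * p.W x u ≤ φ x + ⟪v, x⟫ + κ * p.dgf x := by
  have hL := H.Lω_pos
  set C := κ * (p.Lω / 2 * p.nrm (x - u) ^ 2) with hC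
  have hC0 : 0 ≤ C := by positivity
  -- compare with the points `u + s (x - u)` and let `s` tend to zero
  have key : ∀ s : ℝ, 0 < s → s ≤ 1 →
      0 ≤ (φ x - φ u + ⟪v, x - u⟫ + κ * ⟪p.gradDgf u, x - u⟫) + s * C := by
    intro s hs hs1
    have hm : u + s • (x - u) ∈ p.X := H.convex_X.add_smul_sub_mem hu hx ⟨hs.le, hs1⟩
    have h1 := hmin _ hm
    have h2 : φ (u + s • (x - u)) ≤ (1 - s) * φ u + s * φ x := by
      have := hφ.2 hu hx (by linarith : 0 ≤ 1 - s) hs.le (by ring)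
      have e : (1 - s) • u + s • x = u + s • (x - u) := by module
      rw [e] at this
      simpa using this
    have h3 := mul_le_mul_of_nonneg_left (H.W_le hm hu) hκ
    unfold W at h3
    rw [add_sub_cancel_left, map_smul_eq_mul, Real.norm_of_nonneg hs.le,
      real_inner_smul_right] at h3
    rw [inner_add_right, real_inner_smul_right] at h1
    have h4 : 0 ≤ s * ((φ x - φ u + ⟪v, x - u⟫ + κ * ⟪p.gradDgf u, x - u⟫) + s * C) := by
      rw [hC]
      nlinarith
    exact nonneg_of_mul_nonneg_right h4 hs
  have h0 : 0 ≤ φ x - φ u + ⟪v, x - u⟫ + κ * ⟪p.gradDgf u, x - u⟫ := by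
    by_contra! hlt
    set A := φ x - φ u + ⟪v, x - u⟫ + κ * ⟪p.gradDgf u, x - u⟫
    have h5 := key (min 1 (-A / (2 * (C + 1)))) (lt_min one_pos (by
      apply div_pos <;> linarith)) (min_le_left _ _)
    have h6 : min 1 (-A / (2 * (C + 1))) * C ≤ -A / (2 * (C + 1)) * C :=
      mul_le_mul_of_nonneg_right (min_le_right _ _) hC0
    have h7 : -A / (2 * (C + 1)) * C ≤ -A / 2 := by
      rw [div_mul_eq_mul_div, div_le_div_iff₀ (by positivity) (by norm_num)]
      nlinarith
    linarith
  rw [inner_sub_right v] at h0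
  unfold W
  linarith

end Standing

end Problem

namespace ConExSetup

variable {n m : ℕ} {S : ConExSetup n m}

lemma continuousOn_W (H : S.p.Standing) (z : Rn n) : ContinuousOn (fun x => S.p.W x z) S.p.X := by
  unfold Problem.W
  have := H.continuousOn_dgf
  fun_prop

lemma convexOn_W (H : S.p.Standing) (z : Rn n) :
    ConvexOn ℝ S.p.X (fun x => S.p.W x z) := by
  refine convexOn_of_forall_exists_subgradient H.convex_X fun y hy =>
    ⟨S.p.gradDgf y - S.p.gradDgf z, fun x hx => ?_⟩
  have h1 := S.p.W_three_point x y z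
  have h2 := H.W_nonneg hx hy
  linarith

namespace Valid

lemma continuousOn_fc (V : S.Valid) (H : S.p.Standing) (z : Rn n) (i : Fin (m + 1)) :
    ContinuousOn (S.fc z i) S.p.X := by
  unfold fc
  exact ((H.continuousOn_f i).add (V.cont_χn i)).add ((continuousOn_W H z).const_smul (S.p.μ i))

lemma ψc_eq (V : S.Valid) (z : Rn n) (i : Fin (m + 1)) {x : Rn n} (hx : x ∈ S.p.X) :
    S.p.ψc z i x = S.fc z i x + S.χc z i x := by
  unfold Problem.ψc Problem.ψ fc χc
  rw [V.split i x hx]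
  ring

lemma convexOn_χc (V : S.Valid) (H : S.p.Standing) (z : Rn n)
    (i : Fin (m + 1)) : ConvexOn ℝ S.p.X (S.χc z i) :=
  (V.convex_χs i).add ((convexOn_W H z).smul (H.μ_nonneg i))

/-- Adding `μᵢ W(·, z)` to the weakly convex part makes it convex. -/
lemma convexOn_fc (V : S.Valid) (H : S.p.Standing) (z : Rn n)
    (i : Fin (m + 1)) : ConvexOn ℝ S.p.X (S.fc z i) := by
  have h1 : ConvexOn ℝ S.p.X (fun x => S.p.f i x + S.p.μ i * S.p.W x z) := by
    refine convexOn_of_forall_exists_subgradient H.convex_X fun y hy =>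
      ⟨S.p.gradf i y + S.p.μ i • (S.p.gradDgf y - S.p.gradDgf z), fun x hx => ?_⟩
    have h1 := S.p.W_three_point x y z
    have h2 := mul_le_mul_of_nonneg_left (H.half_sq_le_W hx hy) (H.μ_nonneg i)
    have h3 := H.curvature_f i x hx y hy
    rw [inner_add_left, real_inner_smul_left, h1]
    linarith
  refine (h1.add (V.convex_χn i)).congr fun x _ => ?_
  simp only [Pi.add_apply, fc]
  ring

lemma convexOn_ψc (V : S.Valid) (H : S.p.Standing) (z : Rn n)
    (i : Fin (m + 1)) : ConvexOn ℝ S.p.X (S.p.ψc z i) := by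
  refine ((V.convexOn_fc H z i).add (V.convexOn_χc H z i)).congr fun x hx => ?_
  rw [V.ψc_eq z i hx]
  rfl

/-- The objective of the primal step, up to a constant, as a convex function plus a linear function
plus a multiple of `ω`. -/
lemma primal_objective_eq (z : Rn n) (y : Fin m → ℝ) (g u x : Rn n) (η : ℝ) :
    S.χc z 0 x + ∑ i : Fin m, y i * S.χc z i.succ x + ⟪g, x⟫ + η * S.p.W x u
      = (S.χs 0 x + ∑ i : Fin m, y i * S.χs i.succ x)
        + ⟪g - (S.p.μ 0 + ∑ i : Fin m, y i * S.p.μ i.succ) • S.p.gradDgf z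
            - η • S.p.gradDgf u, x⟫
        + (S.p.μ 0 + ∑ i : Fin m, y i * S.p.μ i.succ + η) * S.p.dgf x
        + ((S.p.μ 0 + ∑ i : Fin m, y i * S.p.μ i.succ)
            * (⟪S.p.gradDgf z, z⟫ - S.p.dgf z)
          + η * (⟪S.p.gradDgf u, u⟫ - S.p.dgf u)) := by
  have e : ∑ i : Fin m, y i * S.χc z i.succ x
      = ∑ i : Fin m, y i * S.χs i.succ x + (∑ i : Fin m, y i * S.p.μ i.succ) * S.p.W x z := by
    rw [Finset.sum_mul, ← Finset.sum_add_distrib]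
    refine Finset.sum_congr rfl fun i _ => ?_
    unfold χc
    ring
  rw [e]
  unfold χc Problem.W
  simp only [inner_sub_left, inner_sub_right, real_inner_smul_left]
  ring

lemma convexOn_sum_χs (V : S.Valid) (H : S.p.Standing) {y : Fin m → ℝ} (hy : ∀ i, 0 ≤ y i) :
    ConvexOn ℝ S.p.X (fun x => S.χs 0 x + ∑ i : Fin m, y i * S.χs i.succ x) := by
  refine (V.convex_χs 0).add ?_
  have h : ∀ s : Finset (Fin m), ConvexOn ℝ S.p.X (fun x => ∑ i ∈ s, y i * S.χs i.succ x) := by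
    classical
    intro s
    induction s using Finset.induction_on with
    | empty => simpa using convexOn_const 0 H.convex_X
    | insert i s hi ih =>
      simp_rw [Finset.sum_insert hi]
      exact ((V.convex_χs i.succ).smul (hy i)).add ih
  exact h _

/-- The three-point inequality for the primal step of ConEx. -/
lemma primal_step_three_point (V : S.Valid) (H : S.p.Standing) {z : Rn n} {y : Fin m → ℝ}
    (hy : ∀ i, 0 ≤ y i) {g u u' x : Rn n} {η : ℝ} (hη : 0 ≤ η) (hu' : u' ∈ S.p.X)
    (hx : x ∈ S.p.X)
    (hmin : IsMinOn (fun x => S.χc z 0 x + ∑ i : Fin m, y i * S.χc z i.succ x + ⟪g, x⟫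
      + η * S.p.W x u) S.p.X u') :
    S.χc z 0 u' + ∑ i : Fin m, y i * S.χc z i.succ u' + ⟪g, u'⟫ + η * S.p.W u' u
      + (S.p.μ 0 + ∑ i : Fin m, y i * S.p.μ i.succ + η) * S.p.W x u'
    ≤ S.χc z 0 x + ∑ i : Fin m, y i * S.χc z i.succ x + ⟪g, x⟫ + η * S.p.W x u := by
  have hs : 0 ≤ ∑ i : Fin m, y i * S.p.μ i.succ :=
    Finset.sum_nonneg fun i _ => mul_nonneg (hy i) (H.μ_succ i)
  have hμ := H.μ_zero
  have := H.prox_three_point (V.convexOn_sum_χs H hy)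
    (κ := S.p.μ 0 + ∑ i : Fin m, y i * S.p.μ i.succ + η) (by positivity)
    (v := g - (S.p.μ 0 + ∑ i : Fin m, y i * S.p.μ i.succ) • S.p.gradDgf z
            - η • S.p.gradDgf u) hu' hx (fun x hx => by
      have := isMinOn_iff.mp hmin x hx
      simp only [primal_objective_eq] at this
      linarith)
  simp only [primal_objective_eq]
  linarith

/-- The estimate for one primal step: the primal-dual gap at the new point against `(x, yc)`.
Here `g i` is a subgradient at `u`, and `Δ i` is the error of the gradient estimate used. -/
lemma gap_le (V : S.Valid) (H : S.p.Standing) {z : Rn n} (hz : z ∈ S.p.X) {y yc : Fin m → ℝ}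
    (hy : ∀ i, 0 ≤ y i) (hyc : ∀ i, 0 ≤ yc i) {u u' x : Rn n} {η : ℝ} (hη : 0 ≤ η)
    (hu : u ∈ S.p.X) (hu' : u' ∈ S.p.X) (hx : x ∈ S.p.X) {g Δ : Fin (m + 1) → Rn n}
    (hg : ∀ i, g i ∈ subdiff S.p.X (S.fc z i) u)
    (hmin : IsMinOn (fun x => S.χc z 0 x + ∑ i : Fin m, y i * S.χc z i.succ x
      + ⟪(g 0 + Δ 0) + ∑ i : Fin m, y i • (g i.succ + Δ i.succ), x⟫
      + η * S.p.W x u) S.p.X u') :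
    S.p.ψc z 0 u' + ∑ i : Fin m, yc i * S.p.ψc z i.succ u'
      - (S.p.ψc z 0 x + ∑ i : Fin m, y i * S.p.ψc z i.succ x)
    ≤ η * S.p.W x u - (S.p.μ 0 + η) * S.p.W x u' - η * S.p.W u' u
      + (S.L 0 + ∑ i : Fin m, yc i * S.L i.succ) / 2 * S.p.nrm (u' - u) ^ 2
      + (S.H 0 + ∑ i : Fin m, yc i * S.H i.succ) * S.p.nrm (u' - u)
      + ⟪Δ 0 + ∑ i : Fin m, y i • Δ i.succ, x - u'⟫
      + ∑ i : Fin m, (yc i - y i)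
        * (S.χc z i.succ u' + (S.fc z i.succ u + ⟪g i.succ, u' - u⟫)) := by
  have h3 := V.primal_step_three_point H hy hη hu' hx hmin
  have hs : 0 ≤ (∑ i : Fin m, y i * S.p.μ i.succ) * S.p.W x u' :=
    mul_nonneg (Finset.sum_nonneg fun i _ => mul_nonneg (hy i) (H.μ_succ i)) (H.W_nonneg hx hu')
  have hlin : ⟪(g 0 + Δ 0) + ∑ i : Fin m, y i • (g i.succ + Δ i.succ), x⟫
      - ⟪(g 0 + Δ 0) + ∑ i : Fin m, y i • (g i.succ + Δ i.succ), u'⟫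
      = ⟪g 0, x - u'⟫ + ∑ i : Fin m, y i * ⟪g i.succ, x - u'⟫
        + ⟪Δ 0 + ∑ i : Fin m, y i • Δ i.succ, x - u'⟫ := by
    rw [← inner_sub_right]
    simp only [smul_add, Finset.sum_add_distrib, inner_add_left, sum_inner, real_inner_smul_left]
    ring
  have hsub : ∀ i, S.fc z i u + ⟪g i, x - u⟫ ≤ S.fc z i x := fun i =>
    subgradient_of_mem_subdiff (V.continuousOn_fc H z i).lowerSemicontinuousOn (hg i) hx
  have hsm : ∀ i, S.fc z i u' ≤ S.fc z i u + ⟪g i, u' - u⟫ + S.L i / 2 * S.p.nrm (u' - u) ^ 2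
      + S.H i * S.p.nrm (u' - u) := fun i => by
    have := V.smooth z hz i u' hu' u hu (g i) (hg i)
    linarith
  have hinn : ∀ i, ⟪g i, x - u⟫ = ⟪g i, x - u'⟫ + ⟪g i, u' - u⟫ := fun i => by
    rw [← inner_add_right]; congr 1; abel
  have h0a := hsub 0
  have h0b := hsm 0
  have ha : ∑ i : Fin m, y i * (S.fc z i.succ u + ⟪g i.succ, x - u⟫ + S.χc z i.succ x)
      ≤ ∑ i : Fin m, y i * S.p.ψc z i.succ x := Finset.sum_le_sum fun i _ => by
    rw [V.ψc_eq z i.succ hx]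
    exact mul_le_mul_of_nonneg_left (by linarith [hsub i.succ]) (hy i)
  have hb : ∑ i : Fin m, yc i * S.p.ψc z i.succ u'
      ≤ ∑ i : Fin m, yc i * (S.fc z i.succ u + ⟪g i.succ, u' - u⟫
        + S.L i.succ / 2 * S.p.nrm (u' - u) ^ 2
        + S.H i.succ * S.p.nrm (u' - u) + S.χc z i.succ u') := Finset.sum_le_sum fun i _ => by
    rw [V.ψc_eq z i.succ hu']
    exact mul_le_mul_of_nonneg_left (by linarith [hsm i.succ]) (hyc i)
  have hc : ∑ i : Fin m, yc i * (S.fc z i.succ u + ⟪g i.succ, u' - u⟫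
        + S.L i.succ / 2 * S.p.nrm (u' - u) ^ 2
        + S.H i.succ * S.p.nrm (u' - u) + S.χc z i.succ u')
      - ∑ i : Fin m, y i * (S.fc z i.succ u + ⟪g i.succ, x - u⟫ + S.χc z i.succ x)
      = ∑ i : Fin m, (yc i - y i)
          * (S.χc z i.succ u' + (S.fc z i.succ u + ⟪g i.succ, u' - u⟫))
        + (∑ i : Fin m, yc i * S.L i.succ) / 2 * S.p.nrm (u' - u) ^ 2
        + (∑ i : Fin m, yc i * S.H i.succ) * S.p.nrm (u' - u)
        + ∑ i : Fin m, y i * S.χc z i.succ u' - ∑ i : Fin m, y i * S.χc z i.succ x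
        - ∑ i : Fin m, y i * ⟪g i.succ, x - u'⟫ := by
    rw [Finset.sum_div, Finset.sum_mul, Finset.sum_mul, ← Finset.sum_sub_distrib,
      ← Finset.sum_add_distrib, ← Finset.sum_add_distrib, ← Finset.sum_add_distrib,
      ← Finset.sum_sub_distrib, ← Finset.sum_sub_distrib]
    refine Finset.sum_congr rfl fun i _ => ?_
    rw [hinn i.succ]
    ring
  rw [V.ψc_eq z 0 hu', V.ψc_eq z 0 hx]
  rw [hinn 0] at h0a
  linarith

end Valid

end ConExSetup

/-! ### ConEx as an extrapolation scheme -/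

namespace ConExSetup

variable {n m : ℕ} {S : ConExSetup n m}

section Constants

lemma Lf_nonneg (S : ConExSetup n m) : 0 ≤ S.Lf := Real.sqrt_nonneg _
lemma Mft_nonneg (S : ConExSetup n m) : 0 ≤ S.Mft := Real.sqrt_nonneg _
lemma Mχt_nonneg (S : ConExSetup n m) : 0 ≤ S.Mχt := Real.sqrt_nonneg _
lemma σXf_nonneg (S : ConExSetup n m) : 0 ≤ S.σXf := Real.sqrt_nonneg _

lemma two_le_t₀ (V : S.Valid) (H : S.p.Standing) {B : ℝ} (hB : 0 ≤ B) : 2 ≤ S.t₀ B := by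
  have h1 := V.L_nonneg 0
  have h2 := S.Lf_nonneg
  have h3 : 0 < S.α₀ := H.μ_zero
  unfold t₀
  have : 0 ≤ 4 * (S.L 0 + B * S.Lf) / S.α₀ := by positivity
  linarith

/-- The factor of `τ` that does not depend on the iteration. -/
def τbase (S : ConExSetup n m) (B : ℝ) (T : ℕ) : ℝ :=
  max (max (32 * S.Mcal ^ 2 / S.α₀) (384 * S.σt ^ 2 * T / S.α₀))
      (S.σXf * (T : ℝ) ^ (3 / 2 : ℝ) / (B * Real.sqrt (S.t₀ B + 2)))

lemma τ_eq (S : ConExSetup n m) (B : ℝ) (T t : ℕ) : S.τ B T t = S.τbase B T / (t + 1) := by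
  unfold τ τbase
  ring

lemma τbase_nonneg (H : S.p.Standing) (B : ℝ) (T : ℕ) : 0 ≤ S.τbase B T := by
  have h3 : 0 < S.α₀ := H.μ_zero
  exact le_max_of_le_left (le_max_of_le_left (by positivity))

lemma τ_nonneg (H : S.p.Standing) (B : ℝ) (T t : ℕ) : 0 ≤ S.τ B T t := by
  have := τbase_nonneg H B T
  rw [τ_eq]
  positivity

lemma τ_anti (H : S.p.Standing) (B : ℝ) (T t : ℕ) : S.τ B T (t + 1) ≤ S.τ B T t := by
  have := τbase_nonneg H B T
  rw [τ_eq, τ_eq]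
  push_cast
  gcongr
  linarith

lemma γτ_anti (V : S.Valid) (H : S.p.Standing) {B : ℝ} (hB : 0 ≤ B) (T t : ℕ) :
    (t + S.t₀ B + 3) * S.τ B T (t + 1) ≤ (t + S.t₀ B + 2) * S.τ B T t := by
  have h1 := τbase_nonneg H B T
  have h2 := two_le_t₀ V H hB
  rw [τ_eq, τ_eq, mul_div_assoc', mul_div_assoc', div_le_div_iff₀ (by positivity) (by positivity)]
  push_cast
  have : 0 ≤ S.τbase B T * (S.t₀ B + 1) := by positivity
  nlinarith

lemma Mcal_sq_le (H : S.p.Standing) (B : ℝ) (T t : ℕ) :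
    32 * S.Mcal ^ 2 ≤ S.τ B T t * (S.α₀ * (t + 1)) := by
  have h3 : 0 < S.α₀ := H.μ_zero
  have h1 : 32 * S.Mcal ^ 2 / S.α₀ ≤ S.τbase B T := (le_max_left _ _).trans (le_max_left _ _)
  rw [div_le_iff₀ h3] at h1
  rw [τ_eq]
  have e : S.τbase B T / (t + 1) * (S.α₀ * (t + 1)) = S.τbase B T * S.α₀ := by
    field_simp
  rw [e]
  exact h1

lemma Hstar_eq (S : ConExSetup n m) {B Y : ℝ} (hYB : Y + 1 ≤ B) :
    S.Hstar B Y = S.H 0 + (Y + 1) * S.Hf := by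
  unfold Hstar
  rw [max_eq_right (by linarith)]
  ring

lemma sum_mul_le_of_norm_le {a : Fin m → ℝ} {yc : Fin m → ℝ} {R : ℝ}
    (h : Real.sqrt (∑ i, yc i ^ 2) ≤ R) :
    ∑ i, yc i * a i ≤ R * Real.sqrt (∑ i, a i ^ 2) :=
  (Real.sum_mul_le_sqrt_mul_sqrt _ _ _).trans
    (mul_le_mul_of_nonneg_right h (Real.sqrt_nonneg _))

end Constants

section Trace

variable {Ξ : Type*}

/-- The exact counterpart of `linVal`, for a subgradient field `g` and exact function values. -/
def linTrue (S : ConExSetup n m) (g : Fin (m + 1) → Rn n → Rn n) (z : Rn n) (u : ℕ → Rn n) :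
    ℕ → Fin m → ℝ
  | 0 => fun i => S.χc z i.succ (u 0) + S.fc z i.succ (u 0)
  | t + 1 => fun i => S.χc z i.succ (u (t + 1)) + (S.fc z i.succ (u t)
      + ⟪g i.succ (u t), u (t + 1) - u t⟫)

/-- The noise in `linVal`. -/
def linErr (S : ConExSetup n m) (G : Rn n → Fin (m + 1) → Rn n → Ξ → Rn n)
    (F : Rn n → Fin m → Rn n → Ξ → ℝ) (g : Fin (m + 1) → Rn n → Rn n) (z : Rn n)
    (sbar : ℕ → Ξ) (u : ℕ → Rn n) : ℕ → Fin m → ℝ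
  | 0 => fun i => F z i (u 0) (sbar 0) - S.fc z i.succ (u 0)
  | t + 1 => fun i => F z i (u t) (sbar t) - S.fc z i.succ (u t)
      + ⟪G z i.succ (u t) (sbar t) - g i.succ (u t), u (t + 1) - u t⟫

/-- The noise in the gradient of the Lagrangian used by the primal step. -/
def gradErr (G : Rn n → Fin (m + 1) → Rn n → Ξ → Rn n) (g : Fin (m + 1) → Rn n → Rn n)
    (z : Rn n) (u : Rn n) (y : Fin m → ℝ) (s : Ξ) : Rn n :=
  (G z 0 u s - g 0 u) + ∑ i : Fin m, y i • (G z i.succ u s - g i.succ u)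

/-- The primal-dual gap of `(u, y)` against `(x, yc)`. -/
def pdGap (S : ConExSetup n m) (z u x : Rn n) (yc y : Fin m → ℝ) : ℝ :=
  S.p.ψc z 0 u + ∑ i : Fin m, yc i * S.p.ψc z i.succ u
    - (S.p.ψc z 0 x + ∑ i : Fin m, y i * S.p.ψc z i.succ x)

variable {G : Rn n → Fin (m + 1) → Rn n → Ξ → Rn n} {F : Rn n → Fin m → Rn n → Ξ → ℝ}
  {g : Fin (m + 1) → Rn n → Rn n} {z : Rn n} {s sbar : ℕ → Ξ} {u : ℕ → Rn n}
  {y : ℕ → Fin m → ℝ} {B : ℝ} {T : ℕ} {u₀ : Rn n}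

lemma linVal_eq (S : ConExSetup n m) (G : Rn n → Fin (m + 1) → Rn n → Ξ → Rn n)
    (F : Rn n → Fin m → Rn n → Ξ → ℝ) (g : Fin (m + 1) → Rn n → Rn n) (z : Rn n)
    (sbar : ℕ → Ξ) (u : ℕ → Rn n) (t : ℕ) (i : Fin m) :
    S.linVal G F z sbar u i t = S.linTrue g z u t i + S.linErr G F g z sbar u t i := by
  cases t with
  | zero => simp only [linVal, linTrue, linErr]; ring
  | succ t => simp only [linVal, linTrue, linErr, inner_sub_left]; ring

lemma IsConExTrace.mem (tr : S.IsConExTrace G F B T z u₀ s sbar u y) (hu₀ : u₀ ∈ S.p.X) :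
    ∀ t ≤ T, u t ∈ S.p.X := by
  intro t ht
  rcases t with _ | t
  · rw [tr.init_primal]; exact hu₀
  · exact tr.primal_mem t ht

lemma IsConExTrace.dual_nonneg (tr : S.IsConExTrace G F B T z u₀ s sbar u y) :
    ∀ t ≤ T, ∀ i, 0 ≤ y t i := by
  intro t ht i
  rcases t with _ | t
  · rw [tr.init_dual]; exact le_rfl
  · rw [tr.dual_step t ht]; exact le_max_right _ _

lemma norm_toLp_le_of_abs_le {v a b : Fin m → ℝ} {r q : ℝ} (hr : 0 ≤ r) (hq : 0 ≤ q)
    (h : ∀ i, |v i| ≤ (a i + b i) * r + 2 * b i * q) :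
    ‖WithLp.toLp 2 v‖ ≤ (Real.sqrt (∑ i, a i ^ 2) + Real.sqrt (∑ i, b i ^ 2)) * r
      + 2 * Real.sqrt (∑ i, b i ^ 2) * q := by
  set A : EuclideanSpace ℝ (Fin m) := WithLp.toLp 2 a
  set Bv : EuclideanSpace ℝ (Fin m) := WithLp.toLp 2 b
  have hA : Real.sqrt (∑ i, a i ^ 2) = ‖A‖ := by simp [A, EuclideanSpace.norm_eq]
  have hBv : Real.sqrt (∑ i, b i ^ 2) = ‖Bv‖ := by simp [Bv, EuclideanSpace.norm_eq]
  rw [hA, hBv]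
  have h1 : ‖WithLp.toLp 2 v‖ ≤ ‖r • A + r • Bv + (2 * q) • Bv‖ := by
    rw [EuclideanSpace.norm_eq, EuclideanSpace.norm_eq]
    apply Real.sqrt_le_sqrt
    refine Finset.sum_le_sum fun i _ => ?_
    have h2 : ‖(WithLp.toLp 2 v).ofLp i‖ ≤ ‖(r • A + r • Bv + (2 * q) • Bv).ofLp i‖ := by
      rw [Real.norm_eq_abs, Real.norm_eq_abs]
      refine (h i).trans (le_trans (le_of_eq ?_) (le_abs_self _))
      simp [A, Bv]
      ring
    gcongr
  refine h1.trans ?_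
  refine (norm_add₃_le).trans ?_
  rw [norm_smul, norm_smul, norm_smul, Real.norm_of_nonneg hr,
    Real.norm_of_nonneg (by positivity : 0 ≤ 2 * q)]
  linarith

/-- Lipschitz continuity of the exact linearized constraint values along the iterates. -/
lemma norm_linTrue_sub_le (V : S.Valid) (hz : z ∈ S.p.X)
    (hg : ∀ i, ∀ x ∈ S.p.X, g i x ∈ subdiff S.p.X (S.fc z i) x)
    {t : ℕ} (hu : ∀ r ≤ t + 1, u r ∈ S.p.X) :
    ‖WithLp.toLp 2 (S.linTrue g z u (t + 1)) - WithLp.toLp 2 (S.linTrue g z u t)‖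
      ≤ S.Mcal * (S.p.nrm (u (t + 1) - u t) + S.p.nrm (u t - u (t - 1))) := by
  have hχ : ∀ i : Fin m, ∀ x₁ ∈ S.p.X, ∀ x₂ ∈ S.p.X,
      |S.χc z i.succ x₁ - S.χc z i.succ x₂| ≤ S.Mχ i * S.p.nrm (x₁ - x₂) := by
    intro i x₁ h₁ x₂ h₂
    have h3 := V.lip_χ z hz i x₂ h₂ x₁ h₁
    rw [map_sub_rev] at h3
    exact abs_sub_le_iff.mpr ⟨V.lip_χ z hz i x₁ h₁ x₂ h₂, h3⟩
  have hf : ∀ i : Fin m, ∀ x₁ ∈ S.p.X, ∀ x₂ ∈ S.p.X,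
      |S.fc z i.succ x₁ - S.fc z i.succ x₂| ≤ S.Mf i * S.p.nrm (x₁ - x₂) := by
    intro i x₁ h₁ x₂ h₂
    have h3 := V.lip_f z hz i x₂ h₂ x₁ h₁
    rw [map_sub_rev] at h3
    exact abs_sub_le_iff.mpr ⟨V.lip_f z hz i x₁ h₁ x₂ h₂, h3⟩
  have hgb : ∀ i : Fin m, ∀ x₁ ∈ S.p.X, ∀ x₂ ∈ S.p.X,
      |⟪g i.succ x₂, x₁ - x₂⟫| ≤ S.Mf i * S.p.nrm (x₁ - x₂) := fun i x₁ h₁ x₂ h₂ =>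
    abs_inner_le_of_mem_subdiff (V.lip_f z hz i) (hg i.succ x₂ h₂) h₁
  have hcomp : ∀ i : Fin m, |(S.linTrue g z u (t + 1) - S.linTrue g z u t) i|
      ≤ (S.Mχ i + S.Mf i) * S.p.nrm (u (t + 1) - u t)
        + 2 * S.Mf i * S.p.nrm (u t - u (t - 1)) := by
    intro i
    have a1 := abs_le.mp (hχ i _ (hu (t + 1) le_rfl) _ (hu t (by omega)))
    have a2 := abs_le.mp (hgb i _ (hu (t + 1) le_rfl) _ (hu t (by omega)))
    rcases t with _ | t
    · simp only [Pi.sub_apply, linTrue, zero_add, Nat.zero_sub, sub_self, map_zero] at *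
      exact abs_le.mpr ⟨by linarith [a1.1, a2.1], by linarith [a1.2, a2.2]⟩
    · have a3 := abs_le.mp (hf i _ (hu (t + 1) (by omega)) _ (hu t (by omega)))
      have a4 := abs_le.mp (hgb i _ (hu (t + 1) (by omega)) _ (hu t (by omega)))
      simp only [Pi.sub_apply, linTrue, Nat.add_sub_cancel] at *
      exact abs_le.mpr ⟨by linarith [a1.1, a2.1, a3.1, a4.2], by
        linarith [a1.2, a2.2, a3.2, a4.1]⟩
  have h1 := norm_toLp_le_of_abs_le (apply_nonneg S.p.nrm _) (apply_nonneg S.p.nrm _) hcomp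
  have h2 : S.Mχt + S.Mft ≤ S.Mcal := le_max_right _ _
  have h3 : 2 * S.Mft ≤ S.Mcal := le_max_left _ _
  have h4 : WithLp.toLp 2 (S.linTrue g z u (t + 1)) - WithLp.toLp 2 (S.linTrue g z u t)
      = WithLp.toLp 2 (S.linTrue g z u (t + 1) - S.linTrue g z u t) := rfl
  rw [h4]
  refine h1.trans ?_
  rw [mul_add]
  exact add_le_add (mul_le_mul_of_nonneg_right h2 (apply_nonneg _ _))
    (mul_le_mul_of_nonneg_right h3 (apply_nonneg _ _))

/-- ConEx, against the solution `xs` of the subproblem and any dual comparison point `yc` with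
`‖yc‖ ≤ Y + 1`, is an extrapolation scheme. If `τ = 0` the dual iterates stay at zero, and this is
consistent only because the constraint functions are then constant and known exactly. -/
lemma IsConExTrace.extrapolationScheme (V : S.Valid) (H : S.p.Standing) (hz : z ∈ S.p.X)
    (hu₀ : u₀ ∈ S.p.X) (tr : S.IsConExTrace G F B T z u₀ s sbar u y)
    (hg : ∀ i, ∀ x ∈ S.p.X, g i x ∈ subdiff S.p.X (S.fc z i) x)
    {xs : Rn n} (hxs : xs ∈ S.p.X) (hfeas : ∀ i : Fin m, S.p.ψc z i.succ xs ≤ 0)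
    {Y : ℝ} (hY : 0 ≤ Y) (hYB : Y + 1 ≤ B) {yc : Fin m → ℝ} (hyc : ∀ i, 0 ≤ yc i)
    (hycY : Real.sqrt (∑ i, yc i ^ 2) ≤ Y + 1) {E : ℕ → ℝ} (hE0 : ∀ t, 0 ≤ E t)
    (hE : ∀ t < T, ‖WithLp.toLp 2 (S.linErr G F g z sbar u (t + 1))
      - WithLp.toLp 2 (S.linErr G F g z sbar u t)‖ ^ 2 ≤ S.τ B T (t + 1) * E (t + 1))
    (hdeg : S.τbase B T = 0 → S.linErr G F g z sbar u 0 = 0) :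
    ExtrapolationScheme S.α₀ (S.t₀ B) S.Mcal (S.Hstar B Y) (S.η B) (S.θ B) (S.τ B T) T
      (fun t => S.pdGap z (u (t + 1)) xs yc (y (t + 1)))
      (fun t => S.p.W xs (u t)) (fun t => S.p.nrm (u t - u (t - 1)))
      (fun t => dualNorm S.p.nrm (gradErr G g z (u t) (y (t + 1)) (s t)))
      (fun t => ⟪gradErr G g z (u t) (y (t + 1)) (s t), xs - u t⟫) E
      (fun t => WithLp.toLp 2 (y t))
      (fun t => WithLp.toLp 2 (fun i => S.linVal G F z sbar u i t))
      (fun t => WithLp.toLp 2 (S.linErr G F g z sbar u t)) (WithLp.toLp 2 yc) := by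
  have hα : 0 < S.α₀ := H.μ_zero
  have hB : 0 ≤ B := by linarith
  have ht0 := two_le_t₀ V H hB
  have hmem := tr.mem hu₀
  have hdn := tr.dual_nonneg
  refine
    { α_pos := hα
      two_le := ht0
      η_eq := fun t => rfl
      θ_eq := fun t => rfl
      τ_nonneg := τ_nonneg H B T
      τ_anti := τ_anti H B T
      γτ_anti := γτ_anti V H hB T
      Mc_le := Mcal_sq_le H B T
      w_nonneg := fun t ht => H.W_nonneg hxs (hmem t ht)
      a_zero := by simp
      E_nonneg := hE0
      primal_step := ?_
      dual_step := ?_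
      h_diff := ?_ }
  · intro t ht
    have hη : 0 ≤ S.η B t := by
      unfold η
      positivity
    have hu := hmem t ht.le
    have hu' := hmem (t + 1) ht
    have h1 := V.gap_le H hz (hdn (t + 1) ht) hyc hη hu hu' hxs (fun i => hg i _ hu)
      (Δ := fun i => G z i (u t) (s t) - g i (u t)) (by
        simpa using tr.primal_step t ht)
    have hW := mul_le_mul_of_nonneg_left (H.half_sq_le_W hu' hu) hη
    have hL : ∑ i : Fin m, yc i * S.L i.succ ≤ (Y + 1) * S.Lf := sum_mul_le_of_norm_le hycY
    have hH : ∑ i : Fin m, yc i * S.H i.succ ≤ (Y + 1) * S.Hf := sum_mul_le_of_norm_le hycY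
    have hL' : (Y + 1) * S.Lf ≤ B * S.Lf := mul_le_mul_of_nonneg_right hYB S.Lf_nonneg
    have hLt : S.L 0 + B * S.Lf = S.α₀ * (S.t₀ B - 2) / 4 := by
      unfold t₀
      field_simp
      ring
    have ha := apply_nonneg S.p.nrm (u (t + 1) - u t)
    have hL2 : (S.L 0 + ∑ i : Fin m, yc i * S.L i.succ) / 2 * S.p.nrm (u (t + 1) - u t) ^ 2
        ≤ S.α₀ * (S.t₀ B - 2) / 8 * S.p.nrm (u (t + 1) - u t) ^ 2 :=
      mul_le_mul_of_nonneg_right (by linarith) (sq_nonneg _)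
    have hH2 : (S.H 0 + ∑ i : Fin m, yc i * S.H i.succ) * S.p.nrm (u (t + 1) - u t)
        ≤ S.Hstar B Y * S.p.nrm (u (t + 1) - u t) := by
      rw [S.Hstar_eq hYB]
      exact mul_le_mul_of_nonneg_right (by linarith) ha
    have hΔ : ⟪gradErr G g z (u t) (y (t + 1)) (s t), xs - u (t + 1)⟫
        ≤ ⟪gradErr G g z (u t) (y (t + 1)) (s t), xs - u t⟫
          + dualNorm S.p.nrm (gradErr G g z (u t) (y (t + 1)) (s t))
            * S.p.nrm (u (t + 1) - u t) := by
      have e : xs - u (t + 1) = (xs - u t) + (u t - u (t + 1)) := by abel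
      rw [e, inner_add_right, map_sub_rev]
      have := inner_le_dualNorm_mul H.norm_definite
        (gradErr G g z (u t) (y (t + 1)) (s t)) (u t - u (t + 1))
      linarith
    have hin : ∑ i : Fin m, (yc i - y (t + 1) i) * (S.χc z i.succ (u (t + 1))
          + (S.fc z i.succ (u t) + ⟪g i.succ (u t), u (t + 1) - u t⟫))
        = ⟪(WithLp.toLp 2 yc : EuclideanSpace ℝ (Fin m)) - WithLp.toLp 2 (y (t + 1)),
            WithLp.toLp 2 (fun i => S.linVal G F z sbar u i (t + 1))⟫
          - ⟪(WithLp.toLp 2 yc : EuclideanSpace ℝ (Fin m)) - WithLp.toLp 2 (y (t + 1)),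
            WithLp.toLp 2 (S.linErr G F g z sbar u (t + 1))⟫ := by
      rw [← inner_sub_right]
      simp only [PiLp.inner_apply, linVal_eq S G F g z sbar u, PiLp.sub_apply,
        RCLike.inner_apply, conj_trivial, linTrue]
      refine Finset.sum_congr rfl fun i _ => ?_
      ring
    have hη' : S.η B t = S.α₀ * (t + S.t₀ B + 1) / 2 := rfl
    have hfin : S.α₀ * (S.t₀ B - 2) / 8 * S.p.nrm (u (t + 1) - u t) ^ 2
        + S.α₀ * (t + 3) / 4 * S.p.nrm (u (t + 1) - u t) ^ 2
        ≤ S.η B t * (1 / 2 * S.p.nrm (u (t + 1) - u t) ^ 2) := by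
      rw [hη']
      have : 0 ≤ S.α₀ * (S.t₀ B - 2) * S.p.nrm (u (t + 1) - u t) ^ 2 :=
        mul_nonneg (mul_nonneg hα.le (by linarith)) (sq_nonneg _)
      nlinarith
    rw [hin] at h1
    have hα' : S.p.μ 0 = S.α₀ := rfl
    rw [hα'] at h1
    simp only [Nat.add_sub_cancel]
    unfold gradErr at hΔ ⊢
    unfold pdGap
    linarith
  · intro t ht
    have hstep := tr.dual_step t ht
    set τ := S.τ B T t with hτdef
    have hτ : 0 ≤ τ := τ_nonneg H B T t
    set sv : Fin m → ℝ := fun i => (1 + S.θ B t) * S.linVal G F z sbar u i t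
      - S.θ B t * S.linVal G F z sbar u i (t - 1) with hsv
    have hL : ⟪(WithLp.toLp 2 yc : EuclideanSpace ℝ (Fin m)) - WithLp.toLp 2 (y (t + 1)),
        (1 + S.θ B t) • (WithLp.toLp 2 (fun i => S.linVal G F z sbar u i t)
            : EuclideanSpace ℝ (Fin m))
          - S.θ B t • WithLp.toLp 2 (fun i => S.linVal G F z sbar u i (t - 1))⟫
        = ∑ i, (yc i - y (t + 1) i) * sv i := by
      simp only [PiLp.inner_apply, PiLp.sub_apply, PiLp.smul_apply, smul_eq_mul,
        RCLike.inner_apply, conj_trivial, hsv]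
      exact Finset.sum_congr rfl fun i _ => mul_comm _ _
    have hR : τ / 2 * (‖(WithLp.toLp 2 yc : EuclideanSpace ℝ (Fin m)) - WithLp.toLp 2 (y t)‖ ^ 2
        - ‖(WithLp.toLp 2 (y (t + 1)) : EuclideanSpace ℝ (Fin m)) - WithLp.toLp 2 (y t)‖ ^ 2
        - ‖(WithLp.toLp 2 yc : EuclideanSpace ℝ (Fin m)) - WithLp.toLp 2 (y (t + 1))‖ ^ 2)
        = ∑ i, τ * ((yc i - y (t + 1) i) * (y (t + 1) i - y t i)) := by
      simp only [EuclideanSpace.norm_sq_eq, PiLp.sub_apply, Real.norm_eq_abs, sq_abs]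
      rw [← Finset.sum_sub_distrib, ← Finset.sum_sub_distrib, Finset.mul_sum]
      refine Finset.sum_congr rfl fun i _ => ?_
      ring
    rw [hL, hR]
    refine Finset.sum_le_sum fun i _ => ?_
    rcases hτ.eq_or_lt with h0 | hpos
    · -- the degenerate case: constant constraints, without noise
      have hbase : S.τbase B T = 0 := by
        have := τ_eq S B T t
        rw [← hτdef, ← h0] at this
        have h2 : (0 : ℝ) < t + 1 := by positivity
        field_simp at this
        linarith
      have hM : S.Mcal = 0 := by
        have h1 := Mcal_sq_le H B T 0
        rw [τ_eq, hbase] at h1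
        have h2 : S.Mcal ^ 2 = 0 := le_antisymm (by linarith) (sq_nonneg _)
        exact pow_eq_zero_iff two_ne_zero |>.mp h2
      have herr : ∀ r ≤ t, S.linErr G F g z sbar u r = 0 := by
        intro r
        induction r with
        | zero => intro _; exact hdeg hbase
        | succ r ih =>
          intro hr
          have h1 := hE r (by omega)
          rw [τ_eq, hbase, ih (by omega)] at h1
          simp only [zero_div, zero_mul, WithLp.toLp_zero, sub_zero] at h1
          have h2 := pow_eq_zero_iff two_ne_zero |>.mp (le_antisymm h1 (sq_nonneg _))
          exact (WithLp.toLp_eq_zero 2).mp (norm_eq_zero.mp h2)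
      have htrue : ∀ r ≤ t, S.linTrue g z u r = S.linTrue g z u 0 := by
        intro r
        induction r with
        | zero => intro _; rfl
        | succ r ih =>
          intro hr
          have h1 := norm_linTrue_sub_le (u := u) (t := r) V hz hg
            (fun q hq => hmem q (by omega))
          rw [hM, zero_mul] at h1
          have h2 := sub_eq_zero.mp (norm_eq_zero.mp (le_antisymm h1 (norm_nonneg _)))
          rw [← ih (by omega)]
          exact WithLp.toLp_injective 2 h2
      have hval : ∀ r ≤ t, S.linVal G F z sbar u i r = S.linTrue g z u 0 i := by
        intro r hr
        rw [linVal_eq S G F g, herr r hr, htrue r hr, Pi.zero_apply, add_zero]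
      have hneg : S.linTrue g z u 0 i ≤ 0 := by
        have hM1 : S.Mft = 0 := by
          have h1 : 2 * S.Mft ≤ S.Mcal := le_max_left _ _
          linarith [S.Mft_nonneg]
        have hM2 : S.Mχt = 0 := by
          have h1 : S.Mχt + S.Mft ≤ S.Mcal := le_max_right _ _
          linarith [S.Mχt_nonneg]
        have hMf : S.Mf i = 0 := by
          have h1 := (Real.sqrt_eq_zero (Finset.sum_nonneg fun i _ => sq_nonneg _)).mp hM1
          exact pow_eq_zero_iff two_ne_zero |>.mp
            ((Finset.sum_eq_zero_iff_of_nonneg fun i _ => sq_nonneg _).mp h1 i (Finset.mem_univ i))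
        have hMχ : S.Mχ i = 0 := by
          have h1 := (Real.sqrt_eq_zero (Finset.sum_nonneg fun i _ => sq_nonneg _)).mp hM2
          exact pow_eq_zero_iff two_ne_zero |>.mp
            ((Finset.sum_eq_zero_iff_of_nonneg fun i _ => sq_nonneg _).mp h1 i (Finset.mem_univ i))
        have h1 := V.lip_f z hz i (u 0) (hmem 0 (by omega)) xs hxs
        have h2 := V.lip_χ z hz i (u 0) (hmem 0 (by omega)) xs hxs
        rw [hMf, zero_mul] at h1
        rw [hMχ, zero_mul] at h2
        have h3 := hfeas i
        rw [V.ψc_eq z i.succ hxs] at h3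
        simp only [linTrue]
        linarith
      have hy0 : y (t + 1) i = 0 := by
        have : ∀ r ≤ t + 1, y r i = 0 := by
          intro r
          induction r with
          | zero => intro _; rw [tr.init_dual]; rfl
          | succ r ih =>
            intro hr
            rw [tr.dual_step r (by omega), ih (by omega), τ_eq, hbase]
            simp
        exact this _ le_rfl
      have hsi : sv i ≤ 0 := by
        simp only [hsv]
        rw [hval t le_rfl, hval (t - 1) (by omega)]
        linarith
      rw [← h0, zero_mul, hy0, sub_zero]
      exact mul_nonpos_of_nonneg_of_nonpos (hyc i) hsi
    · have h1 : sv i = τ * (1 / τ * sv i) := by field_simp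
      have h2 : (yc i - y (t + 1) i) * (1 / τ * sv i)
          ≤ (yc i - y (t + 1) i) * (y (t + 1) i - y t i) := by
        have h3 : y (t + 1) i = max (y t i + 1 / τ * sv i) 0 := hstep i
        rcases le_total 0 (y t i + 1 / τ * sv i) with h4 | h4
        · rw [max_eq_left h4] at h3
          rw [h3]
          apply le_of_eq
          ring
        · rw [max_eq_right h4] at h3
          rw [h3]
          have := mul_nonneg (hyc i) (neg_nonneg.mpr h4)
          linarith
      calc (yc i - y (t + 1) i) * sv i = τ * ((yc i - y (t + 1) i) * (1 / τ * sv i)) := by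
            rw [h1]; field_simp
        _ ≤ _ := mul_le_mul_of_nonneg_left h2 hτ
  · intro t ht
    have h1 := norm_linTrue_sub_le (u := u) (t := t) V hz hg (fun q hq => hmem q (by omega))
    have h2 := hE t ht
    have e : ∀ r, (WithLp.toLp 2 (fun i => S.linVal G F z sbar u i r) : EuclideanSpace ℝ (Fin m))
        = WithLp.toLp 2 (S.linTrue g z u r) + WithLp.toLp 2 (S.linErr G F g z sbar u r) := by
      intro r
      rw [← WithLp.toLp_add]
      congr 1
      funext i
      exact linVal_eq S G F g z sbar u r i
    have e2 : (WithLp.toLp 2 (fun i => S.linVal G F z sbar u i (t + 1))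
          : EuclideanSpace ℝ (Fin m))
        - WithLp.toLp 2 (fun i => S.linVal G F z sbar u i t)
        = (WithLp.toLp 2 (S.linTrue g z u (t + 1)) - WithLp.toLp 2 (S.linTrue g z u t))
          + (WithLp.toLp 2 (S.linErr G F g z sbar u (t + 1))
            - WithLp.toLp 2 (S.linErr G F g z sbar u t)) := by
      rw [e, e]
      abel
    rw [e2]
    set A := (WithLp.toLp 2 (S.linTrue g z u (t + 1)) : EuclideanSpace ℝ (Fin m))
      - WithLp.toLp 2 (S.linTrue g z u t)
    set D := (WithLp.toLp 2 (S.linErr G F g z sbar u (t + 1)) : EuclideanSpace ℝ (Fin m))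
            - WithLp.toLp 2 (S.linErr G F g z sbar u t)
    have h3 : ‖A + D‖ ^ 2 ≤ 2 * ‖A‖ ^ 2 + 2 * ‖D‖ ^ 2 := by
      have := norm_add_le A D
      nlinarith [norm_nonneg (A + D), sq_nonneg (‖A‖ - ‖D‖)]
    have h4 : ‖A‖ ^ 2 ≤ (S.Mcal * (S.p.nrm (u (t + 1) - u t) + S.p.nrm (u t - u (t - 1)))) ^ 2 := by
      gcongr
    have h5 : 0 ≤ S.Mcal ^ 2 * (S.p.nrm (u (t + 1) - u t) - S.p.nrm (u t - u (t - 1))) ^ 2 := by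
      positivity
    simp only [Nat.add_sub_cancel]
    nlinarith

end Trace

end ConExSetup

/-! ### Residuals of a run of ConEx -/

namespace ConExSetup

variable {n m : ℕ} {S : ConExSetup n m}

section Residual

variable {Ξ : Type*}
  {G : Rn n → Fin (m + 1) → Rn n → Ξ → Rn n} {F : Rn n → Fin m → Rn n → Ξ → ℝ}
  {g : Fin (m + 1) → Rn n → Rn n} {z : Rn n} {s sbar : ℕ → Ξ} {u : ℕ → Rn n}
  {y : ℕ → Fin m → ℝ} {B : ℝ} {T : ℕ} {u₀ : Rn n}

/-- A bound for the weighted gaps of the first `N` ConEx steps, uniform in the dual comparison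
point. It separates into a constant, error terms with zero mean, and error terms of second order. -/
def remainder (S : ConExSetup n m) (G : Rn n → Fin (m + 1) → Rn n → Ξ → Rn n)
    (F : Rn n → Fin m → Rn n → Ξ → ℝ) (g : Fin (m + 1) → Rn n → Rn n) (B Y : ℝ) (T : ℕ)
    (z xs : Rn n) (s sbar : ℕ → Ξ) (u : ℕ → Rn n) (y : ℕ → Fin m → ℝ) (E : ℕ → ℝ) (N : ℕ) : ℝ :=
  S.α₀ * (S.t₀ B + 2) * (S.t₀ B + 1) / 4 * S.p.DX ^ 2
    + (S.t₀ B + 2) * S.τbase B T / 2 * (Y + 1) ^ 2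
    + ∑ t ∈ Finset.range N, (((t : ℝ) + S.t₀ B + 2)
        * ⟪gradErr G g z (u t) (y (t + 1)) (s t), xs - u t⟫
      + (t + S.t₀ B + 2) * ∑ i, y (t + 1) i * S.linErr G F g z sbar u (t + 1) i
      + 16 * S.t₀ B / S.α₀ * (S.Hstar B Y ^ 2
        + dualNorm S.p.nrm (gradErr G g z (u t) (y (t + 1)) (s t)) ^ 2))
    + (Y + 1) * ‖∑ t ∈ Finset.range N, ((t : ℝ) + S.t₀ B + 2) •
        (WithLp.toLp 2 (S.linErr G F g z sbar u (t + 1)) : EuclideanSpace ℝ (Fin m))‖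
    + 2 * ∑ t ∈ Finset.range N, ((t : ℝ) + S.t₀ B + 2) * E (t + 1)

lemma IsConExTrace.sum_pdGap_le (V : S.Valid) (H : S.p.Standing) (hz : z ∈ S.p.X)
    (hu₀ : u₀ ∈ S.p.X) (tr : S.IsConExTrace G F B T z u₀ s sbar u y)
    (hg : ∀ i, ∀ x ∈ S.p.X, g i x ∈ subdiff S.p.X (S.fc z i) x)
    {xs : Rn n} (hxs : xs ∈ S.p.X) (hfeas : ∀ i : Fin m, S.p.ψc z i.succ xs ≤ 0)
    {Y : ℝ} (hY : 0 ≤ Y) (hYB : Y + 1 ≤ B) {yc : Fin m → ℝ} (hyc : ∀ i, 0 ≤ yc i)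
    (hycY : Real.sqrt (∑ i, yc i ^ 2) ≤ Y + 1) {E : ℕ → ℝ} (hE0 : ∀ t, 0 ≤ E t)
    (hE : ∀ t < T, ‖WithLp.toLp 2 (S.linErr G F g z sbar u (t + 1))
      - WithLp.toLp 2 (S.linErr G F g z sbar u t)‖ ^ 2 ≤ S.τ B T (t + 1) * E (t + 1))
    (hdeg : S.τbase B T = 0 → S.linErr G F g z sbar u 0 = 0) {N : ℕ} (hN : N < T) :
    ∑ t ∈ Finset.range (N + 1), ((t : ℝ) + S.t₀ B + 2)
        * S.pdGap z (u (t + 1)) xs yc (y (t + 1))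
      + (N + S.t₀ B + 2) * S.τ B T N / 4 * ∑ i, (yc i - y (N + 1) i) ^ 2
    ≤ S.remainder G F g B Y T z xs s sbar u y E (N + 1) := by
  have hα : 0 < S.α₀ := H.μ_zero
  have ht0 := two_le_t₀ V H (by linarith : 0 ≤ B)
  have h1 := (tr.extrapolationScheme V H hz hu₀ hg hxs hfeas hY hYB hyc hycY hE0 hE
    hdeg).sum_gap_le hN
  have hW : S.p.W xs (u 0) ≤ S.p.DX ^ 2 / 2 := by
    have := H.two_W_le_DX_sq hxs (tr.mem hu₀ 0 (by omega))
    linarith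
  have hW' := mul_le_mul_of_nonneg_left hW
    (by positivity : 0 ≤ S.α₀ * (S.t₀ B + 2) * (S.t₀ B + 1) / 2)
  have hyn : ‖(WithLp.toLp 2 yc : EuclideanSpace ℝ (Fin m))‖ ≤ Y + 1 := by
    rw [EuclideanSpace.norm_eq]
    simpa using hycY
  have hτ0 : S.τ B T 0 = S.τbase B T := by rw [τ_eq]; simp
  have hb := τbase_nonneg H B T
  have hd : (S.t₀ B + 2) * S.τ B T 0 / 2
      * ‖(WithLp.toLp 2 yc : EuclideanSpace ℝ (Fin m)) - WithLp.toLp 2 (y 0)‖ ^ 2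
      ≤ (S.t₀ B + 2) * S.τbase B T / 2 * (Y + 1) ^ 2 := by
    rw [tr.init_dual, WithLp.toLp_zero, sub_zero, hτ0]
    gcongr
  have hn : ‖(WithLp.toLp 2 yc : EuclideanSpace ℝ (Fin m)) - WithLp.toLp 2 (y (N + 1))‖ ^ 2
      = ∑ i, (yc i - y (N + 1) i) ^ 2 := by
    simp [EuclideanSpace.norm_sq_eq]
  rw [hn] at h1
  -- the part of the dual noise that is paired with the comparison point
  have hsplit : ∑ t ∈ Finset.range (N + 1),
      (((t : ℝ) + S.t₀ B + 2) * ⟪gradErr G g z (u t) (y (t + 1)) (s t), xs - u t⟫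
        - (t + S.t₀ B + 2) * ⟪(WithLp.toLp 2 yc : EuclideanSpace ℝ (Fin m))
            - WithLp.toLp 2 (y (t + 1)), WithLp.toLp 2 (S.linErr G F g z sbar u (t + 1))⟫
        + 16 * S.t₀ B / S.α₀ * (S.Hstar B Y ^ 2
          + dualNorm S.p.nrm (gradErr G g z (u t) (y (t + 1)) (s t)) ^ 2))
      = ∑ t ∈ Finset.range (N + 1), (((t : ℝ) + S.t₀ B + 2)
          * ⟪gradErr G g z (u t) (y (t + 1)) (s t), xs - u t⟫
        + (t + S.t₀ B + 2) * ∑ i, y (t + 1) i * S.linErr G F g z sbar u (t + 1) i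
        + 16 * S.t₀ B / S.α₀ * (S.Hstar B Y ^ 2
          + dualNorm S.p.nrm (gradErr G g z (u t) (y (t + 1)) (s t)) ^ 2))
        + ⟪-(WithLp.toLp 2 yc : EuclideanSpace ℝ (Fin m)),
          ∑ t ∈ Finset.range (N + 1), ((t : ℝ) + S.t₀ B + 2) •
          (WithLp.toLp 2 (S.linErr G F g z sbar u (t + 1)) : EuclideanSpace ℝ (Fin m))⟫ := by
    rw [inner_sum, ← Finset.sum_add_distrib]
    refine Finset.sum_congr rfl fun t _ => ?_
    have e : ∑ i, y (t + 1) i * S.linErr G F g z sbar u (t + 1) i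
        = ⟪(WithLp.toLp 2 (y (t + 1)) : EuclideanSpace ℝ (Fin m)),
          WithLp.toLp 2 (S.linErr G F g z sbar u (t + 1))⟫ := by
      simp only [PiLp.inner_apply, RCLike.inner_apply, conj_trivial]
      exact Finset.sum_congr rfl fun i _ => mul_comm _ _
    rw [e, real_inner_smul_right, inner_sub_left, inner_neg_left]
    ring
  have hcs : ⟪-(WithLp.toLp 2 yc : EuclideanSpace ℝ (Fin m)),
      ∑ t ∈ Finset.range (N + 1), ((t : ℝ) + S.t₀ B + 2) •
      (WithLp.toLp 2 (S.linErr G F g z sbar u (t + 1)) : EuclideanSpace ℝ (Fin m))⟫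
      ≤ (Y + 1) * ‖∑ t ∈ Finset.range (N + 1), ((t : ℝ) + S.t₀ B + 2) •
        (WithLp.toLp 2 (S.linErr G F g z sbar u (t + 1)) : EuclideanSpace ℝ (Fin m))‖ := by
    refine (real_inner_le_norm _ _).trans ?_
    rw [norm_neg]
    gcongr
  rw [hsplit] at h1
  unfold remainder
  linarith

end Residual

section Consequences

variable {Ξ : Type*}
  {G : Rn n → Fin (m + 1) → Rn n → Ξ → Rn n} {F : Rn n → Fin m → Rn n → Ξ → ℝ}
  {g : Fin (m + 1) → Rn n → Rn n} {z : Rn n} {s sbar : ℕ → Ξ} {u : ℕ → Rn n}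
  {y : ℕ → Fin m → ℝ} {B : ℝ} {T : ℕ} {u₀ : Rn n}

/-- Against a primal-dual pair the gap is nonnegative. -/
lemma pdGap_nonneg (H : S.p.Standing) {x xs : Rn n} {ys yc : Fin m → ℝ}
    (hk : S.p.IsSubKKT z xs ys) (hx : x ∈ S.p.X) (hyc : ∀ i, 0 ≤ yc i) :
    0 ≤ S.pdGap z x xs ys yc := by
  have h1 := hk.lagrangian_strong H hx
  have h2 : ∑ i : Fin m, yc i * S.p.ψc z i.succ xs ≤ 0 :=
    Finset.sum_nonpos fun i _ => mul_nonpos_of_nonneg_of_nonpos (hyc i) (hk.feasible i)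
  have h3 := hk.sum_mul_nonneg H
  have h4 := H.μ_zero
  have : 0 ≤ (S.p.μ 0 + ∑ i : Fin m, ys i * S.p.μ i.succ) / 2 * S.p.nrm (x - xs) ^ 2 := by
    positivity
  unfold pdGap
  linarith

/-- The total weight of the first `T` iterates. -/
def Γ (S : ConExSetup n m) (B : ℝ) (T : ℕ) : ℝ := ∑ t ∈ Finset.range T, S.γ B t

lemma sq_le_Γ (V : S.Valid) (H : S.p.Standing) (hB : 0 ≤ B) (T : ℕ) :
    (T : ℝ) ^ 2 / 2 ≤ S.Γ B T := by
  have ht0 := two_le_t₀ V H hB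
  unfold Γ
  induction T with
  | zero => simp
  | succ T ih =>
    rw [Finset.sum_range_succ]
    unfold γ at *
    push_cast
    nlinarith

lemma Γ_pos (V : S.Valid) (H : S.p.Standing) (hB : 0 ≤ B) (hT : 1 ≤ T) : 0 < S.Γ B T := by
  have h1 := sq_le_Γ V H hB T
  have h2 : (1 : ℝ) ≤ T := by exact_mod_cast hT
  nlinarith

lemma γ_pos (V : S.Valid) (H : S.p.Standing) (hB : 0 ≤ B) (t : ℕ) : 0 < S.γ B t := by
  have ht0 := two_le_t₀ V H hB
  unfold γ
  positivity

lemma IsConExTrace.output_mem (V : S.Valid) (H : S.p.Standing) (hB : 0 ≤ B) (hT : 1 ≤ T)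
    (tr : S.IsConExTrace G F B T z u₀ s sbar u y) :
    (∑ t ∈ Finset.range T, S.γ B t)⁻¹ • ∑ t ∈ Finset.range T, S.γ B t • u (t + 1) ∈ S.p.X :=
  H.convex_X.centerMass_mem (t := Finset.range T) (w := S.γ B) (z := fun t => u (t + 1))
    (fun t _ => (γ_pos V H hB t).le) (Γ_pos V H hB hT)
    (fun t ht => tr.primal_mem t (Finset.mem_range.mp ht))

/-- By convexity, the weighted average of the iterates inherits the average gap. -/
lemma IsConExTrace.Γ_mul_le (V : S.Valid) (H : S.p.Standing) (hB : 0 ≤ B)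
    (hT : 1 ≤ T) (tr : S.IsConExTrace G F B T z u₀ s sbar u y)
    {xs : Rn n} (hfeas : ∀ i : Fin m, S.p.ψc z i.succ xs ≤ 0)
    {yc : Fin m → ℝ} (hyc : ∀ i, 0 ≤ yc i) {x : Rn n}
    (hx : x = (∑ t ∈ Finset.range T, S.γ B t)⁻¹ • ∑ t ∈ Finset.range T, S.γ B t • u (t + 1)) :
    S.Γ B T * (S.p.ψc z 0 x + ∑ i : Fin m, yc i * S.p.ψc z i.succ x - S.p.ψc z 0 xs)
      ≤ ∑ t ∈ Finset.range T, ((t : ℝ) + S.t₀ B + 2)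
        * S.pdGap z (u (t + 1)) xs yc (y (t + 1)) := by
  have hΓ := Γ_pos V H hB hT
  have hconv : ConvexOn ℝ S.p.X
      (fun x => S.p.ψc z 0 x + ∑ i : Fin m, yc i * S.p.ψc z i.succ x) := by
    refine (V.convexOn_ψc H z 0).add ?_
    have h : ∀ s : Finset (Fin m),
        ConvexOn ℝ S.p.X (fun x => ∑ i ∈ s, yc i * S.p.ψc z i.succ x) := by
      classical
      intro s
      induction s using Finset.induction_on with
      | empty => simpa using convexOn_const 0 H.convex_X
      | insert i s hi ih =>
        simp_rw [Finset.sum_insert hi]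
        exact ((V.convexOn_ψc H z i.succ).smul (hyc i)).add ih
    exact h _
  have h1 := hconv.map_centerMass_le (t := Finset.range T) (w := S.γ B)
    (p := fun t => u (t + 1)) (fun t _ => (γ_pos V H hB t).le) hΓ
    (fun t ht => tr.primal_mem t (Finset.mem_range.mp ht))
  have h2 : (Finset.range T).centerMass (S.γ B) (fun t => u (t + 1)) = x := hx.symm
  rw [h2] at h1
  unfold Finset.centerMass at h1
  have h3 := mul_le_mul_of_nonneg_left h1 hΓ.le
  have h4 : S.Γ B T * ((∑ i ∈ Finset.range T, S.γ B i)⁻¹ •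
      ∑ i ∈ Finset.range T, S.γ B i • ((fun x => S.p.ψc z 0 x
        + ∑ i : Fin m, yc i * S.p.ψc z i.succ x) ∘ fun t => u (t + 1)) i)
      = ∑ t ∈ Finset.range T, S.γ B t * (S.p.ψc z 0 (u (t + 1))
        + ∑ i : Fin m, yc i * S.p.ψc z i.succ (u (t + 1))) := by
    rw [smul_eq_mul, ← mul_assoc]
    have : S.Γ B T * (∑ i ∈ Finset.range T, S.γ B i)⁻¹ = 1 := mul_inv_cancel₀ hΓ.ne'
    rw [this, one_mul]
    rfl
  rw [h4] at h3
  have h5 : ∑ t ∈ Finset.range T, (S.γ B t * (S.p.ψc z 0 (u (t + 1))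
        + ∑ i : Fin m, yc i * S.p.ψc z i.succ (u (t + 1))) - S.γ B t * S.p.ψc z 0 xs)
      ≤ ∑ t ∈ Finset.range T, ((t : ℝ) + S.t₀ B + 2)
        * S.pdGap z (u (t + 1)) xs yc (y (t + 1)) := by
    refine Finset.sum_le_sum fun t ht => ?_
    have hn := tr.dual_nonneg (t + 1) (Finset.mem_range.mp ht)
    have h6 : ∑ i : Fin m, y (t + 1) i * S.p.ψc z i.succ xs ≤ 0 :=
      Finset.sum_nonpos fun i _ => mul_nonpos_of_nonneg_of_nonpos (hn i) (hfeas i)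
    rw [← mul_sub]
    refine mul_le_mul_of_nonneg_left ?_ (γ_pos V H hB t).le
    unfold pdGap
    linarith
  rw [Finset.sum_sub_distrib, ← Finset.sum_mul] at h5
  have h7 : (∑ t ∈ Finset.range T, S.γ B t) = S.Γ B T := rfl
  rw [h7] at h5
  linarith

/-- Deterministic consequences of the remainder bound: the dual iterates stay near the multiplier,
and the output has small constraint violation and small optimality gap. -/
theorem IsConExTrace.residuals_le (V : S.Valid) (H : S.p.Standing) (hz : z ∈ S.p.X)
    (hu₀ : u₀ ∈ S.p.X) (tr : S.IsConExTrace G F B T z u₀ s sbar u y)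
    (hg : ∀ i, ∀ x ∈ S.p.X, g i x ∈ subdiff S.p.X (S.fc z i) x)
    {xs : Rn n} {ys : Fin m → ℝ} (hk : S.p.IsSubKKT z xs ys)
    {Y : ℝ} (hY : 0 ≤ Y) (hYB : Y + 1 ≤ B)
    (hysY : Real.sqrt (∑ i, ys i ^ 2) ≤ Y) {E : ℕ → ℝ} (hE0 : ∀ t, 0 ≤ E t)
    (hE : ∀ t < T, ‖WithLp.toLp 2 (S.linErr G F g z sbar u (t + 1))
      - WithLp.toLp 2 (S.linErr G F g z sbar u t)‖ ^ 2 ≤ S.τ B T (t + 1) * E (t + 1))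
    (hdeg : S.τbase B T = 0 → S.linErr G F g z sbar u 0 = 0) :
    (∀ N < T, (N + S.t₀ B + 2) * S.τ B T N / 4 * ∑ i, (ys i - y (N + 1) i) ^ 2
      ≤ S.remainder G F g B Y T z xs s sbar u y E (N + 1)) ∧
    (∀ x, 1 ≤ T →
      x = (∑ t ∈ Finset.range T, S.γ B t)⁻¹ • ∑ t ∈ Finset.range T, S.γ B t • u (t + 1) →
      S.Γ B T * S.p.subViol z x ≤ S.remainder G F g B Y T z xs s sbar u y E T ∧
      S.Γ B T * (S.p.ψc z 0 x - S.p.subOpt z) ≤ S.remainder G F g B Y T z xs s sbar u y E T ∧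
      -(Y * S.p.subViol z x) ≤ S.p.ψc z 0 x - S.p.subOpt z) := by
  have hB : 0 ≤ B := by linarith
  have ht0 := two_le_t₀ V H hB
  have hsum : ∀ {yc : Fin m → ℝ}, (∀ i, 0 ≤ yc i) → Real.sqrt (∑ i, yc i ^ 2) ≤ Y + 1 →
      ∀ {N : ℕ}, N < T → ∑ t ∈ Finset.range (N + 1), ((t : ℝ) + S.t₀ B + 2)
        * S.pdGap z (u (t + 1)) xs yc (y (t + 1))
      + (N + S.t₀ B + 2) * S.τ B T N / 4 * ∑ i, (yc i - y (N + 1) i) ^ 2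
      ≤ S.remainder G F g B Y T z xs s sbar u y E (N + 1) := fun {yc} hyc hycY {N} hN =>
    tr.sum_pdGap_le V H hz hu₀ hg hk.mem hk.feasible hY hYB hyc hycY hE0 hE hdeg (N := N) hN
  have hpd : ∀ N ≤ T, 0 ≤ ∑ t ∈ Finset.range N, ((t : ℝ) + S.t₀ B + 2)
      * S.pdGap z (u (t + 1)) xs ys (y (t + 1)) := fun N hN =>
    Finset.sum_nonneg fun t ht => by
      have ht' : t < T := lt_of_lt_of_le (Finset.mem_range.mp ht) hN
      exact mul_nonneg (by positivity)
        (pdGap_nonneg H hk (tr.primal_mem t ht') (tr.dual_nonneg (t + 1) ht'))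
  refine ⟨fun N hN => ?_, fun x hT hx => ?_⟩
  · have h1 := hsum hk.nonneg (by linarith) hN
    have h2 := hpd (N + 1) hN
    linarith
  have hxX : x ∈ S.p.X := hx ▸ tr.output_mem V H hB hT
  have hΓ := Γ_pos V H hB hT
  have hrem : ∀ {yc : Fin m → ℝ}, (∀ i, 0 ≤ yc i) → Real.sqrt (∑ i, yc i ^ 2) ≤ Y + 1 →
      S.Γ B T * (S.p.ψc z 0 x + ∑ i : Fin m, yc i * S.p.ψc z i.succ x - S.p.ψc z 0 xs)
        ≤ S.remainder G F g B Y T z xs s sbar u y E T := by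
    intro yc hyc hycY
    obtain ⟨N, rfl⟩ := Nat.exists_eq_add_of_le' hT
    have h1 := hsum hyc hycY (N := N) (by omega)
    have h2 := tr.Γ_mul_le V H hB hT hk.feasible hyc hx
    have h3 : 0 ≤ (N + S.t₀ B + 2) * S.τ B (N + 1) N / 4 * ∑ i, (yc i - y (N + 1) i) ^ 2 := by
      have := τ_nonneg H B (N + 1) N
      have h4 : 0 ≤ ∑ i, (yc i - y (N + 1) i) ^ 2 := Finset.sum_nonneg fun i _ => sq_nonneg _
      positivity
    linarith
  have hLag := hk.lagrangian_strong H hxX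
  have hq : 0 ≤ (S.p.μ 0 + ∑ i : Fin m, ys i * S.p.μ i.succ) / 2 * S.p.nrm (x - xs) ^ 2 := by
    have h3 := hk.sum_mul_nonneg H
    have h4 := H.μ_zero
    positivity
  have hv0 : 0 ≤ S.p.subViol z x := Real.sqrt_nonneg _
  rw [hk.subOpt_eq H]
  refine ⟨?_, ?_, ?_⟩
  · rcases hv0.eq_or_lt with h0 | hv
    · rw [← h0, mul_zero]
      have h1 := hrem hk.nonneg (by linarith)
      refine le_trans (mul_nonneg hΓ.le ?_) h1
      linarith
    · set v : Fin m → ℝ := fun i => max (S.p.ψc z i.succ x) 0 with hvdef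
      have hvv : S.p.subViol z x = Real.sqrt (∑ i, v i ^ 2) := rfl
      set r := S.p.subViol z x with hr
      have hr2 : ∑ i, v i ^ 2 = r ^ 2 := by
        rw [hvv, Real.sq_sqrt (Finset.sum_nonneg fun i _ => sq_nonneg _)]
      -- the multiplier, shifted by one in the direction of the violation
      have hyc : ∀ i, 0 ≤ ys i + v i / r := fun i =>
        add_nonneg (hk.nonneg i) (div_nonneg (le_max_right _ _) hv.le)
      have hnorm : Real.sqrt (∑ i, (ys i + v i / r) ^ 2) ≤ Y + 1 := by
        have h1 : ∀ w : Fin m → ℝ, Real.sqrt (∑ i, w i ^ 2)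
            = ‖(WithLp.toLp 2 w : EuclideanSpace ℝ (Fin m))‖ := fun w => by
          simp [EuclideanSpace.norm_eq]
        have h2 : (WithLp.toLp 2 (fun i => ys i + v i / r) : EuclideanSpace ℝ (Fin m))
            = WithLp.toLp 2 ys + r⁻¹ • WithLp.toLp 2 v := by
          ext i
          simp [div_eq_inv_mul]
        rw [h1, h2]
        refine (norm_add_le _ _).trans ?_
        rw [norm_smul, ← h1, ← h1, ← hvv, Real.norm_of_nonneg (inv_nonneg.mpr hv.le),
          inv_mul_cancel₀ hv.ne']
        linarith
      have h1 := hrem hyc hnorm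
      refine le_trans (mul_le_mul_of_nonneg_left ?_ hΓ.le) h1
      have h2 : ∑ i : Fin m, (ys i + v i / r) * S.p.ψc z i.succ x
          = ∑ i : Fin m, ys i * S.p.ψc z i.succ x + r := by
        have h3 : ∀ i : Fin m, v i * S.p.ψc z i.succ x = v i ^ 2 := by
          intro i
          simp only [hvdef]
          rcases le_total (S.p.ψc z i.succ x) 0 with h | h
          · rw [max_eq_right h]; ring
          · rw [max_eq_left h]; ring
        have h4 : ∑ i : Fin m, v i / r * S.p.ψc z i.succ x = r := by
          have : ∀ i : Fin m, v i / r * S.p.ψc z i.succ x = v i ^ 2 / r := fun i => by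
            rw [div_mul_eq_mul_div, h3]
          simp_rw [this]
          rw [← Finset.sum_div, hr2]
          field_simp
        simp_rw [add_mul]
        rw [Finset.sum_add_distrib, h4]
      rw [h2]
      linarith
  · have h1 := hrem (yc := 0) (fun _ => le_rfl) (by simp; linarith)
    simpa using h1
  · have h1 := Problem.sum_mul_le_sqrt_sum_max_sq hk.nonneg (fun i => S.p.ψc z i.succ x)
    have h2 : Real.sqrt (∑ i, ys i ^ 2) * S.p.subViol z x ≤ Y * S.p.subViol z x :=
      mul_le_mul_of_nonneg_right hysY hv0
    unfold Problem.subViol at h2 ⊢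
    linarith

end Consequences

end ConExSetup

/-! ### Noise of the oracle along a random run -/

section Conditioning

variable {Ω α Ξ : Type*} [MeasurableSpace Ω] [MeasurableSpace α] [MeasurableSpace Ξ]
  {P : Measure Ω} [IsProbabilityMeasure P] {ν : Measure Ξ} [IsProbabilityMeasure ν]
  {V : Ω → α} {s : Ω → Ξ}

omit [IsProbabilityMeasure ν] in
lemma map_prodMk_eq_of_indepFun (hV : Measurable V) (hs : Measurable s) (hν : P.map s = ν)
    (hind : IndepFun V s P) : P.map (fun a => (V a, s a)) = (P.map V).prod ν := by
  rw [← hν]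
  exact (indepFun_iff_map_prod_eq_prod_map_map hV.aemeasurable hs.aemeasurable).mp hind

/-- Bounding an expectation by integrating first over an independent sample. -/
lemma integral_le_of_fiberwise (hV : Measurable V) (hs : Measurable s) (hν : P.map s = ν)
    (hind : IndepFun V s P) {f b : Ω → ℝ} {Φ : α → Ξ → ℝ}
    (hΦ : Measurable fun q : α × Ξ => Φ q.1 q.2) (hf : Measurable f) (hf0 : ∀ a, 0 ≤ f a)
    (hle : ∀ a, f a ≤ Φ (V a) (s a)) (hb : Integrable b P) (hb0 : ∀ a, 0 ≤ b a)
    (hfib : ∀ a, ∫⁻ x, ENNReal.ofReal (Φ (V a) x) ∂ν ≤ ENNReal.ofReal (b a)) :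
    Integrable f P ∧ ∫ a, f a ∂P ≤ ∫ a, b a ∂P := by
  have hm : Measurable fun q : α × Ξ => ENNReal.ofReal (Φ q.1 q.2) :=
    ENNReal.measurable_ofReal.comp hΦ
  have h1 : ∫⁻ a, ENNReal.ofReal (f a) ∂P ≤ ENNReal.ofReal (∫ a, b a ∂P) := by
    calc ∫⁻ a, ENNReal.ofReal (f a) ∂P
        ≤ ∫⁻ a, ENNReal.ofReal (Φ (V a) (s a)) ∂P :=
          lintegral_mono fun a => ENNReal.ofReal_le_ofReal (hle a)
      _ = ∫⁻ q, ENNReal.ofReal (Φ q.1 q.2) ∂((P.map V).prod ν) := by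
          rw [← map_prodMk_eq_of_indepFun hV hs hν hind, lintegral_map hm (hV.prodMk hs)]
      _ = ∫⁻ v, ∫⁻ x, ENNReal.ofReal (Φ v x) ∂ν ∂(P.map V) := lintegral_prod _ hm.aemeasurable
      _ = ∫⁻ a, ∫⁻ x, ENNReal.ofReal (Φ (V a) x) ∂ν ∂P :=
          lintegral_map hm.lintegral_prod_right' hV
      _ ≤ ∫⁻ a, ENNReal.ofReal (b a) ∂P := lintegral_mono hfib
      _ = ENNReal.ofReal (∫ a, b a ∂P) :=
          (ofReal_integral_eq_lintegral_ofReal hb (Filter.Eventually.of_forall hb0)).symm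
  have hint : Integrable f P := by
    refine ⟨hf.aestronglyMeasurable, ?_⟩
    rw [hasFiniteIntegral_iff_ofReal (Filter.Eventually.of_forall hf0)]
    exact h1.trans_lt ENNReal.ofReal_lt_top
  refine ⟨hint, ?_⟩
  rw [← ofReal_integral_eq_lintegral_ofReal hint (Filter.Eventually.of_forall hf0)] at h1
  exact (ENNReal.ofReal_le_ofReal_iff (integral_nonneg hb0)).mp h1

/-- A quantity with zero mean given an independent sample has zero expectation. -/
lemma integral_eq_zero_of_fiberwise (hV : Measurable V) (hs : Measurable s) (hν : P.map s = ν)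
    (hind : IndepFun V s P) {Φ : α → Ξ → ℝ} (hΦ : Measurable fun q : α × Ξ => Φ q.1 q.2)
    (hint : Integrable (fun a => Φ (V a) (s a)) P) (h0 : ∀ a, ∫ x, Φ (V a) x ∂ν = 0) :
    ∫ a, Φ (V a) (s a) ∂P = 0 := by
  have hmap := map_prodMk_eq_of_indepFun hV hs hν hind
  have hint' : Integrable (fun q : α × Ξ => Φ q.1 q.2) ((P.map V).prod ν) := by
    rw [← hmap]
    exact (integrable_map_measure hΦ.aestronglyMeasurable (hV.prodMk hs).aemeasurable).mpr hint
  calc ∫ a, Φ (V a) (s a) ∂P = ∫ q, Φ q.1 q.2 ∂((P.map V).prod ν) := by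
        rw [← hmap, integral_map (hV.prodMk hs).aemeasurable hΦ.aestronglyMeasurable]
    _ = ∫ v, ∫ x, Φ v x ∂ν ∂(P.map V) := integral_prod _ hint'
    _ = ∫ a, ∫ x, Φ (V a) x ∂ν ∂P :=
        integral_map hV.aemeasurable
          hΦ.stronglyMeasurable.integral_prod_right.aestronglyMeasurable
    _ = 0 := by simp [h0]

omit [IsProbabilityMeasure P] in
lemma integrable_inner_of_memLp {E : Type*} [NormedAddCommGroup E] [InnerProductSpace ℝ E]
    {f g : Ω → E} (hf : MemLp f 2 P) (hg : MemLp g 2 P) : Integrable (fun a => ⟪f a, g a⟫) P := by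
  have h1 : Integrable (fun a => ‖f a‖ ^ 2) P := hf.integrable_norm_pow (by norm_num)
  have h2 : Integrable (fun a => ‖g a‖ ^ 2) P := hg.integrable_norm_pow (by norm_num)
  refine Integrable.mono' (h1.add h2) (hf.1.inner hg.1) (Filter.Eventually.of_forall fun a => ?_)
  refine (norm_inner_le_norm (𝕜 := ℝ) _ _).trans ?_
  simp only [Pi.add_apply]
  have := sq_nonneg (‖f a‖ - ‖g a‖)
  nlinarith [sq_nonneg (‖f a‖), sq_nonneg ‖g a‖]

end Conditioning

namespace ConExSetup

variable {n m : ℕ} {S : ConExSetup n m}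

section Oracle

variable {Ξ : Type*} [MeasurableSpace Ξ] {ν : Measure Ξ} [IsProbabilityMeasure ν]
  {G : Rn n → Fin (m + 1) → Rn n → Ξ → Rn n} {F : Rn n → Fin m → Rn n → Ξ → ℝ}

/-- Noise of the gradient estimates. -/
def noiseG (ν : Measure Ξ) (G : Rn n → Fin (m + 1) → Rn n → Ξ → Rn n) (z : Rn n)
    (i : Fin (m + 1)) (x : Rn n) (s : Ξ) : Rn n := G z i x s - ∫ s', G z i x s' ∂ν

/-- Noise of the estimates of the constraint values. -/
def noiseF (ν : Measure Ξ) (F : Rn n → Fin m → Rn n → Ξ → ℝ) (z : Rn n)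
    (i : Fin m) (x : Rn n) (s : Ξ) : ℝ := F z i x s - ∫ s', F z i x s' ∂ν

lemma IsOracle.measurable_noiseG (O : S.IsOracle ν G F) (i : Fin (m + 1)) :
    Measurable fun q : Rn n × Rn n × Ξ => noiseG ν G q.1 i q.2.1 q.2.2 := by
  have h1 := O.meas_G i
  have h2 : Measurable fun q : (Rn n × Rn n) × Ξ => G q.1.1 i q.1.2 q.2 :=
    h1.comp (f := fun q : (Rn n × Rn n) × Ξ => (q.1.1, q.1.2, q.2)) (by fun_prop)
  have h3 : Measurable fun w : Rn n × Rn n => ∫ s', G w.1 i w.2 s' ∂ν :=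
    h2.stronglyMeasurable.integral_prod_right.measurable
  exact h1.sub (h3.comp (f := fun q : Rn n × Rn n × Ξ => (q.1, q.2.1)) (by fun_prop))

lemma IsOracle.measurable_noiseF (O : S.IsOracle ν G F) (i : Fin m) :
    Measurable fun q : Rn n × Rn n × Ξ => noiseF ν F q.1 i q.2.1 q.2.2 := by
  have h1 := O.meas_F i
  have h2 : Measurable fun q : (Rn n × Rn n) × Ξ => F q.1.1 i q.1.2 q.2 :=
    h1.comp (f := fun q : (Rn n × Rn n) × Ξ => (q.1.1, q.1.2, q.2)) (by fun_prop)
  have h3 : Measurable fun w : Rn n × Rn n => ∫ s', F w.1 i w.2 s' ∂ν :=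
    h2.stronglyMeasurable.integral_prod_right.measurable
  exact h1.sub (h3.comp (f := fun q : Rn n × Rn n × Ξ => (q.1, q.2.1)) (by fun_prop))

lemma IsOracle.integrable_noiseG (O : S.IsOracle ν G F) {z x : Rn n} (hz : z ∈ S.p.X)
    (hx : x ∈ S.p.X) (i : Fin (m + 1)) : Integrable (noiseG ν G z i x) ν :=
  (O.integrable_G z hz i x hx).sub (integrable_const _)

lemma IsOracle.integrable_noiseF (O : S.IsOracle ν G F) {z x : Rn n} (hz : z ∈ S.p.X)
    (hx : x ∈ S.p.X) (i : Fin m) : Integrable (noiseF ν F z i x) ν :=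
  (O.integrable_F z hz i x hx).sub (integrable_const _)

lemma IsOracle.integral_noiseG (O : S.IsOracle ν G F) {z x : Rn n} (hz : z ∈ S.p.X)
    (hx : x ∈ S.p.X) (i : Fin (m + 1)) : ∫ s, noiseG ν G z i x s ∂ν = 0 := by
  unfold noiseG
  rw [integral_sub (O.integrable_G z hz i x hx) (integrable_const _)]
  simp

lemma IsOracle.integral_noiseF (O : S.IsOracle ν G F) {z x : Rn n} (hz : z ∈ S.p.X)
    (hx : x ∈ S.p.X) (i : Fin m) : ∫ s, noiseF ν F z i x s ∂ν = 0 := by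
  unfold noiseF
  rw [integral_sub (O.integrable_F z hz i x hx) (integrable_const _)]
  simp

lemma IsOracle.integral_inner_noiseG (O : S.IsOracle ν G F) {z x : Rn n} (hz : z ∈ S.p.X)
    (hx : x ∈ S.p.X) (i : Fin (m + 1)) (w : Rn n) :
    ∫ s, ⟪noiseG ν G z i x s, w⟫ ∂ν = 0 := by
  simp_rw [real_inner_comm w]
  rw [integral_inner (O.integrable_noiseG hz hx i), O.integral_noiseG hz hx, inner_zero_right]

lemma sq_σt (S : ConExSetup n m) : S.σt ^ 2 = ∑ i : Fin m, S.σ i.succ ^ 2 :=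
  Real.sq_sqrt (Finset.sum_nonneg fun _ _ => sq_nonneg _)

lemma sq_σXf (S : ConExSetup n m) : S.σXf ^ 2 = S.σf ^ 2 + S.p.DX ^ 2 * S.σt ^ 2 :=
  Real.sq_sqrt (by positivity)

lemma IsOracle.lintegral_sum_noiseG_le (O : S.IsOracle ν G F) (H : S.p.Standing) {z x : Rn n}
    (hz : z ∈ S.p.X) (hx : x ∈ S.p.X) :
    ∫⁻ s, ENNReal.ofReal (∑ i : Fin m, dualNorm S.p.nrm (noiseG ν G z i.succ x s) ^ 2) ∂ν
      ≤ ENNReal.ofReal (S.σt ^ 2) := by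
  have hm : ∀ i : Fin m, Measurable fun s =>
      ENNReal.ofReal (dualNorm S.p.nrm (noiseG ν G z i.succ x s) ^ 2) := fun i =>
    ENNReal.measurable_ofReal.comp (((continuous_dualNorm H.norm_definite).measurable.comp
      ((O.measurable_noiseG i.succ).comp (f := fun s : Ξ => (z, x, s)) (by fun_prop))).pow_const 2)
  simp_rw [ENNReal.ofReal_sum_of_nonneg fun (i : Fin m) (_ : i ∈ Finset.univ) =>
    sq_nonneg (dualNorm S.p.nrm (noiseG ν G z i.succ x _))]
  rw [lintegral_finsetSum _ fun i _ => hm i, sq_σt,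
    ENNReal.ofReal_sum_of_nonneg fun i _ => sq_nonneg _]
  exact Finset.sum_le_sum fun i _ => O.var_G z hz i.succ x hx

omit [IsProbabilityMeasure ν] in
lemma IsOracle.lintegral_noiseF_le (O : S.IsOracle ν G F) {z x : Rn n}
    (hz : z ∈ S.p.X) (hx : x ∈ S.p.X) :
    ∫⁻ s, ENNReal.ofReal (∑ i : Fin m, noiseF ν F z i x s ^ 2) ∂ν ≤ ENNReal.ofReal (S.σf ^ 2) := by
  have h := O.var_F z hz x hx
  unfold noiseF
  simp_rw [O.mean_F z hz _ x hx]
  exact h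

omit [IsProbabilityMeasure ν] in
lemma lintegral_ofReal_lin_comb_le {f₁ f₂ : Ξ → ℝ} {c₁ c₂ b₁ b₂ : ℝ}
    (hf₁ : Measurable f₁) (hf₂ : Measurable f₂) (hc₁ : 0 ≤ c₁) (hc₂ : 0 ≤ c₂) (hb₁ : 0 ≤ b₁)
    (hb₂ : 0 ≤ b₂)
    (h₁ : ∫⁻ s, ENNReal.ofReal (f₁ s) ∂ν ≤ ENNReal.ofReal b₁)
    (h₂ : ∫⁻ s, ENNReal.ofReal (f₂ s) ∂ν ≤ ENNReal.ofReal b₂) :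
    ∫⁻ s, ENNReal.ofReal (c₁ * f₁ s + c₂ * f₂ s) ∂ν ≤ ENNReal.ofReal (c₁ * b₁ + c₂ * b₂) := by
  have m₁ : Measurable fun s => ENNReal.ofReal (f₁ s) := ENNReal.measurable_ofReal.comp hf₁
  have m₂ : Measurable fun s => ENNReal.ofReal (f₂ s) := ENNReal.measurable_ofReal.comp hf₂
  calc ∫⁻ s, ENNReal.ofReal (c₁ * f₁ s + c₂ * f₂ s) ∂ν
      ≤ ∫⁻ s, (ENNReal.ofReal c₁ * ENNReal.ofReal (f₁ s)
          + ENNReal.ofReal c₂ * ENNReal.ofReal (f₂ s)) ∂ν := by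
        refine lintegral_mono fun s => ?_
        refine ENNReal.ofReal_add_le.trans (le_of_eq ?_)
        rw [ENNReal.ofReal_mul hc₁, ENNReal.ofReal_mul hc₂]
    _ = ENNReal.ofReal c₁ * ∫⁻ s, ENNReal.ofReal (f₁ s) ∂ν
          + ENNReal.ofReal c₂ * ∫⁻ s, ENNReal.ofReal (f₂ s) ∂ν := by
        rw [lintegral_add_left (m₁.const_mul _), lintegral_const_mul _ m₁, lintegral_const_mul _ m₂]
    _ ≤ ENNReal.ofReal c₁ * ENNReal.ofReal b₁ + ENNReal.ofReal c₂ * ENNReal.ofReal b₂ := by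
        gcongr
    _ = _ := by
        rw [← ENNReal.ofReal_mul hc₁, ← ENNReal.ofReal_mul hc₂,
          ← ENNReal.ofReal_add (by positivity) (by positivity)]

end Oracle

section StochasticTrace

variable {Ω Ξ : Type*} [MeasurableSpace Ω] [MeasurableSpace Ξ]

/-- A random run of `T` iterations of ConEx on the subproblem with random centre `z` and solution
`xs`, together with the independence of each sample of the quantities computed before it is used.
The sample `sbar 0` is special: it already enters the first dual step, and so is not independent of
the first primal step. -/
structure StochasticTrace (S : ConExSetup n m) (P : Measure Ω) (ν : Measure Ξ)
    (G : Rn n → Fin (m + 1) → Rn n → Ξ → Rn n) (F : Rn n → Fin m → Rn n → Ξ → ℝ) (B : ℝ) (T : ℕ)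
    (z xs u₀ : Ω → Rn n) (s sbar : ℕ → Ω → Ξ) (u : ℕ → Ω → Rn n) (y : ℕ → Ω → Fin m → ℝ) :
    Prop where
  oracle : S.IsOracle ν G F
  trace : ∀ a, S.IsConExTrace G F B T (z a) (u₀ a) (fun t => s t a) (fun t => sbar t a)
    (fun t => u t a) (fun t => y t a)
  z_mem : ∀ a, z a ∈ S.p.X
  xs_mem : ∀ a, xs a ∈ S.p.X
  u₀_mem : ∀ a, u₀ a ∈ S.p.X
  meas_z : Measurable z
  meas_xs : Measurable xs
  meas_u : ∀ t ≤ T, Measurable (u t)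
  meas_y : ∀ t ≤ T, Measurable (y t)
  meas_s : ∀ t, Measurable (s t)
  meas_sbar : ∀ t, Measurable (sbar t)
  law_s : ∀ t, P.map (s t) = ν
  law_sbar : ∀ t, P.map (sbar t) = ν
  indep_s : ∀ t < T, IndepFun (fun a => (z a, u t a, y (t + 1) a, xs a)) (s t) P
  indep_sbar : ∀ t < T, IndepFun (fun a => (z a, u t a)) (sbar t) P
  indep_sbar' : ∀ t < T, 1 ≤ t → IndepFun (fun a => (z a, u t a, u (t + 1) a, y (t + 1) a,
    ∑ r ∈ Finset.range t, ((r : ℝ) + S.t₀ B + 2) •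
      (WithLp.toLp 2 (S.linErr G F (fun i x => ∫ q, G (z a) i x q ∂ν) (z a) (fun t => sbar t a)
        (fun t => u t a) (r + 1)) : EuclideanSpace ℝ (Fin m)))) (sbar t) P

/-- The noise of the linearized constraint values as a random vector. -/
def errVec (S : ConExSetup n m) (ν : Measure Ξ)
    (G : Rn n → Fin (m + 1) → Rn n → Ξ → Rn n) (F : Rn n → Fin m → Rn n → Ξ → ℝ)
    (z : Ω → Rn n) (sbar : ℕ → Ω → Ξ) (u : ℕ → Ω → Rn n) (t : ℕ) (a : Ω) :
    EuclideanSpace ℝ (Fin m) :=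
  WithLp.toLp 2 (S.linErr G F (fun i x => ∫ q, G (z a) i x q ∂ν) (z a) (fun t => sbar t a)
        (fun t => u t a) t)

/-- The noise of the Lagrangian gradient as a random vector. -/
def gradVec (ν : Measure Ξ)
    (G : Rn n → Fin (m + 1) → Rn n → Ξ → Rn n) (z : Ω → Rn n) (s : ℕ → Ω → Ξ)
    (u : ℕ → Ω → Rn n) (y : ℕ → Ω → Fin m → ℝ) (t : ℕ) (a : Ω) : Rn n :=
  gradErr G (fun i x => ∫ q, G (z a) i x q ∂ν) (z a) (u t a) (y (t + 1) a) (s t a)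

namespace StochasticTrace

variable {P : Measure Ω} [IsProbabilityMeasure P] {ν : Measure Ξ} [IsProbabilityMeasure ν]
  {G : Rn n → Fin (m + 1) → Rn n → Ξ → Rn n} {F : Rn n → Fin m → Rn n → Ξ → ℝ} {B : ℝ} {T : ℕ}
  {z xs u₀ : Ω → Rn n} {s sbar : ℕ → Ω → Ξ} {u : ℕ → Ω → Rn n} {y : ℕ → Ω → Fin m → ℝ}

omit [IsProbabilityMeasure P] [IsProbabilityMeasure ν] in
lemma u_mem (R : StochasticTrace S P ν G F B T z xs u₀ s sbar u y) {t : ℕ} (ht : t ≤ T) (a : Ω) :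
    u t a ∈ S.p.X := (R.trace a).mem (R.u₀_mem a) t ht

omit [IsProbabilityMeasure P] [IsProbabilityMeasure ν] in
lemma errVec_zero_apply (R : StochasticTrace S P ν G F B T z xs u₀ s sbar u y) (a : Ω)
    (i : Fin m) : S.errVec ν G F z sbar u 0 a i = noiseF ν F (z a) i (u 0 a) (sbar 0 a) := by
  unfold errVec linErr noiseF
  rw [R.oracle.mean_F _ (R.z_mem a) _ _ (R.u_mem (Nat.zero_le T) a)]

omit [IsProbabilityMeasure P] [IsProbabilityMeasure ν] in
lemma errVec_succ_apply (R : StochasticTrace S P ν G F B T z xs u₀ s sbar u y) {t : ℕ}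
    (ht : t < T) (a : Ω) (i : Fin m) : S.errVec ν G F z sbar u (t + 1) a i
      = noiseF ν F (z a) i (u t a) (sbar t a)
        + ⟪noiseG ν G (z a) i.succ (u t a) (sbar t a), u (t + 1) a - u t a⟫ := by
  unfold errVec linErr noiseF noiseG
  rw [R.oracle.mean_F _ (R.z_mem a) _ _ (R.u_mem ht.le a)]

lemma measurable_toLp {α : Type*} {_ : MeasurableSpace α} {f : α → EuclideanSpace ℝ (Fin m)}
    (h : ∀ i, Measurable fun a => f a i) : Measurable f := by
  have : Measurable fun a => (f a).ofLp := measurable_pi_iff.mpr h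
  exact (WithLp.measurable_toLp 2 _).comp this

omit [IsProbabilityMeasure P] in
lemma measurable_noiseG_comp (R : StochasticTrace S P ν G F B T z xs u₀ s sbar u y)
    {r : ℕ → Ω → Ξ} (hr : ∀ t, Measurable (r t)) {t : ℕ} (ht : t < T) (i : Fin (m + 1)) :
    Measurable fun a => noiseG ν G (z a) i (u t a) (r t a) :=
  (R.oracle.measurable_noiseG i).comp (R.meas_z.prodMk ((R.meas_u t ht.le).prodMk (hr t)))

omit [IsProbabilityMeasure P] in
lemma measurable_errVec (R : StochasticTrace S P ν G F B T z xs u₀ s sbar u y) (hT : 1 ≤ T)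
    {t : ℕ} (ht : t ≤ T) : Measurable (S.errVec ν G F z sbar u t) := by
  have hF : ∀ t < T, ∀ i, Measurable fun a => noiseF ν F (z a) i (u t a) (sbar t a) :=
    fun t ht i => (R.oracle.measurable_noiseF i).comp
      (R.meas_z.prodMk ((R.meas_u t ht.le).prodMk (R.meas_sbar t)))
  refine measurable_toLp fun i => ?_
  rcases t with _ | t
  · simp_rw [R.errVec_zero_apply]
    exact hF 0 (by omega) i
  · simp_rw [R.errVec_succ_apply ht]
    exact (hF t ht i).add ((R.measurable_noiseG_comp R.meas_sbar ht i.succ).inner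
      ((R.meas_u (t + 1) ht).sub (R.meas_u t (by omega))))

omit [IsProbabilityMeasure P] in
lemma measurable_gradVec (R : StochasticTrace S P ν G F B T z xs u₀ s sbar u y) {t : ℕ}
    (ht : t < T) : Measurable (gradVec ν G z s u y t) := by
  have h1 := fun i => R.measurable_noiseG_comp R.meas_s ht i
  have h2 : ∀ i, Measurable fun a => y (t + 1) a i := fun i =>
    (measurable_pi_apply i).comp (R.meas_y (t + 1) ht)
  exact (h1 0).add (Finset.measurable_sum _ fun i _ => (h2 i).smul (h1 i.succ))

/-- Second moment of the noise in the constraint values. -/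
lemma errVec_sq (R : StochasticTrace S P ν G F B T z xs u₀ s sbar u y) (H : S.p.Standing)
    (hT : 1 ≤ T) {t : ℕ} (ht : t ≤ T) :
    Integrable (fun a => ‖S.errVec ν G F z sbar u t a‖ ^ 2) P ∧
      ∫ a, ‖S.errVec ν G F z sbar u t a‖ ^ 2 ∂P ≤ 2 * S.σXf ^ 2 := by
  have hdn := (continuous_dualNorm H.norm_definite).measurable
  -- domination by a function of the current state and the sample only
  let Φ : Rn n × Rn n → Ξ → ℝ := fun v q => 2 * ∑ i : Fin m, noiseF ν F v.1 i v.2 q ^ 2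
    + 2 * S.p.DX ^ 2 * ∑ i : Fin m, dualNorm S.p.nrm (noiseG ν G v.1 i.succ v.2 q) ^ 2
  have hmF : ∀ i, Measurable fun q : (Rn n × Rn n) × Ξ => noiseF ν F q.1.1 i q.1.2 q.2 := fun i =>
    (R.oracle.measurable_noiseF i).comp (f := fun q : (Rn n × Rn n) × Ξ => (q.1.1, q.1.2, q.2))
      (by fun_prop)
  have hmG : ∀ i, Measurable fun q : (Rn n × Rn n) × Ξ => noiseG ν G q.1.1 i q.1.2 q.2 := fun i =>
    (R.oracle.measurable_noiseG i).comp (f := fun q : (Rn n × Rn n) × Ξ => (q.1.1, q.1.2, q.2))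
      (by fun_prop)
  have hm1 : Measurable fun q : (Rn n × Rn n) × Ξ =>
      ∑ i : Fin m, noiseF ν F q.1.1 i q.1.2 q.2 ^ 2 :=
    Finset.measurable_sum _ fun i _ => (hmF i).pow_const 2
  have hm2 : Measurable fun q : (Rn n × Rn n) × Ξ =>
      ∑ i : Fin m, dualNorm S.p.nrm (noiseG ν G q.1.1 i.succ q.1.2 q.2) ^ 2 :=
    Finset.measurable_sum _ fun i _ => (hdn.comp (hmG i.succ)).pow_const 2
  have hΦ : Measurable fun q : (Rn n × Rn n) × Ξ => Φ q.1 q.2 :=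
    (hm1.const_mul 2).add (hm2.const_mul _)
  have hfib : ∀ a, ∀ x ∈ S.p.X, ∫⁻ q, ENNReal.ofReal (Φ (z a, x) q) ∂ν
      ≤ ENNReal.ofReal (2 * S.σXf ^ 2) := by
    intro a x hx
    rw [S.sq_σXf]
    have := lintegral_ofReal_lin_comb_le (ν := ν) (c₁ := 2) (c₂ := 2 * S.p.DX ^ 2)
      (hm1.comp (f := fun q : Ξ => ((z a, x), q)) (by fun_prop))
      (hm2.comp (f := fun q : Ξ => ((z a, x), q)) (by fun_prop)) (by norm_num) (by positivity)
      (sq_nonneg _) (sq_nonneg _) (R.oracle.lintegral_noiseF_le (R.z_mem a) hx)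
      (R.oracle.lintegral_sum_noiseG_le H (R.z_mem a) hx)
    refine this.trans (le_of_eq ?_)
    congr 1
    ring
  have hmE : Measurable fun a => ‖S.errVec ν G F z sbar u t a‖ ^ 2 :=
    (R.measurable_errVec hT ht).norm.pow_const 2
  have hconst : ∫ _ : Ω, 2 * S.σXf ^ 2 ∂P = 2 * S.σXf ^ 2 := by simp
  rw [← hconst]
  have hind : ∀ t < T, IndepFun (fun a => (z a, u t a)) (sbar t) P := R.indep_sbar
  have hV : ∀ t < T, Measurable fun a => (z a, u t a) := fun t ht =>
    R.meas_z.prodMk (R.meas_u t ht.le)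
  rcases t with _ | t
  · refine integral_le_of_fiberwise (hV 0 hT) (R.meas_sbar 0) (R.law_sbar 0) (hind 0 hT) hΦ hmE
      (fun a => sq_nonneg _) (fun a => ?_) (integrable_const _) (fun a => by positivity)
      (fun a => hfib a _ (R.u_mem (by omega) a))
    rw [EuclideanSpace.norm_sq_eq]
    simp_rw [R.errVec_zero_apply, Real.norm_eq_abs, sq_abs]
    have h1 : 0 ≤ ∑ i : Fin m, noiseF ν F (z a) i (u 0 a) (sbar 0 a) ^ 2 :=
      Finset.sum_nonneg fun i _ => sq_nonneg _
    have h2 : 0 ≤ ∑ i : Fin m, dualNorm S.p.nrm (noiseG ν G (z a) i.succ (u 0 a) (sbar 0 a)) ^ 2 :=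
      Finset.sum_nonneg fun i _ => sq_nonneg _
    have h3 : 0 ≤ 2 * S.p.DX ^ 2
      * ∑ i : Fin m, dualNorm S.p.nrm (noiseG ν G (z a) i.succ (u 0 a) (sbar 0 a)) ^ 2 := by
      positivity
    simp only [Φ]
    linarith
  · have htT : t < T := ht
    refine integral_le_of_fiberwise (hV t htT) (R.meas_sbar t) (R.law_sbar t) (hind t htT) hΦ hmE
      (fun a => sq_nonneg _) (fun a => ?_) (integrable_const _) (fun a => by positivity)
      (fun a => hfib a _ (R.u_mem htT.le a))
    rw [EuclideanSpace.norm_sq_eq]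
    simp_rw [R.errVec_succ_apply htT, Real.norm_eq_abs, sq_abs]
    simp only [Φ]
    rw [Finset.mul_sum, Finset.mul_sum, ← Finset.sum_add_distrib]
    refine Finset.sum_le_sum fun i _ => ?_
    have h1 := abs_inner_le_dualNorm_mul H.norm_definite
      (noiseG ν G (z a) i.succ (u t a) (sbar t a)) (u (t + 1) a - u t a)
    have h2 := H.nrm_le_DX (R.u_mem ht a) (R.u_mem htT.le a)
    have h3 := dualNorm_nonneg H.norm_definite (noiseG ν G (z a) i.succ (u t a) (sbar t a))
    have h4 : ⟪noiseG ν G (z a) i.succ (u t a) (sbar t a), u (t + 1) a - u t a⟫ ^ 2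
        ≤ (dualNorm S.p.nrm (noiseG ν G (z a) i.succ (u t a) (sbar t a)) * S.p.DX) ^ 2 := by
      rw [← sq_abs]
      refine pow_le_pow_left₀ (abs_nonneg _) (h1.trans ?_) 2
      exact mul_le_mul_of_nonneg_left h2 h3
    have h5 := sq_nonneg (noiseF ν F (z a) i (u t a) (sbar t a)
      - ⟪noiseG ν G (z a) i.succ (u t a) (sbar t a), u (t + 1) a - u t a⟫)
    nlinarith

lemma memLp_errVec (R : StochasticTrace S P ν G F B T z xs u₀ s sbar u y) (H : S.p.Standing)
    (hT : 1 ≤ T) {t : ℕ} (ht : t ≤ T) : MemLp (S.errVec ν G F z sbar u t) 2 P :=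
  (memLp_two_iff_integrable_sq_norm (R.measurable_errVec hT ht).aestronglyMeasurable).mpr
    (R.errVec_sq H hT ht).1

/-- After the first step, the noise in the constraint values is orthogonal to everything that is
computed before its sample is drawn. -/
lemma integral_inner_errVec (R : StochasticTrace S P ν G F B T z xs u₀ s sbar u y)
    (H : S.p.Standing) (hT : 1 ≤ T) {t : ℕ} (ht : t < T) {w : Ω → EuclideanSpace ℝ (Fin m)}
    (hw : MemLp w 2 P) (hwm : Measurable w)
    (hind : IndepFun (fun a => (z a, u t a, u (t + 1) a, w a)) (sbar t) P) :
    ∫ a, ⟪w a, S.errVec ν G F z sbar u (t + 1) a⟫ ∂P = 0 := by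
  let Φ : Rn n × Rn n × Rn n × EuclideanSpace ℝ (Fin m) → Ξ → ℝ := fun v q =>
    ∑ i : Fin m, v.2.2.2 i * (noiseF ν F v.1 i v.2.1 q
      + ⟪noiseG ν G v.1 i.succ v.2.1 q, v.2.2.1 - v.2.1⟫)
  have hΦ : Measurable fun q : (Rn n × Rn n × Rn n × EuclideanSpace ℝ (Fin m)) × Ξ =>
      Φ q.1 q.2 := by
    refine Finset.measurable_sum _ fun i _ => ?_
    have h1 : Measurable fun q : (Rn n × Rn n × Rn n × EuclideanSpace ℝ (Fin m)) × Ξ =>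
        noiseF ν F q.1.1 i q.1.2.1 q.2 :=
      (R.oracle.measurable_noiseF i).comp
        (f := fun q : (Rn n × Rn n × Rn n × EuclideanSpace ℝ (Fin m)) × Ξ =>
          (q.1.1, q.1.2.1, q.2)) (by fun_prop)
    have h2 : Measurable fun q : (Rn n × Rn n × Rn n × EuclideanSpace ℝ (Fin m)) × Ξ =>
        noiseG ν G q.1.1 i.succ q.1.2.1 q.2 :=
      (R.oracle.measurable_noiseG i.succ).comp
        (f := fun q : (Rn n × Rn n × Rn n × EuclideanSpace ℝ (Fin m)) × Ξ =>
          (q.1.1, q.1.2.1, q.2)) (by fun_prop)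
    have h3 : Measurable fun q : (Rn n × Rn n × Rn n × EuclideanSpace ℝ (Fin m)) × Ξ =>
        q.1.2.2.2 i :=
      (measurable_pi_apply i).comp ((WithLp.measurable_ofLp 2 _).comp (by fun_prop))
    exact h3.mul (h1.add (h2.inner (by fun_prop)))
  have heq : ∀ a, ⟪w a, S.errVec ν G F z sbar u (t + 1) a⟫
      = Φ (z a, u t a, u (t + 1) a, w a) (sbar t a) := by
    intro a
    have hin : ∀ v w : EuclideanSpace ℝ (Fin m), ⟪v, w⟫ = ∑ i, v i * w i := fun v w => by
      simp only [PiLp.inner_apply, RCLike.inner_apply, conj_trivial, mul_comm]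
    rw [hin]
    exact Finset.sum_congr rfl fun i _ => by rw [R.errVec_succ_apply ht]
  have hV : Measurable fun a => (z a, u t a, u (t + 1) a, w a) :=
    R.meas_z.prodMk ((R.meas_u t ht.le).prodMk ((R.meas_u (t + 1) ht).prodMk hwm))
  have hint : Integrable (fun a => ⟪w a, S.errVec ν G F z sbar u (t + 1) a⟫) P :=
    integrable_inner_of_memLp hw (R.memLp_errVec H hT ht)
  simp_rw [heq] at hint ⊢
  refine integral_eq_zero_of_fiberwise hV (R.meas_sbar t) (R.law_sbar t) hind hΦ hint fun a => ?_
  have hz := R.z_mem a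
  have hu := R.u_mem ht.le a
  have hI : ∀ i : Fin m, Integrable (fun q => noiseF ν F (z a) i (u t a) q
      + ⟪noiseG ν G (z a) i.succ (u t a) q, u (t + 1) a - u t a⟫) ν := fun i =>
    (R.oracle.integrable_noiseF hz hu i).add ((R.oracle.integrable_noiseG hz hu i.succ).inner_const _)
  simp only [Φ]
  rw [integral_finsetSum _ fun i _ => (hI i).const_mul _]
  refine Finset.sum_eq_zero fun i _ => ?_
  rw [integral_const_mul, integral_add (R.oracle.integrable_noiseF hz hu i)
    ((R.oracle.integrable_noiseG hz hu i.succ).inner_const _), R.oracle.integral_noiseF hz hu,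
    R.oracle.integral_inner_noiseG hz hu]
  simp

/-- The accumulated noise in the constraint values is a martingale up to its first term. -/
lemma sum_errVec_sq (R : StochasticTrace S P ν G F B T z xs u₀ s sbar u y) (H : S.p.Standing)
    (hT : 1 ≤ T) : ∀ N ≤ T,
    ∫ a, ‖∑ t ∈ Finset.range N, ((t : ℝ) + S.t₀ B + 2) • S.errVec ν G F z sbar u (t + 1) a‖ ^ 2 ∂P
      ≤ ∑ t ∈ Finset.range N, ((t : ℝ) + S.t₀ B + 2) ^ 2 * (2 * S.σXf ^ 2) := by
  have hmem : ∀ N ≤ T, MemLp (fun a => ∑ t ∈ Finset.range N, ((t : ℝ) + S.t₀ B + 2) •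
      S.errVec ν G F z sbar u (t + 1) a) 2 P := by
    intro N hN
    refine memLp_finsetSum _ fun t ht => ?_
    have ht' : t + 1 ≤ T := by have := Finset.mem_range.mp ht; omega
    exact (R.memLp_errVec H hT ht').const_smul ((t : ℝ) + S.t₀ B + 2)
  have hmeas : ∀ N ≤ T, Measurable (fun a => ∑ t ∈ Finset.range N, ((t : ℝ) + S.t₀ B + 2) •
      S.errVec ν G F z sbar u (t + 1) a) := by
    intro N hN
    refine Finset.measurable_sum _ fun t ht => ?_
    have ht' : t + 1 ≤ T := by have := Finset.mem_range.mp ht; omega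
    exact (R.measurable_errVec hT ht').const_smul ((t : ℝ) + S.t₀ B + 2)
  intro N
  induction N with
  | zero => intro _; simp
  | succ N ih =>
    intro hN
    have h0 := ih (by omega)
    have hE := R.errVec_sq H hT hN
    set c : ℝ := (N : ℝ) + S.t₀ B + 2
    set w : Ω → EuclideanSpace ℝ (Fin m) := fun a => ∑ t ∈ Finset.range N,
      ((t : ℝ) + S.t₀ B + 2) • S.errVec ν G F z sbar u (t + 1) a with hw
    have hw2 : MemLp w 2 P := hmem N (by omega)
    have hwm : Measurable w := hmeas N (by omega)
    have hcross : ∫ a, ⟪w a, S.errVec ν G F z sbar u (N + 1) a⟫ ∂P = 0 := by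
      rcases Nat.eq_zero_or_pos N with h | h
      · subst h
        simp [hw]
      · refine R.integral_inner_errVec H hT hN hw2 hwm ?_
        exact (R.indep_sbar' N hN h).comp
          (φ := fun v => (v.1, v.2.1, v.2.2.1, v.2.2.2.2)) (by fun_prop) measurable_id
    have hI1 : Integrable (fun a => ‖w a‖ ^ 2) P := hw2.integrable_norm_pow (by norm_num)
    have hI2 : Integrable (fun a => ⟪w a, S.errVec ν G F z sbar u (N + 1) a⟫) P :=
      integrable_inner_of_memLp hw2 (R.memLp_errVec H hT hN)
    have hexp : ∀ a, ‖∑ t ∈ Finset.range (N + 1), ((t : ℝ) + S.t₀ B + 2) •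
        S.errVec ν G F z sbar u (t + 1) a‖ ^ 2 = ‖w a‖ ^ 2
          + 2 * c * ⟪w a, S.errVec ν G F z sbar u (N + 1) a⟫
          + c ^ 2 * ‖S.errVec ν G F z sbar u (N + 1) a‖ ^ 2 := by
      intro a
      rw [Finset.sum_range_succ, norm_add_sq_real, real_inner_smul_right, norm_smul, mul_pow,
        Real.norm_eq_abs, sq_abs]
      ring
    simp_rw [hexp]
    have hint := integral_add (hI1.add (hI2.const_mul (2 * c))) (hE.1.const_mul (c ^ 2))
    have hint' := integral_add hI1 (hI2.const_mul (2 * c))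
    simp only [Pi.add_apply] at hint hint'
    rw [hint, hint', integral_const_mul, integral_const_mul, hcross, Finset.sum_range_succ]
    have := mul_le_mul_of_nonneg_left hE.2 (sq_nonneg c)
    linarith

end StochasticTrace

end StochasticTrace

end ConExSetup

/-! ### Second moments of the iterates -/

namespace ConExSetup

variable {n m : ℕ} {S : ConExSetup n m}

/-- The linearized constraint values are bounded, uniformly in the centre and the search points. -/
lemma Valid.exists_abs_linTrue_le (V : S.Valid) (H : S.p.Standing) :
    ∃ C : ℝ, 0 ≤ C ∧ ∀ z ∈ S.p.X, ∀ g : Fin (m + 1) → Rn n → Rn n,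
      (∀ i, ∀ x ∈ S.p.X, g i x ∈ subdiff S.p.X (S.fc z i) x) → ∀ (u : ℕ → Rn n) (t : ℕ),
      (∀ r ≤ t, u r ∈ S.p.X) → ∀ i, |S.linTrue g z u t i| ≤ C := by
  have hb : ∀ i : Fin m, ∃ c : ℝ, ∀ x ∈ S.p.X, |S.p.ψ i.succ x| ≤ c := fun i =>
    H.compact_X.exists_bound_of_continuousOn
      ((H.continuousOn_f i.succ).add (H.cont_χ i))
  choose c hc using hb
  have hψ : ∀ z ∈ S.p.X, ∀ x ∈ S.p.X, ∀ i : Fin m, |S.p.ψc z i.succ x|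
      ≤ |c i| + S.p.μ i.succ * S.p.DX ^ 2 := by
    intro z hz x hx i
    have h1 := (hc i x hx).trans (le_abs_self _)
    have h2 := mul_le_mul_of_nonneg_left (H.two_W_le_DX_sq hx hz) (H.μ_nonneg i.succ)
    have h3 : 0 ≤ 2 * S.p.μ i.succ * S.p.W x z := by
      have := H.W_nonneg hx hz
      have := H.μ_nonneg i.succ
      positivity
    unfold Problem.ψc
    refine (abs_add_le _ _).trans ?_
    rw [abs_of_nonneg h3]
    linarith
  have hD := H.DX_nonneg
  have h0 : ∀ i : Fin m, 0 ≤ |c i| + S.p.μ i.succ * S.p.DX ^ 2 + 2 * (S.Mf i * S.p.DX) := by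
    intro i
    have h1 := V.Mf_nonneg i
    have h2 := H.μ_nonneg i.succ
    positivity
  refine ⟨∑ i : Fin m, (|c i| + S.p.μ i.succ * S.p.DX ^ 2 + 2 * (S.Mf i * S.p.DX)),
    Finset.sum_nonneg fun i _ => h0 i, ?_⟩
  intro z hz g hg u t hu i
  refine le_trans ?_ (Finset.single_le_sum (fun i _ => h0 i) (Finset.mem_univ i))
  have hM0 := V.Mf_nonneg i
  rcases t with _ | t
  · have h1 := hψ z hz (u 0) (hu 0 le_rfl) i
    rw [V.ψc_eq z i.succ (hu 0 le_rfl), add_comm] at h1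
    have : 0 ≤ S.Mf i * S.p.DX := by positivity
    simp only [linTrue]
    linarith
  · have hu0 := hu t (Nat.le_succ t)
    have hu1 := hu (t + 1) le_rfl
    have h1 := hψ z hz (u (t + 1)) hu1 i
    rw [V.ψc_eq z i.succ hu1] at h1
    have h2 := V.lip_f z hz i (u t) hu0 (u (t + 1)) hu1
    have h3 := V.lip_f z hz i (u (t + 1)) hu1 (u t) hu0
    have h4 := abs_inner_le_of_mem_subdiff (V.lip_f z hz i) (hg i.succ (u t) hu0) hu1
    have h5 := mul_le_mul_of_nonneg_left (H.nrm_le_DX hu0 hu1) hM0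
    have h6 := mul_le_mul_of_nonneg_left (H.nrm_le_DX hu1 hu0) hM0
    have h7 := abs_le.mp h1
    have h8 := abs_le.mp h4
    simp only [linTrue]
    rw [abs_le]
    constructor <;> linarith

namespace StochasticTrace

variable {Ω Ξ : Type*} [MeasurableSpace Ω] [MeasurableSpace Ξ]
  {P : Measure Ω} [IsProbabilityMeasure P] {ν : Measure Ξ} [IsProbabilityMeasure ν]
  {G : Rn n → Fin (m + 1) → Rn n → Ξ → Rn n} {F : Rn n → Fin m → Rn n → Ξ → ℝ} {B : ℝ} {T : ℕ}
  {z xs u₀ : Ω → Rn n} {s sbar : ℕ → Ω → Ξ} {u : ℕ → Ω → Rn n} {y : ℕ → Ω → Fin m → ℝ}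

omit [IsProbabilityMeasure P] [IsProbabilityMeasure ν] in
lemma measurable_dual (R : StochasticTrace S P ν G F B T z xs u₀ s sbar u y) {t : ℕ}
    (ht : t ≤ T) : Measurable fun a => (WithLp.toLp 2 (y t a) : EuclideanSpace ℝ (Fin m)) :=
  (WithLp.measurable_toLp 2 _).comp (R.meas_y t ht)

/-- The dual iterates are square integrable. -/
lemma memLp_dual (R : StochasticTrace S P ν G F B T z xs u₀ s sbar u y) (V : S.Valid)
    (H : S.p.Standing) (hT : 1 ≤ T) {t : ℕ} (ht : t ≤ T) :
    MemLp (fun a => (WithLp.toLp 2 (y t a) : EuclideanSpace ℝ (Fin m))) 2 P := by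
  obtain ⟨C, hC0, hC⟩ := V.exists_abs_linTrue_le H
  have hg : ∀ a, ∀ i, ∀ x ∈ S.p.X, ∫ q, G (z a) i x q ∂ν ∈ subdiff S.p.X (S.fc (z a) i) x :=
    fun a i x hx => R.oracle.mean_G (z a) (R.z_mem a) i x hx
  have hlin : ∀ t ≤ T, ∀ a i, |S.linVal G F (z a) (fun t => sbar t a) (fun t => u t a) i t|
      ≤ C + ‖S.errVec ν G F z sbar u t a‖ := by
    intro t ht a i
    rw [linVal_eq S G F (fun i x => ∫ q, G (z a) i x q ∂ν)]
    refine (abs_add_le _ _).trans (add_le_add ?_ ?_)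
    · exact hC (z a) (R.z_mem a) _ (hg a) _ t (fun r hr => R.u_mem (hr.trans ht) a) i
    · exact PiLp.norm_apply_le (S.errVec ν G F z sbar u t a) i
  suffices hcomp : ∀ t ≤ T, ∀ i, MemLp (fun a => y t a i) 2 P by
    rw [memLp_two_iff_integrable_sq_norm (R.measurable_dual ht).aestronglyMeasurable]
    simp_rw [EuclideanSpace.norm_sq_eq]
    refine integrable_finsetSum _ fun i _ => ?_
    have h2 := (hcomp t ht i).integrable_norm_pow (by norm_num)
    exact h2
  intro t
  induction t with
  | zero =>
    intro _ i
    have : (fun a => y 0 a i) = fun _ => (0 : ℝ) := by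
      funext a
      rw [(R.trace a).init_dual]
      rfl
    rw [this]
    exact memLp_const 0
  | succ t ih =>
    intro ht i
    have htT : t < T := ht
    set c := 1 / S.τ B T t
    set θ := S.θ B t
    have hm : ∀ r ≤ T, MemLp (fun a => C + ‖S.errVec ν G F z sbar u r a‖) 2 P := fun r hr =>
      (memLp_const C).add (R.memLp_errVec H hT hr).norm
    have hdom := (ih htT.le i).norm.add ((((hm t htT.le).const_mul |1 + θ|).add
      ((hm (t - 1) (by omega)).const_mul |θ|)).const_mul |c|)
    refine hdom.mono' ((measurable_pi_apply i).comp (R.meas_y (t + 1) ht)).aestronglyMeasurable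
      (Filter.Eventually.of_forall fun a => ?_)
    rw [(R.trace a).dual_step t htT, Real.norm_of_nonneg (le_max_right _ _)]
    simp only [Pi.add_apply]
    have h1 := hlin t htT.le a i
    have h2 := hlin (t - 1) (by omega) a i
    set h := S.linVal G F (z a) (fun t => sbar t a) (fun t => u t a) i t
    set h' := S.linVal G F (z a) (fun t => sbar t a) (fun t => u t a) i (t - 1)
    have h3 : |(1 + θ) * h - θ * h'| ≤ |1 + θ| * (C + ‖S.errVec ν G F z sbar u t a‖)
        + |θ| * (C + ‖S.errVec ν G F z sbar u (t - 1) a‖) := by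
      refine (abs_sub _ _).trans ?_
      rw [abs_mul, abs_mul]
      gcongr
    have h4 : c * ((1 + θ) * h - θ * h') ≤ |c| * (|1 + θ| * (C + ‖S.errVec ν G F z sbar u t a‖)
        + |θ| * (C + ‖S.errVec ν G F z sbar u (t - 1) a‖)) := by
      refine (le_abs_self _).trans ?_
      rw [abs_mul]
      gcongr
    refine max_le ?_ (by positivity)
    rw [Real.norm_eq_abs]
    exact add_le_add (le_abs_self _) h4

/-- Second moment of the noise of the Lagrangian gradient. -/
lemma gradVec_sq (R : StochasticTrace S P ν G F B T z xs u₀ s sbar u y) (V : S.Valid)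
    (H : S.p.Standing) (hT : 1 ≤ T) {t : ℕ} (ht : t < T) :
    Integrable (fun a => dualNorm S.p.nrm (gradVec ν G z s u y t a) ^ 2) P ∧
      ∫ a, dualNorm S.p.nrm (gradVec ν G z s u y t a) ^ 2 ∂P
        ≤ 2 * S.σ 0 ^ 2
          + 2 * S.σt ^ 2 * ∫ a, ‖(WithLp.toLp 2 (y (t + 1) a) : EuclideanSpace ℝ (Fin m))‖ ^ 2 ∂P
    := by
  have hn := H.norm_definite
  have hdn := (continuous_dualNorm H.norm_definite).measurable
  have hy : Integrable (fun a => ‖(WithLp.toLp 2 (y (t + 1) a) : EuclideanSpace ℝ (Fin m))‖ ^ 2)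
      P := (R.memLp_dual V H hT ht).integrable_norm_pow (by norm_num)
  let Φ : Rn n × Rn n × (Fin m → ℝ) × Rn n → Ξ → ℝ := fun v q =>
    2 * dualNorm S.p.nrm (noiseG ν G v.1 0 v.2.1 q) ^ 2
    + 2 * (∑ i, v.2.2.1 i ^ 2)
      * ∑ i : Fin m, dualNorm S.p.nrm (noiseG ν G v.1 i.succ v.2.1 q) ^ 2
  have hmG : ∀ i, Measurable fun q : (Rn n × Rn n × (Fin m → ℝ) × Rn n) × Ξ =>
      dualNorm S.p.nrm (noiseG ν G q.1.1 i q.1.2.1 q.2) ^ 2 := fun i =>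
    (hdn.comp ((R.oracle.measurable_noiseG i).comp
      (f := fun q : (Rn n × Rn n × (Fin m → ℝ) × Rn n) × Ξ => (q.1.1, q.1.2.1, q.2))
      (by fun_prop))).pow_const 2
  have hmS : Measurable fun q : (Rn n × Rn n × (Fin m → ℝ) × Rn n) × Ξ =>
      ∑ i : Fin m, dualNorm S.p.nrm (noiseG ν G q.1.1 i.succ q.1.2.1 q.2) ^ 2 :=
    Finset.measurable_sum _ fun i _ => hmG i.succ
  have hΦ : Measurable fun q : (Rn n × Rn n × (Fin m → ℝ) × Rn n) × Ξ => Φ q.1 q.2 :=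
    ((hmG 0).const_mul 2).add (Measurable.mul (by fun_prop) hmS)
  have hb : Integrable (fun a => 2 * S.σ 0 ^ 2
      + 2 * S.σt ^ 2 * ‖(WithLp.toLp 2 (y (t + 1) a) : EuclideanSpace ℝ (Fin m))‖ ^ 2) P :=
    (integrable_const _).add (hy.const_mul _)
  have hbint : ∫ a, (2 * S.σ 0 ^ 2
      + 2 * S.σt ^ 2 * ‖(WithLp.toLp 2 (y (t + 1) a) : EuclideanSpace ℝ (Fin m))‖ ^ 2) ∂P
      = 2 * S.σ 0 ^ 2
          + 2 * S.σt ^ 2 * ∫ a, ‖(WithLp.toLp 2 (y (t + 1) a) : EuclideanSpace ℝ (Fin m))‖ ^ 2 ∂P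
      := by
    rw [integral_add (integrable_const _) (hy.const_mul _), integral_const_mul (2 * S.σt ^ 2)]
    simp
  rw [← hbint]
  refine integral_le_of_fiberwise (R.meas_z.prodMk ((R.meas_u t ht.le).prodMk
    ((R.meas_y (t + 1) ht).prodMk R.meas_xs))) (R.meas_s t) (R.law_s t) (R.indep_s t ht) hΦ
    ((hdn.comp (R.measurable_gradVec ht)).pow_const 2) (fun a => sq_nonneg _) (fun a => ?_) hb
    (fun a => by positivity) (fun a => ?_)
  · simp only [Φ]
    have h0 : gradVec ν G z s u y t a = noiseG ν G (z a) 0 (u t a) (s t a)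
        + ∑ i : Fin m, y (t + 1) a i • noiseG ν G (z a) i.succ (u t a) (s t a) := rfl
    set D0 := noiseG ν G (z a) 0 (u t a) (s t a)
    set D : Fin m → Rn n := fun i => noiseG ν G (z a) i.succ (u t a) (s t a)
    have hy0 := (R.trace a).dual_nonneg (t + 1) ht
    have h1 : dualNorm S.p.nrm (∑ i, y (t + 1) a i • D i)
        ≤ ∑ i, y (t + 1) a i * dualNorm S.p.nrm (D i) := by
      refine (dualNorm_sum_le hn _ _).trans (Finset.sum_le_sum fun i _ => ?_)
      refine (dualNorm_smul_le hn _ _).trans ?_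
      rw [abs_of_nonneg (hy0 i)]
    have h2 : (∑ i, y (t + 1) a i * dualNorm S.p.nrm (D i)) ^ 2
        ≤ (∑ i, y (t + 1) a i ^ 2) * ∑ i, dualNorm S.p.nrm (D i) ^ 2 :=
      Finset.sum_mul_sq_le_sq_mul_sq _ _ _
    have h3 := dualNorm_nonneg hn (∑ i, y (t + 1) a i • D i)
    have h4 : dualNorm S.p.nrm (∑ i, y (t + 1) a i • D i) ^ 2
        ≤ (∑ i, y (t + 1) a i * dualNorm S.p.nrm (D i)) ^ 2 := pow_le_pow_left₀ h3 h1 2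
    have h5 := dualNorm_add_le hn D0 (∑ i, y (t + 1) a i • D i)
    have h6 := dualNorm_nonneg hn D0
    have h7 : dualNorm S.p.nrm (gradVec ν G z s u y t a) ^ 2
        ≤ (dualNorm S.p.nrm D0 + dualNorm S.p.nrm (∑ i, y (t + 1) a i • D i)) ^ 2 := by
      rw [h0]
      exact pow_le_pow_left₀ (dualNorm_nonneg hn _) h5 2
    nlinarith [sq_nonneg (dualNorm S.p.nrm D0 - dualNorm S.p.nrm (∑ i, y (t + 1) a i • D i))]
  · have hz := R.z_mem a
    have hu := R.u_mem ht.le a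
    have hy2 : ‖(WithLp.toLp 2 (y (t + 1) a) : EuclideanSpace ℝ (Fin m))‖ ^ 2
        = ∑ i, y (t + 1) a i ^ 2 := by
      simp [EuclideanSpace.norm_sq_eq]
    have := lintegral_ofReal_lin_comb_le (ν := ν) (c₁ := 2) (c₂ := 2 * ∑ i, y (t + 1) a i ^ 2)
      ((hmG 0).comp (f := fun q : Ξ => ((z a, u t a, y (t + 1) a, xs a), q)) (by fun_prop))
      (hmS.comp (f := fun q : Ξ => ((z a, u t a, y (t + 1) a, xs a), q)) (by fun_prop))
      (by norm_num)
      (by have := Finset.sum_nonneg fun (i : Fin m) (_ : i ∈ Finset.univ) =>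
            sq_nonneg (y (t + 1) a i)
          positivity)
      (sq_nonneg _) (sq_nonneg _) (R.oracle.var_G _ hz 0 _ hu)
      (R.oracle.lintegral_sum_noiseG_le H hz hu)
    refine this.trans (le_of_eq ?_)
    rw [hy2]
    congr 1
    ring

/-- The gradient noise is orthogonal to what is computed before its sample is drawn. -/
lemma integral_inner_gradVec (R : StochasticTrace S P ν G F B T z xs u₀ s sbar u y)
    (V : S.Valid) (H : S.p.Standing) (hT : 1 ≤ T) {t : ℕ} (ht : t < T) :
    Integrable (fun a => ⟪gradVec ν G z s u y t a, xs a - u t a⟫) P ∧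
      ∫ a, ⟪gradVec ν G z s u y t a, xs a - u t a⟫ ∂P = 0 := by
  have hn := H.norm_definite
  have hint : Integrable (fun a => ⟪gradVec ν G z s u y t a, xs a - u t a⟫) P := by
    have h2 := (R.gradVec_sq V H hT ht).1
    refine Integrable.mono' (h2.add (integrable_const (S.p.DX ^ 2)))
      ((R.measurable_gradVec ht).inner
        (R.meas_xs.sub (R.meas_u t ht.le))).aestronglyMeasurable
      (Filter.Eventually.of_forall fun a => ?_)
    have h3 := abs_inner_le_dualNorm_mul hn (gradVec ν G z s u y t a) (xs a - u t a)
    have h4 := H.nrm_le_DX (R.xs_mem a) (R.u_mem ht.le a)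
    have h5 := mul_le_mul_of_nonneg_left h4 (dualNorm_nonneg hn (gradVec ν G z s u y t a))
    simp only [Pi.add_apply, Real.norm_eq_abs]
    nlinarith [sq_nonneg (dualNorm S.p.nrm (gradVec ν G z s u y t a) - S.p.DX),
      sq_nonneg (dualNorm S.p.nrm (gradVec ν G z s u y t a)), sq_nonneg S.p.DX]
  refine ⟨hint, ?_⟩
  let Φ : Rn n × Rn n × (Fin m → ℝ) × Rn n → Ξ → ℝ := fun v q =>
    ⟪noiseG ν G v.1 0 v.2.1 q + ∑ i : Fin m, v.2.2.1 i • noiseG ν G v.1 i.succ v.2.1 q,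
      v.2.2.2 - v.2.1⟫
  have hmG : ∀ i, Measurable fun q : (Rn n × Rn n × (Fin m → ℝ) × Rn n) × Ξ =>
      noiseG ν G q.1.1 i q.1.2.1 q.2 := fun i =>
    (R.oracle.measurable_noiseG i).comp
      (f := fun q : (Rn n × Rn n × (Fin m → ℝ) × Rn n) × Ξ => (q.1.1, q.1.2.1, q.2))
      (by fun_prop)
  have hΦ : Measurable fun q : (Rn n × Rn n × (Fin m → ℝ) × Rn n) × Ξ => Φ q.1 q.2 := by
    have h1 : ∀ i, Measurable fun q : (Rn n × Rn n × (Fin m → ℝ) × Rn n) × Ξ => q.1.2.2.1 i :=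
      fun i => by fun_prop
    have h2 : Measurable fun q : (Rn n × Rn n × (Fin m → ℝ) × Rn n) × Ξ =>
      q.1.2.2.2 - q.1.2.1 := by fun_prop
    exact ((hmG 0).add (Finset.measurable_sum _ fun i _ => (h1 i).smul (hmG i.succ))).inner h2
  refine integral_eq_zero_of_fiberwise (Φ := Φ) (R.meas_z.prodMk ((R.meas_u t ht.le).prodMk
    ((R.meas_y (t + 1) ht).prodMk R.meas_xs))) (R.meas_s t) (R.law_s t) (R.indep_s t ht) hΦ
    hint fun a => ?_
  have hz := R.z_mem a
  have hu := R.u_mem ht.le a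
  have hI := fun i => R.oracle.integrable_noiseG hz hu i
  simp only [Φ, inner_add_left, sum_inner, real_inner_smul_left]
  rw [integral_add ((hI 0).inner_const _)
    (integrable_finsetSum _ fun i _ => ((hI i.succ).inner_const _).const_mul _),
    integral_finsetSum _ fun i _ => ((hI i.succ).inner_const _).const_mul _,
    R.oracle.integral_inner_noiseG hz hu]
  simp_rw [integral_const_mul, R.oracle.integral_inner_noiseG hz hu]
  simp

end StochasticTrace

end ConExSetup

/-! ### The expected remainder -/

lemma integral_norm_le_of_integral_sq_le {Ω E : Type*} [MeasurableSpace Ω] {P : Measure Ω}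
    [IsProbabilityMeasure P] [NormedAddCommGroup E] {f : Ω → E} (hf : MemLp f 2 P) {b : ℝ}
    (hb : 0 ≤ b) (h : ∫ a, ‖f a‖ ^ 2 ∂P ≤ b ^ 2) : ∫ a, ‖f a‖ ∂P ≤ b := by
  have h1 := variance_nonneg (fun a => ‖f a‖) P
  rw [variance_eq_sub hf.norm] at h1
  refine abs_le_of_sq_le_sq' ?_ hb |>.2
  have h2 : ∫ a, ((fun a => ‖f a‖) ^ 2) a ∂P = ∫ a, ‖f a‖ ^ 2 ∂P := rfl
  linarith

lemma rpow_three_halves {x : ℝ} (hx : 0 ≤ x) : x ^ (3 / 2 : ℝ) = x * Real.sqrt x := by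
  rw [Real.sqrt_eq_rpow, show (3 / 2 : ℝ) = 1 + 1 / 2 by norm_num]
  rcases hx.eq_or_lt with h | h
  · rw [← h, Real.zero_rpow (by norm_num)]
    simp
  · rw [Real.rpow_add h, Real.rpow_one]

namespace ConExSetup

variable {n m : ℕ} {S : ConExSetup n m}

/-- A bound for the expected remainder after at most `T` steps, given a bound `yM` on the second
moments of the dual iterates. -/
def remainderBound (S : ConExSetup n m) (B Y : ℝ) (T : ℕ) (yM : ℝ) : ℝ :=
  S.α₀ * (S.t₀ B + 2) * (S.t₀ B + 1) / 4 * S.p.DX ^ 2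
    + (S.t₀ B + 2) * S.τbase B T / 2 * (Y + 1) ^ 2
    + (S.t₀ B + 2) * (S.σXf * (yM / 2 + 1))
    + T * (16 * S.t₀ B / S.α₀ * (S.Hstar B Y ^ 2 + (2 * S.σ 0 ^ 2 + 2 * S.σt ^ 2 * yM)))
    + (Y + 1) * (2 * (S.t₀ B + 2) * S.σXf * (T * Real.sqrt T))
    + 32 * ((S.t₀ B + 2) * Real.sqrt (S.t₀ B + 2)) * S.σXf * B * (T * Real.sqrt T)

lemma σXf_mul_le_τbase {B : ℝ} (T : ℕ) :
    S.σXf * (T * Real.sqrt T) / (B * Real.sqrt (S.t₀ B + 2)) ≤ S.τbase B T := by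
  have : (T : ℝ) ^ (3 / 2 : ℝ) = T * Real.sqrt T := rpow_three_halves (Nat.cast_nonneg T)
  rw [← this]
  exact le_max_right _ _

namespace StochasticTrace

variable {Ω Ξ : Type*} [MeasurableSpace Ω] [MeasurableSpace Ξ]
  {P : Measure Ω} [IsProbabilityMeasure P] {ν : Measure Ξ} [IsProbabilityMeasure ν]
  {G : Rn n → Fin (m + 1) → Rn n → Ξ → Rn n} {F : Rn n → Fin m → Rn n → Ξ → ℝ} {B : ℝ} {T : ℕ}
  {z xs u₀ : Ω → Rn n} {s sbar : ℕ → Ω → Ξ} {u : ℕ → Ω → Rn n} {y : ℕ → Ω → Fin m → ℝ}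

lemma ae_errVec_eq_zero (R : StochasticTrace S P ν G F B T z xs u₀ s sbar u y)
    (H : S.p.Standing) (hT : 1 ≤ T) (hσ : S.σXf = 0) :
    ∀ᵐ a ∂P, ∀ t ≤ T, S.errVec ν G F z sbar u t a = 0 := by
  rw [ae_all_iff]
  intro t
  by_cases ht : t ≤ T
  · have h := R.errVec_sq H hT ht
    rw [hσ] at h
    have h0 : ∫ a, ‖S.errVec ν G F z sbar u t a‖ ^ 2 ∂P = 0 :=
      le_antisymm (h.2.trans_eq (by ring)) (integral_nonneg fun a => sq_nonneg _)
    rw [integral_eq_zero_iff_of_nonneg (fun a => sq_nonneg _) h.1] at h0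
    filter_upwards [h0] with a ha _
    simpa using ha
  · exact Filter.Eventually.of_forall fun a h => absurd h ht

/-- The scaled increments of the noise in the constraint values. -/
def noiseIncr (S : ConExSetup n m) (ν : Measure Ξ)
    (G : Rn n → Fin (m + 1) → Rn n → Ξ → Rn n) (F : Rn n → Fin m → Rn n → Ξ → ℝ) (B : ℝ) (T : ℕ)
    (z : Ω → Rn n) (sbar : ℕ → Ω → Ξ) (u : ℕ → Ω → Rn n) (t : ℕ) (a : Ω) : ℝ :=
  ‖S.errVec ν G F z sbar u t a - S.errVec ν G F z sbar u (t - 1) a‖ ^ 2 / S.τ B T t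

lemma integral_noiseIncr_le (R : StochasticTrace S P ν G F B T z xs u₀ s sbar u y)
    (H : S.p.Standing) (hT : 1 ≤ T) {t : ℕ} (ht : t ≤ T) :
    Integrable (noiseIncr S ν G F B T z sbar u t) P ∧
      ∫ a, noiseIncr S ν G F B T z sbar u t a ∂P ≤ 8 * S.σXf ^ 2 / S.τ B T t := by
  have h1 := R.errVec_sq H hT ht
  have h2 := R.errVec_sq H hT (t := t - 1) (by omega)
  have hm : MemLp (fun a => S.errVec ν G F z sbar u t a - S.errVec ν G F z sbar u (t - 1) a) 2 P :=
    (R.memLp_errVec H hT ht).sub (R.memLp_errVec H hT (t := t - 1) (by omega))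
  have hi : Integrable (fun a => ‖S.errVec ν G F z sbar u t a
      - S.errVec ν G F z sbar u (t - 1) a‖ ^ 2) P := hm.integrable_norm_pow (by norm_num)
  refine ⟨hi.div_const _, ?_⟩
  unfold noiseIncr
  rw [integral_div]
  refine div_le_div_of_nonneg_right ?_ (τ_nonneg H B T t)
  have h3 : ∫ a, ‖S.errVec ν G F z sbar u t a - S.errVec ν G F z sbar u (t - 1) a‖ ^ 2 ∂P
      ≤ ∫ a, (2 * ‖S.errVec ν G F z sbar u t a‖ ^ 2
        + 2 * ‖S.errVec ν G F z sbar u (t - 1) a‖ ^ 2) ∂P := by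
    refine integral_mono hi ((h1.1.const_mul 2).add (h2.1.const_mul 2)) fun a => ?_
    have h4 := norm_sub_le (S.errVec ν G F z sbar u t a) (S.errVec ν G F z sbar u (t - 1) a)
    have h5 := pow_le_pow_left₀ (norm_nonneg _) h4 2
    have h6 := sq_nonneg (‖S.errVec ν G F z sbar u t a‖ - ‖S.errVec ν G F z sbar u (t - 1) a‖)
    simp only
    nlinarith
  rw [integral_add (h1.1.const_mul 2) (h2.1.const_mul 2), integral_const_mul,
    integral_const_mul] at h3
  linarith [h1.2, h2.2]

/-- The pairing of a dual iterate with the noise of the constraint values has zero mean, except in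
the first step, where both depend on the same sample. -/
lemma integral_dual_errVec_le (R : StochasticTrace S P ν G F B T z xs u₀ s sbar u y)
    (V : S.Valid) (H : S.p.Standing) (hT : 1 ≤ T) {yM : ℝ}
    (hyM : ∫ a, ‖(WithLp.toLp 2 (y 1 a) : EuclideanSpace ℝ (Fin m))‖ ^ 2 ∂P ≤ yM)
    {t : ℕ} (ht : t < T) :
    Integrable (fun a => ⟪(WithLp.toLp 2 (y (t + 1) a) : EuclideanSpace ℝ (Fin m)),
        S.errVec ν G F z sbar u (t + 1) a⟫) P ∧
      ∫ a, ⟪(WithLp.toLp 2 (y (t + 1) a) : EuclideanSpace ℝ (Fin m)),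
        S.errVec ν G F z sbar u (t + 1) a⟫ ∂P ≤ if t = 0 then S.σXf * (yM / 2 + 1) else 0 := by
  have hI := integrable_inner_of_memLp (R.memLp_dual V H hT ht) (R.memLp_errVec H hT ht)
  refine ⟨hI, ?_⟩
  split_ifs with h0
  · subst h0
    rcases S.σXf_nonneg.eq_or_lt with hσ | hσ
    · rw [← hσ, zero_mul]
      refine le_of_eq (integral_eq_zero_of_ae ?_)
      filter_upwards [R.ae_errVec_eq_zero H hT hσ.symm] with a ha
      rw [ha 1 hT, inner_zero_right]
      rfl
    · have hE := R.errVec_sq H hT hT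
      have hy2 : Integrable (fun a => ‖(WithLp.toLp 2 (y 1 a) : EuclideanSpace ℝ (Fin m))‖ ^ 2) P :=
        (R.memLp_dual V H hT hT).integrable_norm_pow (by norm_num)
      have h1 : ∫ a, ⟪(WithLp.toLp 2 (y 1 a) : EuclideanSpace ℝ (Fin m)),
          S.errVec ν G F z sbar u 1 a⟫ ∂P
          ≤ ∫ a, (S.σXf / 2 * ‖(WithLp.toLp 2 (y 1 a) : EuclideanSpace ℝ (Fin m))‖ ^ 2
            + 1 / (2 * S.σXf) * ‖S.errVec ν G F z sbar u 1 a‖ ^ 2) ∂P := by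
        refine integral_mono hI ((hy2.const_mul _).add (hE.1.const_mul _)) fun a => ?_
        refine (real_inner_le_norm _ _).trans ?_
        set p := ‖(WithLp.toLp 2 (y 1 a) : EuclideanSpace ℝ (Fin m))‖
        set q := ‖S.errVec ν G F z sbar u 1 a‖
        have h2 : S.σXf / 2 * p ^ 2 + 1 / (2 * S.σXf) * q ^ 2 - p * q
            = (S.σXf * p - q) ^ 2 / (2 * S.σXf) := by
          field_simp
          ring
        have h3 : 0 ≤ (S.σXf * p - q) ^ 2 / (2 * S.σXf) := by positivity
        linarith
      rw [integral_add (hy2.const_mul _) (hE.1.const_mul _), integral_const_mul,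
        integral_const_mul] at h1
      have h2 := mul_le_mul_of_nonneg_left hyM (by positivity : 0 ≤ S.σXf / 2)
      have h3 := mul_le_mul_of_nonneg_left hE.2 (by positivity : 0 ≤ 1 / (2 * S.σXf))
      have h4 : 1 / (2 * S.σXf) * (2 * S.σXf ^ 2) = S.σXf := by field_simp
      refine h1.trans ?_
      linarith
  · refine le_of_eq (R.integral_inner_errVec H hT ht (R.memLp_dual V H hT ht)
      (R.measurable_dual ht) ?_)
    exact (R.indep_sbar' t ht (by omega)).comp
      (φ := fun v => (v.1, v.2.1, v.2.2.1,
        (WithLp.toLp 2 v.2.2.2.1 : EuclideanSpace ℝ (Fin m))))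
      (by fun_prop) measurable_id

/-- The remainder along a random run. -/
def remainderVec (S : ConExSetup n m) (ν : Measure Ξ)
    (G : Rn n → Fin (m + 1) → Rn n → Ξ → Rn n) (F : Rn n → Fin m → Rn n → Ξ → ℝ) (B Y : ℝ)
    (T : ℕ) (z xs : Ω → Rn n) (s sbar : ℕ → Ω → Ξ) (u : ℕ → Ω → Rn n) (y : ℕ → Ω → Fin m → ℝ)
    (N : ℕ) (a : Ω) : ℝ :=
  S.remainder G F (fun i x => ∫ q, G (z a) i x q ∂ν) B Y T (z a) (xs a) (fun t => s t a)
    (fun t => sbar t a) (fun t => u t a) (fun t => y t a)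
    (fun t => noiseIncr S ν G F B T z sbar u t a) N

/-- The expected remainder. -/
lemma integral_remainderVec_le (R : StochasticTrace S P ν G F B T z xs u₀ s sbar u y)
    (V : S.Valid) (H : S.p.Standing) (hT : 1 ≤ T) {Y : ℝ} (hY : 0 ≤ Y) (hYB : Y + 1 ≤ B) {yM : ℝ}
    (hyM : ∀ t ≤ T, ∫ a, ‖(WithLp.toLp 2 (y t a) : EuclideanSpace ℝ (Fin m))‖ ^ 2 ∂P ≤ yM)
    {N : ℕ} (hN : N ≤ T) :
    Integrable (remainderVec S ν G F B Y T z xs s sbar u y N) P ∧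
      ∫ a, remainderVec S ν G F B Y T z xs s sbar u y N a ∂P ≤ S.remainderBound B Y T yM := by
  have hB : 0 < B := by linarith
  have hα : 0 < S.α₀ := H.μ_zero
  have ht0 := two_le_t₀ V H hB.le
  have hσ := S.σXf_nonneg
  have hyM0 : 0 ≤ yM := (integral_nonneg fun a => sq_nonneg _).trans (hyM 0 (Nat.zero_le _))
  set g := S.t₀ B + 2 with hg
  have hg4 : 4 ≤ g := by linarith
  have hT1 : (1 : ℝ) ≤ T := by exact_mod_cast hT
  set K0 := 16 * S.t₀ B / S.α₀ with hK0
  have hK0' : 0 ≤ K0 := by positivity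
  set γ : ℕ → ℝ := fun t => (t : ℝ) + S.t₀ B + 2 with hγ
  have hγ0 : ∀ t, 0 ≤ γ t := fun t => by simp only [hγ]; positivity
  have hγT : ∀ t < T, γ t ≤ g * T := by
    intro t ht
    have h1 : (t : ℝ) + 1 ≤ T := by exact_mod_cast ht
    simp only [hγ, hg] at *
    nlinarith
  let ip : ℕ → Ω → ℝ := fun t a => ⟪gradVec ν G z s u y t a, xs a - u t a⟫
  let cr : ℕ → Ω → ℝ := fun t a => ⟪(WithLp.toLp 2 (y (t + 1) a) : EuclideanSpace ℝ (Fin m)),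
        S.errVec ν G F z sbar u (t + 1) a⟫
  let d : ℕ → Ω → ℝ := fun t a => dualNorm S.p.nrm (gradVec ν G z s u y t a) ^ 2
  let w : Ω → EuclideanSpace ℝ (Fin m) := fun a => ∑ t ∈ Finset.range N, ((t : ℝ) + S.t₀ B + 2) •
        S.errVec ν G F z sbar u (t + 1) a
  let e : ℕ → Ω → ℝ := fun t => noiseIncr S ν G F B T z sbar u (t + 1)
  have hrem : ∀ a, remainderVec S ν G F B Y T z xs s sbar u y N a
      = (S.α₀ * g * (S.t₀ B + 1) / 4 * S.p.DX ^ 2 + g * S.τbase B T / 2 * (Y + 1) ^ 2)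
        + ∑ t ∈ Finset.range N, (γ t * ip t a + γ t * cr t a + K0 * (S.Hstar B Y ^ 2 + d t a))
        + (Y + 1) * ‖w a‖ + 2 * ∑ t ∈ Finset.range N, γ t * e t a := by
    intro a
    have hin : ∀ v w : EuclideanSpace ℝ (Fin m), ⟪v, w⟫ = ∑ i, v i * w i := fun v w => by
      simp only [PiLp.inner_apply, RCLike.inner_apply, conj_trivial, mul_comm]
    simp only [cr, hin]
    rfl
  have hlt : ∀ t ∈ Finset.range N, t < T := fun t ht => lt_of_lt_of_le (Finset.mem_range.mp ht) hN
  have hip := fun t ht => R.integral_inner_gradVec V H hT (hlt t ht)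
  have hcr := fun t ht => R.integral_dual_errVec_le V H hT (hyM 1 hT) (hlt t ht)
  have hd := fun t ht => R.gradVec_sq V H hT (hlt t ht)
  have he := fun t ht => R.integral_noiseIncr_le H hT (hlt t ht)
  have hw : MemLp w 2 P := by
    refine memLp_finsetSum _ fun t ht => ?_
    exact (R.memLp_errVec H hT (hlt t ht)).const_smul ((t : ℝ) + S.t₀ B + 2)
  have hterm : ∀ t ∈ Finset.range N, Integrable (fun a => γ t * ip t a + γ t * cr t a
      + K0 * (S.Hstar B Y ^ 2 + d t a)) P := fun t ht =>
    (((hip t ht).1.const_mul _).add ((hcr t ht).1.const_mul _)).add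
      (((integrable_const _).add (hd t ht).1).const_mul _)
  have hI1 := integrable_finsetSum _ hterm
  have hI2 : Integrable (fun a => ‖w a‖) P := (hw.integrable (by norm_num)).norm
  have hI3 : Integrable (fun a => ∑ t ∈ Finset.range N, γ t * e t a) P :=
    integrable_finsetSum _ fun t ht => (he t ht).1.const_mul _
  have hrem' : remainderVec S ν G F B Y T z xs s sbar u y N = fun a =>
      (S.α₀ * g * (S.t₀ B + 1) / 4 * S.p.DX ^ 2 + g * S.τbase B T / 2 * (Y + 1) ^ 2)
        + ∑ t ∈ Finset.range N, (γ t * ip t a + γ t * cr t a + K0 * (S.Hstar B Y ^ 2 + d t a))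
        + (Y + 1) * ‖w a‖ + 2 * ∑ t ∈ Finset.range N, γ t * e t a := funext hrem
  have hi12 := (integrable_const (μ := P) (S.α₀ * g * (S.t₀ B + 1) / 4 * S.p.DX ^ 2
    + g * S.τbase B T / 2 * (Y + 1) ^ 2)).add hI1
  have hi123 := hi12.add (hI2.const_mul (Y + 1))
  have hint := hi123.add (hI3.const_mul 2)
  rw [hrem']
  refine ⟨hint, ?_⟩
  have e1 := integral_add hi123 (hI3.const_mul 2)
  have e2 := integral_add hi12 (hI2.const_mul (Y + 1))
  have e3 := integral_add (integrable_const (μ := P) (S.α₀ * g * (S.t₀ B + 1) / 4 * S.p.DX ^ 2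
    + g * S.τbase B T / 2 * (Y + 1) ^ 2)) hI1
  simp only [Pi.add_apply] at e1 e2 e3
  rw [e1, e2, e3, integral_const_mul, integral_const_mul, integral_finsetSum _ hterm,
    integral_finsetSum _ fun t ht => (he t ht).1.const_mul _]
  simp only [integral_const, probReal_univ, one_smul]
  -- the drift terms
  have b1 : ∑ t ∈ Finset.range N, ∫ a, (γ t * ip t a + γ t * cr t a
      + K0 * (S.Hstar B Y ^ 2 + d t a)) ∂P
      ≤ g * (S.σXf * (yM / 2 + 1))
        + T * (K0 * (S.Hstar B Y ^ 2 + (2 * S.σ 0 ^ 2 + 2 * S.σt ^ 2 * yM))) := by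
    have hc : 0 ≤ K0 * (S.Hstar B Y ^ 2 + (2 * S.σ 0 ^ 2 + 2 * S.σt ^ 2 * yM)) := by positivity
    calc _ ≤ ∑ t ∈ Finset.range N, ((if t = 0 then g * (S.σXf * (yM / 2 + 1)) else 0)
          + K0 * (S.Hstar B Y ^ 2 + (2 * S.σ 0 ^ 2 + 2 * S.σt ^ 2 * yM))) := by
          refine Finset.sum_le_sum fun t ht => ?_
          have q1 := integral_add (((hip t ht).1.const_mul (γ t)).add
            ((hcr t ht).1.const_mul (γ t)))
            (((integrable_const (μ := P) (S.Hstar B Y ^ 2)).add (hd t ht).1).const_mul K0)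
          have q2 := integral_add ((hip t ht).1.const_mul (γ t)) ((hcr t ht).1.const_mul (γ t))
          have q3 := integral_add (integrable_const (μ := P) (S.Hstar B Y ^ 2)) (hd t ht).1
          simp only [Pi.add_apply] at q1 q2 q3
          rw [q1, q2, integral_const_mul, integral_const_mul, integral_const_mul, q3]
          simp only [integral_const, probReal_univ, one_smul]
          have q4 := (hip t ht).2
          have q5 := (hcr t ht).2
          have q6 := (hd t ht).2
          have q7 := mul_le_mul_of_nonneg_left (hyM (t + 1) (hlt t ht))
            (by positivity : 0 ≤ 2 * S.σt ^ 2)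
          refine add_le_add ?_ ?_
          · rw [q4, mul_zero, zero_add]
            refine (mul_le_mul_of_nonneg_left q5 (hγ0 t)).trans (le_of_eq ?_)
            split_ifs with h
            · subst h
              simp [hγ, hg]
            · rw [mul_zero]
          · refine mul_le_mul_of_nonneg_left ?_ hK0'
            linarith
      _ ≤ _ := by
          rw [Finset.sum_add_distrib, Finset.sum_ite_eq' (Finset.range N) 0, Finset.sum_const,
            Finset.card_range, nsmul_eq_mul]
          have hNT : (N : ℝ) ≤ T := by exact_mod_cast hN
          refine add_le_add ?_ (mul_le_mul_of_nonneg_right hNT hc)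
          split_ifs
          · exact le_rfl
          · positivity
  -- the martingale term
  have b2 : ∫ a, ‖w a‖ ∂P ≤ 2 * g * S.σXf * (T * Real.sqrt T) := by
    refine integral_norm_le_of_integral_sq_le hw (by positivity) ?_
    refine (R.sum_errVec_sq H hT N hN).trans ?_
    calc ∑ t ∈ Finset.range N, ((t : ℝ) + S.t₀ B + 2) ^ 2 * (2 * S.σXf ^ 2)
        ≤ ∑ t ∈ Finset.range N, (g * T) ^ 2 * (2 * S.σXf ^ 2) := by
          refine Finset.sum_le_sum fun t ht => ?_
          exact mul_le_mul_of_nonneg_right (pow_le_pow_left₀ (hγ0 t) (hγT t (hlt t ht)) 2)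
            (by positivity)
      _ = N * ((g * T) ^ 2 * (2 * S.σXf ^ 2)) := by simp
      _ ≤ T * ((g * T) ^ 2 * (4 * S.σXf ^ 2)) := by
          have hNT : (N : ℝ) ≤ T := by exact_mod_cast hN
          gcongr
          norm_num
      _ = (2 * g * S.σXf * T) ^ 2 * T := by ring
      _ = (2 * g * S.σXf * T) ^ 2 * Real.sqrt T ^ 2 := by rw [Real.sq_sqrt (by positivity)]
      _ = _ := by ring
  -- the increments, divided by the dual step sizes
  have b3 : ∑ t ∈ Finset.range N, ∫ a, γ t * e t a ∂P
      ≤ 16 * (g * Real.sqrt g) * S.σXf * B * (T * Real.sqrt T) := by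
    have hstep : ∀ t ∈ Finset.range N, ∫ a, γ t * e t a ∂P
        ≤ 16 * (g * Real.sqrt g) * S.σXf * B * Real.sqrt T := by
      intro t ht
      rw [integral_const_mul]
      have q1 := (he t ht).2
      have hlow : S.σXf * (T * Real.sqrt T) / (B * Real.sqrt g) ≤ S.τbase B T :=
        S.σXf_mul_le_τbase T
      have hsT : 0 < Real.sqrt T := Real.sqrt_pos.mpr (by linarith)
      have hsg : 0 < Real.sqrt g := Real.sqrt_pos.mpr (by linarith)
      have q2 : 8 * S.σXf ^ 2 / S.τ B T (t + 1) ≤ 16 * S.σXf * B * Real.sqrt g / Real.sqrt T := by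
        rcases hσ.eq_or_lt with h0 | h0
        · rw [← h0]; simp
        · have hpos : 0 < S.σXf * (T * Real.sqrt T) / (B * Real.sqrt g) := by positivity
          rw [τ_eq, div_div_eq_mul_div]
          push_cast
          have ht' : (t : ℝ) + 1 + 1 ≤ 2 * T := by
            have : (t : ℝ) + 1 ≤ T := by exact_mod_cast hlt t ht
            linarith
          calc 8 * S.σXf ^ 2 * ((t : ℝ) + 1 + 1) / S.τbase B T
              ≤ 8 * S.σXf ^ 2 * (2 * T) / (S.σXf * (T * Real.sqrt T) / (B * Real.sqrt g)) := by
                gcongr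
            _ = _ := by field_simp; norm_num
      calc γ t * ∫ a, e t a ∂P
          ≤ (g * T) * (16 * S.σXf * B * Real.sqrt g / Real.sqrt T) :=
            mul_le_mul (hγT t (hlt t ht)) (q1.trans q2)
              (integral_nonneg fun a => div_nonneg (sq_nonneg _) (τ_nonneg H B T _))
              (by positivity)
        _ = 16 * (g * Real.sqrt g) * S.σXf * B * (T / Real.sqrt T) := by ring
        _ = _ := by rw [Real.div_sqrt]
    calc _ ≤ ∑ t ∈ Finset.range N, 16 * (g * Real.sqrt g) * S.σXf * B * Real.sqrt T :=
          Finset.sum_le_sum hstep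
      _ = N * (16 * (g * Real.sqrt g) * S.σXf * B * Real.sqrt T) := by simp
      _ ≤ T * (16 * (g * Real.sqrt g) * S.σXf * B * Real.sqrt T) := by
          have hNT : (N : ℝ) ≤ T := by exact_mod_cast hN
          gcongr
      _ = _ := by ring
  have b2' := mul_le_mul_of_nonneg_left b2 (by linarith : 0 ≤ Y + 1)
  unfold remainderBound
  linarith

end StochasticTrace

end ConExSetup

/-! ### Expected accuracy of one subproblem -/

lemma ContinuousOn.measurable_comp_of_mem {Ω E F : Type*} {_ : MeasurableSpace Ω}
    [TopologicalSpace E] [MeasurableSpace E] [OpensMeasurableSpace E]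
    [TopologicalSpace F] [MeasurableSpace F] [BorelSpace F] {X : Set E} {h : E → F}
    (hh : ContinuousOn h X) {x : Ω → E} (hx : Measurable x) (hm : ∀ a, x a ∈ X) :
    Measurable fun a => h (x a) :=
  (continuousOn_iff_continuous_domRestrict.mp hh).measurable.comp (hx.subtype_mk (h := hm))

lemma LowerSemicontinuousOn.measurable_comp_of_mem {Ω E : Type*} {_ : MeasurableSpace Ω}
    [TopologicalSpace E] [MeasurableSpace E] [OpensMeasurableSpace E] {X : Set E} {h : E → ℝ}
    (hh : LowerSemicontinuousOn h X) {x : Ω → E} (hx : Measurable x) (hm : ∀ a, x a ∈ X) :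
    Measurable fun a => h (x a) := by
  have h1 : LowerSemicontinuous (X.domRestrict h) := lowerSemicontinuous_restrict_iff.mpr hh
  exact h1.measurable.comp (hx.subtype_mk (h := hm))

namespace Problem

variable {n m : ℕ} {p : Problem n m} {Ω : Type*} [MeasurableSpace Ω]

lemma Standing.measurable_ψc (H : p.Standing) {z x : Ω → Rn n} (hz : Measurable z)
    (hx : Measurable x) (hzm : ∀ a, z a ∈ p.X) (hxm : ∀ a, x a ∈ p.X) (i : Fin (m + 1)) :
    Measurable fun a => p.ψc (z a) i (x a) := by
  have h1 := (H.continuousOn_f i).measurable_comp_of_mem hx hxm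
  have h2 := (H.lsc_χ' i).measurable_comp_of_mem hx hxm
  have h3 := H.continuousOn_dgf.measurable_comp_of_mem hx hxm
  have h4 := H.continuousOn_dgf.measurable_comp_of_mem hz hzm
  have h5 := H.continuousOn_gradDgf.measurable_comp_of_mem hz hzm
  unfold ψc ψ W
  exact (h1.add h2).add (((h3.sub h4).sub (h5.inner (hx.sub hz))).const_mul _)

lemma Standing.measurable_subViol (H : p.Standing) {z x : Ω → Rn n} (hz : Measurable z)
    (hx : Measurable x) (hzm : ∀ a, z a ∈ p.X) (hxm : ∀ a, x a ∈ p.X) :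
    Measurable fun a => p.subViol (z a) (x a) := by
  unfold subViol
  exact (Finset.measurable_sum _ fun i _ =>
    ((H.measurable_ψc hz hx hzm hxm (Fin.succ i)).max measurable_const).pow_const 2).sqrt

end Problem

namespace ConExSetup

variable {n m : ℕ} {S : ConExSetup n m}

namespace StochasticTrace

variable {Ω Ξ : Type*} [MeasurableSpace Ω] [MeasurableSpace Ξ]
  {P : Measure Ω} [IsProbabilityMeasure P] {ν : Measure Ξ} [IsProbabilityMeasure ν]
  {G : Rn n → Fin (m + 1) → Rn n → Ξ → Rn n} {F : Rn n → Fin m → Rn n → Ξ → ℝ} {B : ℝ} {T : ℕ}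
  {z xs u₀ : Ω → Rn n} {s sbar : ℕ → Ω → Ξ} {u : ℕ → Ω → Rn n} {y : ℕ → Ω → Fin m → ℝ}

/-- The deterministic bounds hold almost surely. Only if all dual step sizes vanish is there an
exceptional set; then the constraint oracle is exact almost surely. -/
lemma ae_residuals_le (R : StochasticTrace S P ν G F B T z xs u₀ s sbar u y)
    (V : S.Valid) (H : S.p.Standing) (hT : 1 ≤ T) {Y : ℝ} (hY : 0 ≤ Y) (hYB : Y + 1 ≤ B)
    {ys : Ω → Fin m → ℝ} (hk : ∀ a, S.p.IsSubKKT (z a) (xs a) (ys a))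
    (hys : ∀ a, Real.sqrt (∑ i, ys a i ^ 2) ≤ Y) :
    ∀ᵐ a ∂P, (∀ N < T, (N + S.t₀ B + 2) * S.τ B T N / 4 * ∑ i, (ys a i - y (N + 1) a i) ^ 2
      ≤ remainderVec S ν G F B Y T z xs s sbar u y (N + 1) a) ∧
    (∀ x, 1 ≤ T →
      x = (∑ t ∈ Finset.range T, S.γ B t)⁻¹ • ∑ t ∈ Finset.range T, S.γ B t • u (t + 1) a →
      S.Γ B T * S.p.subViol (z a) x ≤ remainderVec S ν G F B Y T z xs s sbar u y T a ∧
      S.Γ B T * (S.p.ψc (z a) 0 x - S.p.subOpt (z a))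
        ≤ remainderVec S ν G F B Y T z xs s sbar u y T a ∧
      -(Y * S.p.subViol (z a) x) ≤ S.p.ψc (z a) 0 x - S.p.subOpt (z a)) := by
  have hB : 0 < B := by linarith
  have ht0 := two_le_t₀ V H hB.le
  have hae : ∀ᵐ a ∂P, S.τbase B T = 0 → ∀ t ≤ T, S.errVec ν G F z sbar u t a = 0 := by
    by_cases h0 : S.τbase B T = 0
    · have hσ : S.σXf = 0 := by
        have h1 := S.σXf_mul_le_τbase (B := B) T
        rw [h0] at h1
        by_contra hne
        have h2 : 0 < S.σXf := lt_of_le_of_ne S.σXf_nonneg (Ne.symm hne)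
        have h3 : (0 : ℝ) < T := by exact_mod_cast hT
        have : 0 < S.σXf * (T * Real.sqrt T) / (B * Real.sqrt (S.t₀ B + 2)) := by
          have := Real.sqrt_pos.mpr h3
          have := Real.sqrt_pos.mpr (by linarith : 0 < S.t₀ B + 2)
          positivity
        linarith
      filter_upwards [R.ae_errVec_eq_zero H hT hσ] with a ha _
      exact ha
    · exact Filter.Eventually.of_forall fun a h => absurd h h0
  filter_upwards [hae] with a ha
  refine (R.trace a).residuals_le V H (R.z_mem a) (R.u₀_mem a)
    (fun i x hx => R.oracle.mean_G (z a) (R.z_mem a) i x hx) (hk a) hY hYB (hys a)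
    (fun t => div_nonneg (sq_nonneg _) (τ_nonneg H B T t)) (fun t ht => ?_) (fun h0 => ?_)
  · by_cases h0 : S.τbase B T = 0
    · have h1 : S.errVec ν G F z sbar u (t + 1) a - S.errVec ν G F z sbar u t a = 0 := by
        rw [ha h0 (t + 1) ht, ha h0 t ht.le, sub_zero]
      have h2 : ‖S.errVec ν G F z sbar u (t + 1) a - S.errVec ν G F z sbar u t a‖ ^ 2 ≤
          S.τ B T (t + 1) * noiseIncr S ν G F B T z sbar u (t + 1) a := by
        rw [τ_eq, h0, h1]
        simp
      exact h2
    · have hτ : S.τ B T (t + 1) ≠ 0 := by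
        rw [τ_eq]
        exact div_ne_zero h0 (by positivity)
      have h2 : ‖S.errVec ν G F z sbar u (t + 1) a - S.errVec ν G F z sbar u t a‖ ^ 2 ≤
          S.τ B T (t + 1) * noiseIncr S ν G F B T z sbar u (t + 1) a := by
        unfold noiseIncr
        rw [mul_div_cancel₀ _ hτ, Nat.add_sub_cancel]
      exact h2
  · have h1 := ha h0 0 (Nat.zero_le _)
    unfold errVec at h1
    exact (WithLp.toLp_eq_zero 2).mp h1

/-- The second moments of the dual iterates satisfy a self-bounding estimate. -/
lemma exists_dual_moment_bound (R : StochasticTrace S P ν G F B T z xs u₀ s sbar u y)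
    (V : S.Valid) (H : S.p.Standing) (hT : 1 ≤ T) {Y : ℝ} (hY : 0 ≤ Y) (hYB : Y + 1 ≤ B)
    {ys : Ω → Fin m → ℝ} (hk : ∀ a, S.p.IsSubKKT (z a) (xs a) (ys a))
    (hys : ∀ a, Real.sqrt (∑ i, ys a i ^ 2) ≤ Y) :
    ∃ yM : ℝ, 0 ≤ yM ∧
      (∀ t ≤ T, ∫ a, ‖(WithLp.toLp 2 (y t a) : EuclideanSpace ℝ (Fin m))‖ ^ 2 ∂P ≤ yM) ∧
      (0 < S.τbase B T → yM ≤ 2 * Y ^ 2 + 8 / S.τbase B T * S.remainderBound B Y T yM) := by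
  have hB : 0 < B := by linarith
  have ht0 := two_le_t₀ V H hB.le
  obtain ⟨t, ht, hmax⟩ := Finset.exists_max_image (Finset.range (T + 1))
    (fun t => ∫ a, ‖(WithLp.toLp 2 (y t a) : EuclideanSpace ℝ (Fin m))‖ ^ 2 ∂P)
    ⟨0, by simp⟩
  set yM := ∫ a, ‖(WithLp.toLp 2 (y t a) : EuclideanSpace ℝ (Fin m))‖ ^ 2 ∂P with hyM
  have hyM0 : 0 ≤ yM := integral_nonneg fun a => sq_nonneg _
  have hle : ∀ t ≤ T, ∫ a, ‖(WithLp.toLp 2 (y t a) : EuclideanSpace ℝ (Fin m))‖ ^ 2 ∂P ≤ yM :=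
    fun r hr => hmax r (Finset.mem_range.mpr (by omega))
  refine ⟨yM, hyM0, hle, fun hτ => ?_⟩
  have htT : t ≤ T := by have := Finset.mem_range.mp ht; omega
  rcases t with _ | t
  · have h0 : yM = 0 := by
      rw [hyM]
      refine integral_eq_zero_of_ae (Filter.Eventually.of_forall fun a => ?_)
      simp only [(R.trace a).init_dual]
      simp
    obtain ⟨h1, h2⟩ := R.integral_remainderVec_le V H hT hY hYB hle (N := 1) hT
    have h3 : 0 ≤ ∫ a, remainderVec S ν G F B Y T z xs s sbar u y 1 a ∂P := by
      refine integral_nonneg_of_ae ?_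
      filter_upwards [R.ae_residuals_le V H hT hY hYB hk hys] with a ha
      refine le_trans ?_ (ha.1 0 hT)
      have h4 := τ_nonneg H B T 0
      have h5 : 0 ≤ ∑ i, (ys a i - y (0 + 1) a i) ^ 2 := Finset.sum_nonneg fun i _ => sq_nonneg _
      have h6 : (0 : ℝ) ≤ ((0 : ℕ) : ℝ) + S.t₀ B + 2 := by push_cast; linarith
      exact mul_nonneg (div_nonneg (mul_nonneg h6 h4) (by norm_num)) h5
    have h4 : 0 ≤ S.remainderBound B Y T yM := h3.trans h2
    have h5 : 0 ≤ 2 * Y ^ 2 + 8 / S.τbase B T * S.remainderBound B Y T yM := by positivity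
    linarith
  · obtain ⟨h1, h2⟩ := R.integral_remainderVec_le V H hT hY hYB hle (N := t + 1) htT
    have hy2 : Integrable (fun a =>
        ‖(WithLp.toLp 2 (y (t + 1) a) : EuclideanSpace ℝ (Fin m))‖ ^ 2) P :=
      (R.memLp_dual V H hT htT).integrable_norm_pow (by norm_num)
    have h3 : yM ≤ ∫ a, (2 * Y ^ 2 + 8 / S.τbase B T
        * remainderVec S ν G F B Y T z xs s sbar u y (t + 1) a) ∂P := by
      refine integral_mono_ae hy2 ((integrable_const _).add (h1.const_mul _)) ?_
      filter_upwards [R.ae_residuals_le V H hT hY hYB hk hys] with a ha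
      have h4 := ha.1 t htT
      set D := ∑ i, (ys a i - y (t + 1) a i) ^ 2 with hD
      have hD0 : 0 ≤ D := Finset.sum_nonneg fun i _ => sq_nonneg _
      have h5 : S.τbase B T ≤ (t + S.t₀ B + 2) * S.τ B T t := by
        rw [τ_eq, mul_div_assoc', le_div_iff₀ (by positivity), mul_comm]
        exact mul_le_mul_of_nonneg_right (by linarith) hτ.le
      have h6 : S.τbase B T / 4 * D ≤ remainderVec S ν G F B Y T z xs s sbar u y (t + 1) a := by
        refine le_trans ?_ h4
        gcongr
      have h7 : 2 * D ≤ 8 / S.τbase B T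
          * remainderVec S ν G F B Y T z xs s sbar u y (t + 1) a := by
        rw [div_mul_eq_mul_div, le_div_iff₀ hτ]
        linarith
      have h8 : ‖(WithLp.toLp 2 (y (t + 1) a) : EuclideanSpace ℝ (Fin m))‖ ^ 2
          = ∑ i, y (t + 1) a i ^ 2 := by
        simp [EuclideanSpace.norm_sq_eq]
      have h9 : ∑ i, ys a i ^ 2 ≤ Y ^ 2 := by
        rw [← Real.sq_sqrt (Finset.sum_nonneg fun i _ => sq_nonneg (ys a i))]
        exact pow_le_pow_left₀ (Real.sqrt_nonneg _) (hys a) 2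
      have h10 : ∑ i, y (t + 1) a i ^ 2 ≤ 2 * ∑ i, ys a i ^ 2 + 2 * D := by
        rw [hD, Finset.mul_sum, Finset.mul_sum, ← Finset.sum_add_distrib]
        refine Finset.sum_le_sum fun i _ => ?_
        nlinarith [sq_nonneg (2 * ys a i - y (t + 1) a i)]
      rw [h8]
      linarith
    have h4 := integral_add (integrable_const (μ := P) (2 * Y ^ 2)) (h1.const_mul (8 / S.τbase B T))
    rw [h4, integral_const_mul (8 / S.τbase B T)] at h3
    simp only [integral_const, probReal_univ, one_smul] at h3
    have h5 := mul_le_mul_of_nonneg_left h2 (by positivity : 0 ≤ 8 / S.τbase B T)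
    linarith

/-- Expected accuracy of the output, from a bound for the expected remainder. -/
theorem isStochSubOpt (R : StochasticTrace S P ν G F B T z xs u₀ s sbar u y)
    (V : S.Valid) (H : S.p.Standing) (hT : 1 ≤ T) {Y : ℝ} (hY : 0 ≤ Y) (hYB : Y + 1 ≤ B)
    {ys : Ω → Fin m → ℝ} (hk : ∀ a, S.p.IsSubKKT (z a) (xs a) (ys a))
    (hys : ∀ a, Real.sqrt (∑ i, ys a i ^ 2) ≤ Y) {x : Ω → Rn n} (hxm : Measurable x)
    (hx : ∀ a, x a = (∑ t ∈ Finset.range T, S.γ B t)⁻¹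
      • ∑ t ∈ Finset.range T, S.γ B t • u (t + 1) a) {δo δc : ℝ}
    (hδ : ∀ yM : ℝ, 0 ≤ yM →
      (0 < S.τbase B T → yM ≤ 2 * Y ^ 2 + 8 / S.τbase B T * S.remainderBound B Y T yM) →
      S.remainderBound B Y T yM ≤ S.Γ B T * δo ∧ S.remainderBound B Y T yM ≤ S.Γ B T * δc) :
    S.p.IsStochSubOpt P δo δc z x := by
  have hB : 0 < B := by linarith
  obtain ⟨yM, h0, hyM, hself⟩ := R.exists_dual_moment_bound V H hT hY hYB hk hys
  obtain ⟨hδo, hδc⟩ := hδ yM h0 hself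
  obtain ⟨hI, hle⟩ := R.integral_remainderVec_le V H hT hY hYB hyM le_rfl
  have hΓ := Γ_pos V H hB.le hT
  have hxX : ∀ a, x a ∈ S.p.X := fun a => by
    have h := (R.trace a).output_mem V H hB.le hT
    rw [hx a]
    exact h
  have hae := R.ae_residuals_le V H hT hY hYB hk hys
  set r := remainderVec S ν G F B Y T z xs s sbar u y T with hr
  have hvm := H.measurable_subViol R.meas_z hxm R.z_mem hxX
  have hsub : (fun a => S.p.subOpt (z a)) = fun a => S.p.ψc (z a) 0 (xs a) :=
    funext fun a => (hk a).subOpt_eq H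
  have hgm : Measurable fun a => S.p.ψc (z a) 0 (x a) - S.p.subOpt (z a) := by
    refine (H.measurable_ψc R.meas_z hxm R.z_mem hxX 0).sub ?_
    rw [hsub]
    exact H.measurable_ψc R.meas_z R.meas_xs R.z_mem R.xs_mem 0
  have hIr : Integrable (fun a => r a / S.Γ B T) P := hI.div_const _
  have hv : ∀ᵐ a ∂P, S.p.subViol (z a) (x a) ≤ r a / S.Γ B T := by
    filter_upwards [hae] with a ha
    rw [le_div_iff₀ hΓ, mul_comm]
    exact (ha.2 _ hT (hx a)).1
  have hg : ∀ᵐ a ∂P, S.p.ψc (z a) 0 (x a) - S.p.subOpt (z a) ≤ r a / S.Γ B T := by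
    filter_upwards [hae] with a ha
    rw [le_div_iff₀ hΓ, mul_comm]
    exact (ha.2 _ hT (hx a)).2.1
  have hv0 : ∀ a, 0 ≤ S.p.subViol (z a) (x a) := fun a => Real.sqrt_nonneg _
  have hIv : Integrable (fun a => S.p.subViol (z a) (x a)) P := by
    refine hIr.mono' hvm.aestronglyMeasurable ?_
    filter_upwards [hv] with a ha
    rwa [Real.norm_of_nonneg (hv0 a)]
  have hIg : Integrable (fun a => S.p.ψc (z a) 0 (x a) - S.p.subOpt (z a)) P := by
    refine (hIr.add (hIr.const_mul Y)).mono' hgm.aestronglyMeasurable ?_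
    filter_upwards [hae, hv, hg] with a ha h1 h2
    have h3 := (ha.2 _ hT (hx a)).2.2
    have h4 := mul_le_mul_of_nonneg_left h1 hY
    have h5 : 0 ≤ r a / S.Γ B T := (hv0 a).trans h1
    have h6 : 0 ≤ Y * (r a / S.Γ B T) := by positivity
    simp only [Pi.add_apply, Real.norm_eq_abs]
    rw [abs_le]
    constructor <;> linarith
  have hfin : ∀ δ, S.remainderBound B Y T yM ≤ S.Γ B T * δ →
      ∫ a, r a / S.Γ B T ∂P ≤ δ := by
    intro δ hδ
    rw [integral_div, div_le_iff₀ hΓ, mul_comm]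
    exact hle.trans hδ
  exact ⟨hxX, hIg, (integral_mono_ae hIg hIr hg).trans (hfin _ hδo), hIv,
    (integral_mono_ae hIv hIr hv).trans (hfin _ hδc)⟩

end StochasticTrace

end ConExSetup

/-! ### Measurability of solutions and iterates -/

/-- A function that is Hölder continuous as a function of a measurable one is measurable, for any
σ-algebra. -/
lemma measurable_of_sq_dist_le {Ω α β : Type*} {_ : MeasurableSpace Ω}
    [MetricSpace α] [MeasurableSpace α] [BorelSpace α]
    [PseudoMetricSpace β] [MeasurableSpace β] [OpensMeasurableSpace β]
    {f : Ω → α} {g : Ω → β} {C : ℝ} (hg : Measurable g)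
    (h : ∀ a b, dist (f a) (f b) ^ 2 ≤ C * dist (g a) (g b)) : Measurable f := by
  let F : Set.range g → α := fun r => f r.2.choose
  have hsp : ∀ r : Set.range g, g r.2.choose = r := fun r => r.2.choose_spec
  have hF : Continuous F := by
    rw [Metric.continuous_iff]
    intro r ε hε
    refine ⟨ε ^ 2 / (|C| + 1), by positivity, fun q hq => ?_⟩
    have h1 := h q.2.choose r.2.choose
    rw [hsp, hsp] at h1
    have h2 : C * dist (q : β) (r : β) ≤ |C| * dist (q : β) (r : β) :=
      mul_le_mul_of_nonneg_right (le_abs_self C) dist_nonneg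
    have h3 : dist (q : β) (r : β) < ε ^ 2 / (|C| + 1) := hq
    rw [lt_div_iff₀ (by positivity)] at h3
    have h4 : dist (f q.2.choose) (f r.2.choose) ^ 2 < ε ^ 2 := by
      nlinarith [dist_nonneg (x := (q : β)) (y := (r : β))]
    exact lt_of_pow_lt_pow_left₀ 2 hε.le h4
  have hg' : Measurable fun a => (⟨g a, a, rfl⟩ : Set.range g) := hg.subtype_mk
  have heq : f = fun a => F ⟨g a, a, rfl⟩ := by
    funext a
    have h1 := h a (⟨g a, a, rfl⟩ : Set.range g).2.choose
    rw [hsp] at h1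
    simp only [dist_self, mul_zero] at h1
    exact dist_eq_zero.mp (pow_eq_zero_iff (two_ne_zero) |>.mp (le_antisymm h1 (sq_nonneg _)))
  rw [heq]
  exact hF.measurable.comp hg'

namespace Problem

variable {n m : ℕ} {p : Problem n m}

lemma Standing.exists_abs_W_sub_le (H : p.Standing) :
    ∃ C : ℝ, 0 ≤ C ∧ ∀ x ∈ p.X, ∀ z ∈ p.X, ∀ z' ∈ p.X, p.W x z - p.W x z' ≤ C * dist z z' := by
  obtain ⟨c, hc, h⟩ := exists_seminorm_le_norm p.nrm
  have hL := H.Lω_pos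
  have hD := H.DX_nonneg
  refine ⟨p.Lω * c * p.DX, by positivity, fun x hx z hz z' hz' => ?_⟩
  have h1 := p.W_three_point x z z'
  have h2 := H.W_nonneg hz hz'
  have h3 := abs_inner_le_dualNorm_mul H.norm_definite (p.gradDgf z - p.gradDgf z') (x - z)
  have h4 := H.smooth_dgf z hz z' hz'
  have h5 := H.nrm_le_DX hx hz
  have h6 := h (z - z')
  have h7 : p.W x z - p.W x z' ≤ dualNorm p.nrm (p.gradDgf z - p.gradDgf z') * p.nrm (x - z) := by
    have := (abs_le.mp h3).1
    linarith
  refine h7.trans ?_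
  rw [dist_eq_norm]
  calc _ ≤ (p.Lω * p.nrm (z - z')) * p.DX :=
        mul_le_mul h4 h5 (apply_nonneg _ _) (by positivity)
    _ ≤ (p.Lω * (c * ‖z - z'‖)) * p.DX := by gcongr
    _ = _ := by ring

/-- The solution of the subproblem is a Hölder continuous function of the centre, as long as the
multipliers stay bounded. -/
lemma Standing.exists_sq_dist_subKKT_le (H : p.Standing) (B : ℝ) :
    ∃ C : ℝ, ∀ z ∈ p.X, ∀ z' ∈ p.X, ∀ x x' : Rn n, ∀ y y' : Fin m → ℝ,
      p.IsSubKKT z x y → p.IsSubKKT z' x' y' → ∑ i, |y i| ≤ B → ∑ i, |y' i| ≤ B →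
      dist x x' ^ 2 ≤ C * dist z z' := by
  obtain ⟨C, hC0, hC⟩ := H.exists_abs_W_sub_le
  obtain ⟨c, hc, hn⟩ := exists_norm_le_seminorm H.norm_definite
  have hμ := H.μ_zero
  have hM := H.μmax_nonneg
  refine ⟨c ^ 2 / p.μ 0 * (2 * (2 * p.μ 0 * C + 2 * p.μmax * C * B)), ?_⟩
  intro z hz z' hz' x x' y y' hk hk' hy hy'
  set d := dist z z' with hd
  have hd0 : 0 ≤ d := dist_nonneg
  -- one half of the estimate; the other one is symmetric
  have key : ∀ z ∈ p.X, ∀ z' ∈ p.X, ∀ x x' : Rn n, ∀ y y' : Fin m → ℝ, dist z z' = d →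
      p.IsSubKKT z x y → p.IsSubKKT z' x' y' → ∑ i, |y i| ≤ B →
      p.ψc z 0 x + p.μ 0 / 2 * p.nrm (x' - x) ^ 2
        ≤ p.ψc z 0 x' + 2 * p.μmax * C * B * d := by
    intro z hz z' hz' x x' y y' hdz hk hk' hy
    have h1 := hk.lagrangian_strong H hk'.mem
    have h2 := hk.sum_mul_nonneg H
    have h3 : ∑ i : Fin m, y i * p.ψc z i.succ x' ≤ ∑ i : Fin m, |y i| * (2 * p.μmax * C * d) := by
      refine Finset.sum_le_sum fun i _ => ?_
      rw [abs_of_nonneg (hk.nonneg i)]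
      refine mul_le_mul_of_nonneg_left ?_ (hk.nonneg i)
      have h4 := hk'.feasible i
      have h5 := hC x' hk'.mem z hz z' hz'
      rw [hdz] at h5
      have h6 := p.μ_le_μmax i
      have h7 := H.μ_succ i
      unfold ψc at h4 ⊢
      have h8 := mul_le_mul_of_nonneg_left h5 h7
      have h9 : p.μ i.succ * (C * d) ≤ p.μmax * (C * d) := by gcongr
      linarith
    rw [← Finset.sum_mul] at h3
    have h4 : (∑ i, |y i|) * (2 * p.μmax * C * d) ≤ B * (2 * p.μmax * C * d) := by gcongr
    have h5 : 0 ≤ (∑ i : Fin m, y i * p.μ i.succ) / 2 * p.nrm (x' - x) ^ 2 := by positivity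
    linarith
  have h1 := key z hz z' hz' x x' y y' rfl hk hk' hy
  have h2 := key z' hz' z hz x' x y' y (dist_comm _ _) hk' hk hy'
  rw [map_sub_rev] at h2
  have h3 := mul_le_mul_of_nonneg_left (hC x' hk'.mem z hz z' hz') hμ.le
  have h4 := mul_le_mul_of_nonneg_left (hC x hk.mem z' hz' z hz) hμ.le
  rw [dist_comm z' z] at h4
  have h5 : p.μ 0 * p.nrm (x' - x) ^ 2 ≤ 2 * (2 * p.μ 0 * C + 2 * p.μmax * C * B) * d := by
    unfold ψc at h1 h2
    have e : p.μ 0 * (C * dist z z') = p.μ 0 * C * d := by rw [hd]; ring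
    rw [e] at h3 h4
    linarith
  have h6 := hn (x' - x)
  rw [dist_comm, dist_eq_norm]
  calc ‖x' - x‖ ^ 2 ≤ (c * p.nrm (x' - x)) ^ 2 := by gcongr
    _ = c ^ 2 / p.μ 0 * (p.μ 0 * p.nrm (x' - x) ^ 2) := by field_simp
    _ ≤ c ^ 2 / p.μ 0 * (2 * (2 * p.μ 0 * C + 2 * p.μmax * C * B) * d) := by gcongr
    _ = _ := by ring

end Problem

namespace ConExSetup

variable {n m : ℕ} {S : ConExSetup n m}

/-- Minimizers of the primal subproblems are Hölder continuous in the parameters. -/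
lemma Valid.exists_sq_dist_prox_le (V : S.Valid) (H : S.p.Standing) :
    ∃ C : ℝ, ∀ η : ℝ, 0 ≤ η → ∀ (y y' : Fin m → ℝ) (w w' u u' : Rn n),
      (∀ i, 0 ≤ y i) → (∀ i, 0 ≤ y' i) → u ∈ S.p.X → u' ∈ S.p.X →
      (∀ x ∈ S.p.X, S.χs 0 u + ∑ i : Fin m, y i * S.χs i.succ u + ⟪w, u⟫
          + (S.p.μ 0 + ∑ i : Fin m, y i * S.p.μ i.succ + η) * S.p.dgf u
        ≤ S.χs 0 x + ∑ i : Fin m, y i * S.χs i.succ x + ⟪w, x⟫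
          + (S.p.μ 0 + ∑ i : Fin m, y i * S.p.μ i.succ + η) * S.p.dgf x) →
      (∀ x ∈ S.p.X, S.χs 0 u' + ∑ i : Fin m, y' i * S.χs i.succ u' + ⟪w', u'⟫
          + (S.p.μ 0 + ∑ i : Fin m, y' i * S.p.μ i.succ + η) * S.p.dgf u'
        ≤ S.χs 0 x + ∑ i : Fin m, y' i * S.χs i.succ x + ⟪w', x⟫
          + (S.p.μ 0 + ∑ i : Fin m, y' i * S.p.μ i.succ + η) * S.p.dgf x) →
      dist u u' ^ 2 ≤ C * dist (y, w) (y', w') := by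
  obtain ⟨c, hc, hn⟩ := exists_norm_le_seminorm H.norm_definite
  obtain ⟨R, hR⟩ := H.compact_X.isBounded.subset_closedBall 0
  have hb : ∀ i : Fin m, ∃ b : ℝ, ∀ x ∈ S.p.X, |S.χs i.succ x + S.p.μ i.succ * S.p.dgf x| ≤ b :=
    fun i => H.compact_X.exists_bound_of_continuousOn
      ((V.cont_χs i).add (H.continuousOn_dgf.const_smul (S.p.μ i.succ)))
  choose b hb using hb
  have hμ := H.μ_zero
  refine ⟨c ^ 2 / S.p.μ 0 * (∑ i : Fin m, 2 * |b i| + (|R| + |R|)), ?_⟩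
  intro η hη y y' w w' u u' hy hy' hu hu' hmin hmin'
  set d := dist (y, w) (y', w') with hd
  have hd0 : 0 ≤ d := dist_nonneg
  have hs : ∀ y : Fin m → ℝ, (∀ i, 0 ≤ y i) → 0 ≤ ∑ i : Fin m, y i * S.p.μ i.succ := fun y hy =>
    Finset.sum_nonneg fun i _ => mul_nonneg (hy i) (H.μ_succ i)
  have hsy := hs y hy
  have hsy' := hs y' hy'
  have h1 := H.prox_three_point (V.convexOn_sum_χs H hy) (by positivity) hu hu' hmin
  have h2 := H.prox_three_point (V.convexOn_sum_χs H hy') (by positivity) hu' hu hmin'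
  have h3 := H.half_sq_le_W hu' hu
  have h4 := H.half_sq_le_W hu hu'
  rw [map_sub_rev] at h4
  have h5 : S.p.μ 0 * S.p.nrm (u' - u) ^ 2
      ≤ ∑ i : Fin m, (y i - y' i) * ((S.χs i.succ u' + S.p.μ i.succ * S.p.dgf u')
          - (S.χs i.succ u + S.p.μ i.succ * S.p.dgf u)) + ⟪w - w', u' - u⟫ := by
    have e : ∑ i : Fin m, (y i - y' i) * ((S.χs i.succ u' + S.p.μ i.succ * S.p.dgf u')
          - (S.χs i.succ u + S.p.μ i.succ * S.p.dgf u))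
        = ∑ i : Fin m, y i * S.χs i.succ u' - ∑ i : Fin m, y' i * S.χs i.succ u'
          - (∑ i : Fin m, y i * S.χs i.succ u - ∑ i : Fin m, y' i * S.χs i.succ u)
          + (∑ i : Fin m, y i * S.p.μ i.succ - ∑ i : Fin m, y' i * S.p.μ i.succ)
            * (S.p.dgf u' - S.p.dgf u) := by
      rw [← Finset.sum_sub_distrib, ← Finset.sum_sub_distrib, ← Finset.sum_sub_distrib,
        ← Finset.sum_sub_distrib, Finset.sum_mul, ← Finset.sum_add_distrib]
      refine Finset.sum_congr rfl fun i _ => ?_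
      ring
    rw [e, inner_sub_left, inner_sub_right, inner_sub_right]
    have h6 : S.p.μ 0 * (1 / 2 * S.p.nrm (u' - u) ^ 2)
        ≤ (S.p.μ 0 + ∑ i : Fin m, y i * S.p.μ i.succ + η) * S.p.W u' u :=
      mul_le_mul (by linarith) h3 (by positivity) (by positivity)
    have h7 : S.p.μ 0 * (1 / 2 * S.p.nrm (u' - u) ^ 2)
        ≤ (S.p.μ 0 + ∑ i : Fin m, y' i * S.p.μ i.succ + η) * S.p.W u u' :=
      mul_le_mul (by linarith) h4 (by positivity) (by positivity)
    linarith
  have h6 : ∑ i : Fin m, (y i - y' i) * ((S.χs i.succ u' + S.p.μ i.succ * S.p.dgf u')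
          - (S.χs i.succ u + S.p.μ i.succ * S.p.dgf u)) ≤ d * ∑ i : Fin m, 2 * |b i| := by
    rw [Finset.mul_sum]
    refine Finset.sum_le_sum fun i _ => (le_abs_self _).trans ?_
    rw [abs_mul]
    have h7 : |y i - y' i| ≤ d := by
      rw [← Real.dist_eq]
      exact (dist_le_pi_dist y y' i).trans (le_max_left _ _)
    have h8 := hb i u hu
    have h9 := hb i u' hu'
    have h10 := le_abs_self (b i)
    refine mul_le_mul h7 ((abs_sub _ _).trans (by linarith)) (abs_nonneg _) hd0
  have h7 : ⟪w - w', u' - u⟫ ≤ d * (|R| + |R|) := by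
    refine (real_inner_le_norm _ _).trans (mul_le_mul ?_ ?_ (norm_nonneg _) hd0)
    · rw [← dist_eq_norm]
      exact le_max_right _ _
    · have q1 := mem_closedBall_zero_iff.mp (hR hu)
      have q2 := mem_closedBall_zero_iff.mp (hR hu')
      have q3 := le_abs_self R
      exact (norm_sub_le _ _).trans (by linarith)
  have h8 := hn (u' - u)
  rw [dist_comm, dist_eq_norm]
  calc ‖u' - u‖ ^ 2 ≤ (c * S.p.nrm (u' - u)) ^ 2 := by gcongr
    _ = c ^ 2 / S.p.μ 0 * (S.p.μ 0 * S.p.nrm (u' - u) ^ 2) := by field_simp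
    _ ≤ c ^ 2 / S.p.μ 0 * (d * ∑ i : Fin m, 2 * |b i| + d * (|R| + |R|)) := by
        gcongr
        linarith
    _ = _ := by ring

section Measurability

variable {Ω Ξ : Type*} {mΩ : MeasurableSpace Ω} [MeasurableSpace Ξ] {ν : Measure Ξ}
  [IsProbabilityMeasure ν] {G : Rn n → Fin (m + 1) → Rn n → Ξ → Rn n}
  {F : Rn n → Fin m → Rn n → Ξ → ℝ} {B : ℝ} {T : ℕ}
  {z u₀ : Ω → Rn n} {s sbar : ℕ → Ω → Ξ} {u : ℕ → Ω → Rn n} {y : ℕ → Ω → Fin m → ℝ}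

omit [IsProbabilityMeasure ν] in
/-- The primal step is measurable with respect to whatever it is computed from. -/
lemma measurable_primal_step (V : S.Valid) (H : S.p.Standing) (O : S.IsOracle ν G F) (hB : 0 ≤ B)
    (hz : Measurable z) (hzm : ∀ a, z a ∈ S.p.X)
    (tr : ∀ a, S.IsConExTrace G F B T (z a) (u₀ a) (fun t => s t a) (fun t => sbar t a)
      (fun t => u t a) (fun t => y t a)) (hu₀ : ∀ a, u₀ a ∈ S.p.X) {t : ℕ} (ht : t < T)
    (hu : Measurable (u t)) (hy : Measurable (y (t + 1))) (hs : Measurable (s t)) :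
    Measurable (u (t + 1)) := by
  obtain ⟨C, hC⟩ := V.exists_sq_dist_prox_le H
  have hum : ∀ a, u t a ∈ S.p.X := fun a => (tr a).mem (hu₀ a) t ht.le
  have hη : 0 ≤ S.η B t := by
    have h1 := two_le_t₀ V H hB
    have h2 : 0 < S.α₀ := H.μ_zero
    unfold η
    positivity
  have hy' : ∀ i, Measurable fun a => y (t + 1) a i := fun i => (measurable_pi_apply i).comp hy
  have hG : ∀ i, Measurable fun a => G (z a) i (u t a) (s t a) := fun i =>
    (O.meas_G i).comp (hz.prodMk (hu.prodMk hs))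
  have hgz := H.continuousOn_gradDgf.measurable_comp_of_mem hz hzm
  have hgu := H.continuousOn_gradDgf.measurable_comp_of_mem hu hum
  let w : Ω → Rn n := fun a =>
    (G (z a) 0 (u t a) (s t a) + ∑ i : Fin m, y (t + 1) a i • G (z a) i.succ (u t a) (s t a))
      - (S.p.μ 0 + ∑ i : Fin m, y (t + 1) a i * S.p.μ i.succ) • S.p.gradDgf (z a)
      - S.η B t • S.p.gradDgf (u t a)
  have hw : Measurable w :=
    (((hG 0).add (Finset.measurable_sum _ fun i _ => (hy' i).smul (hG i.succ))).sub
      ((measurable_const.add (Finset.measurable_sum _ fun i _ => (hy' i).mul_const _)).smul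
        hgz)).sub (hgu.const_smul (S.η B t))
  have hmin : ∀ a, ∀ x ∈ S.p.X,
      S.χs 0 (u (t + 1) a) + ∑ i : Fin m, y (t + 1) a i * S.χs i.succ (u (t + 1) a)
          + ⟪w a, u (t + 1) a⟫
          + (S.p.μ 0 + ∑ i : Fin m, y (t + 1) a i * S.p.μ i.succ + S.η B t)
            * S.p.dgf (u (t + 1) a)
        ≤ S.χs 0 x + ∑ i : Fin m, y (t + 1) a i * S.χs i.succ x + ⟪w a, x⟫
          + (S.p.μ 0 + ∑ i : Fin m, y (t + 1) a i * S.p.μ i.succ + S.η B t) * S.p.dgf x := by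
    intro a x hx
    have h1 := isMinOn_iff.mp ((tr a).primal_step t ht) x hx
    simp only [Valid.primal_objective_eq] at h1
    simp only [w]
    linarith
  refine measurable_of_sq_dist_le (C := C) (hy.prodMk hw) fun a b => ?_
  exact hC (S.η B t) hη _ _ _ _ _ _ ((tr a).dual_nonneg (t + 1) ht)
    ((tr b).dual_nonneg (t + 1) ht) ((tr a).primal_mem t ht) ((tr b).primal_mem t ht)
    (hmin a) (hmin b)

lemma measurable_χc (V : S.Valid) (H : S.p.Standing) (hz : Measurable z) (hzm : ∀ a, z a ∈ S.p.X)
    {x : Ω → Rn n} (hx : Measurable x) (hxm : ∀ a, x a ∈ S.p.X) (i : Fin m) :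
    Measurable fun a => S.χc (z a) i.succ (x a) := by
  have h1 := (V.cont_χs i).measurable_comp_of_mem hx hxm
  have h3 := H.continuousOn_dgf.measurable_comp_of_mem hx hxm
  have h4 := H.continuousOn_dgf.measurable_comp_of_mem hz hzm
  have h5 := H.continuousOn_gradDgf.measurable_comp_of_mem hz hzm
  unfold χc Problem.W
  exact h1.add (((h3.sub h4).sub (h5.inner (hx.sub hz))).const_mul _)

omit [IsProbabilityMeasure ν] in
lemma measurable_linVal_zero (V : S.Valid) (H : S.p.Standing) (O : S.IsOracle ν G F)
    (hz : Measurable z) (hzm : ∀ a, z a ∈ S.p.X) (hu : Measurable (u 0))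
    (hum : ∀ a, u 0 a ∈ S.p.X) (hs : Measurable (sbar 0)) (i : Fin m) :
    Measurable fun a => S.linVal G F (z a) (fun t => sbar t a) (fun t => u t a) i 0 :=
  (measurable_χc V H hz hzm hu hum i).add ((O.meas_F i).comp (hz.prodMk (hu.prodMk hs)))

omit [IsProbabilityMeasure ν] in
lemma measurable_linVal_succ (V : S.Valid) (H : S.p.Standing) (O : S.IsOracle ν G F)
    (hz : Measurable z) (hzm : ∀ a, z a ∈ S.p.X) {t : ℕ} (hu : Measurable (u t))
    (hu' : Measurable (u (t + 1))) (hum' : ∀ a, u (t + 1) a ∈ S.p.X) (hs : Measurable (sbar t))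
    (i : Fin m) :
    Measurable fun a => S.linVal G F (z a) (fun t => sbar t a) (fun t => u t a) i (t + 1) :=
  (measurable_χc V H hz hzm hu' hum' i).add (((O.meas_F i).comp (hz.prodMk (hu.prodMk hs))).add
    (((O.meas_G i.succ).comp (hz.prodMk (hu.prodMk hs))).inner (hu'.sub hu)))

omit [MeasurableSpace Ξ] [IsProbabilityMeasure ν] in
lemma measurable_dual_step (tr : ∀ a, S.IsConExTrace G F B T (z a) (u₀ a) (fun t => s t a)
      (fun t => sbar t a) (fun t => u t a) (fun t => y t a)) {t : ℕ} (ht : t < T)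
    (hy : Measurable (y t))
    (h : ∀ i, Measurable fun a => S.linVal G F (z a) (fun t => sbar t a) (fun t => u t a) i t)
    (h' : ∀ i, Measurable fun a =>
      S.linVal G F (z a) (fun t => sbar t a) (fun t => u t a) i (t - 1)) :
    Measurable (y (t + 1)) := by
  refine measurable_pi_iff.mpr fun i => ?_
  simp_rw [fun a => (tr a).dual_step t ht i]
  exact (((measurable_pi_apply i).comp hy).add
    ((((h i).const_mul _).sub ((h' i).const_mul _)).const_mul _)).max measurable_const

/-- The constraint noise is measurable with respect to whatever it is computed from. -/
lemma measurable_linErr_succ (O : S.IsOracle ν G F)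
    (hz : Measurable z) (hzm : ∀ a, z a ∈ S.p.X) {t : ℕ} (hu : Measurable (u t))
    (hum : ∀ a, u t a ∈ S.p.X) (hu' : Measurable (u (t + 1))) (hs : Measurable (sbar t)) :
    Measurable fun a => (WithLp.toLp 2 (S.linErr G F (fun i x => ∫ q, G (z a) i x q ∂ν) (z a)
      (fun t => sbar t a) (fun t => u t a) (t + 1)) : EuclideanSpace ℝ (Fin m)) := by
  refine StochasticTrace.measurable_toLp fun i => ?_
  have h1 := (O.measurable_noiseF i).comp (hz.prodMk (hu.prodMk hs))
  have h2 := Measurable.inner (𝕜 := ℝ)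
    ((O.measurable_noiseG i.succ).comp (hz.prodMk (hu.prodMk hs))) (hu'.sub hu)
  convert h1.add h2 using 1
  funext a
  simp only [linErr, noiseF, noiseG, Pi.add_apply, Function.comp]
  rw [O.mean_F _ (hzm a) _ _ (hum a)]
  rfl

end Measurability

end ConExSetup

/-! ### Independence of the samples -/

section SampleSigma

variable {Ω Ξ ι : Type*} [MeasurableSpace Ω] [MeasurableSpace Ξ] {ξ : ι → Ω → Ξ}

/-- The σ-algebra generated by the samples with index in `J`. -/
abbrev sampleSigma (ξ : ι → Ω → Ξ) (J : Set ι) : MeasurableSpace Ω :=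
  ⨆ j ∈ J, MeasurableSpace.comap (ξ j) inferInstance

omit [MeasurableSpace Ω] in
lemma sampleSigma_le {mΩ : MeasurableSpace Ω} (hξ : ∀ j, Measurable (ξ j)) (J : Set ι) :
    sampleSigma ξ J ≤ mΩ :=
  iSup₂_le fun j _ => (hξ j).comap_le

omit [MeasurableSpace Ω] in
lemma sampleSigma_mono {J J' : Set ι} (h : J ⊆ J') : sampleSigma ξ J ≤ sampleSigma ξ J' :=
  biSup_mono h

omit [MeasurableSpace Ω] in
lemma measurable_sample {J : Set ι} {j : ι} (hj : j ∈ J) : Measurable[sampleSigma ξ J] (ξ j) :=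
  Measurable.mono (comap_measurable (ξ j)) (le_biSup (fun j => MeasurableSpace.comap (ξ j) _) hj)
    le_rfl

lemma indepFun_of_measurable_sampleSigma {P : Measure Ω} {α : Type*} [MeasurableSpace α]
    (hξ : ∀ j, Measurable (ξ j)) (hind : iIndepFun ξ P) {J : Set ι} {V : Ω → α}
    (hV : Measurable[sampleSigma ξ J] V) {j : ι} (hj : j ∉ J) : IndepFun V (ξ j) P := by
  have h1 : iIndep (fun j => MeasurableSpace.comap (ξ j) inferInstance) P := hind
  have h2 := indep_iSup_of_disjoint (fun j => (hξ j).comap_le) h1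
    (Set.disjoint_singleton_right.mpr hj)
  rw [IndepFun_iff_Indep]
  refine indep_of_indep_of_le_left (indep_of_indep_of_le_right h2 ?_) hV.comap_le
  exact le_biSup (fun j => MeasurableSpace.comap (ξ j) _) (Set.mem_singleton j)

end SampleSigma

namespace ConExSetup

variable {n m : ℕ} {S : ConExSetup n m}

/-- Indices of the samples drawn for the first `k` subproblems. -/
def pastSamples (k : ℕ) : Set (ℕ × ℕ × Bool) := {j | j.1 < k}

/-- Indices of the samples that determine the first `t` primal iterates and `t + 1` dual iterates
for the subproblem `k`. -/
def iterSamples (k t : ℕ) : Set (ℕ × ℕ × Bool) :=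
  {j | j.1 < k ∨ (j.1 = k ∧ (j.2.1 < t ∨ (j.2.1 = 0 ∧ j.2.2 = true)))}

lemma pastSamples_subset (k t : ℕ) : pastSamples k ⊆ iterSamples k t := fun _ hj => Or.inl hj

lemma iterSamples_subset {k t t' : ℕ} (h : t ≤ t') : iterSamples k t ⊆ iterSamples k t' := by
  rintro j (hj | ⟨h1, h2 | h2⟩)
  · exact Or.inl hj
  · exact Or.inr ⟨h1, Or.inl (h2.trans_le h)⟩
  · exact Or.inr ⟨h1, Or.inr h2⟩

lemma iterSamples_subset_past (k t : ℕ) : iterSamples k t ⊆ pastSamples (k + 1) := by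
  rintro j (hj | ⟨h1, _⟩)
  · exact Nat.lt_succ_of_lt hj
  · exact h1 ▸ Nat.lt_succ_self _

variable {Ω Ξ : Type*} [MeasurableSpace Ω] [MeasurableSpace Ξ]
  {P : Measure Ω} [IsProbabilityMeasure P] {ν : Measure Ξ} [IsProbabilityMeasure ν]
  {G : Rn n → Fin (m + 1) → Rn n → Ξ → Rn n} {F : Rn n → Fin m → Rn n → Ξ → ℝ} {B : ℝ} {T : ℕ}
  {ξ : ℕ × ℕ × Bool → Ω → Ξ} {z xs u₀ : Ω → Rn n} {u : ℕ → Ω → Rn n} {y : ℕ → Ω → Fin m → ℝ}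

omit [MeasurableSpace Ω] [IsProbabilityMeasure ν] in
/-- The iterates are measurable with respect to the samples used so far. -/
lemma measurable_iterates (V : S.Valid) (H : S.p.Standing) (O : S.IsOracle ν G F) (hB : 0 ≤ B)
    {k : ℕ} (hz : Measurable[sampleSigma ξ (pastSamples k)] z) (hzm : ∀ a, z a ∈ S.p.X)
    (hu₀ : Measurable[sampleSigma ξ (pastSamples k)] u₀) (hu₀m : ∀ a, u₀ a ∈ S.p.X)
    (tr : ∀ a, S.IsConExTrace G F B T (z a) (u₀ a) (fun t => ξ (k, t, false) a)
      (fun t => ξ (k, t, true) a) (fun t => u t a) (fun t => y t a)) :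
    ∀ t ≤ T, Measurable[sampleSigma ξ (iterSamples k t)] (u t) ∧
      Measurable[sampleSigma ξ (iterSamples k t)] (y t) ∧
      (∀ i, Measurable[sampleSigma ξ (iterSamples k t)] fun a =>
        S.linVal G F (z a) (fun t => ξ (k, t, true) a) (fun t => u t a) i t) ∧
      (t < T → Measurable[sampleSigma ξ (iterSamples k t)] (y (t + 1))) := by
  have hz' : ∀ t, Measurable[sampleSigma ξ (iterSamples k t)] z := fun t =>
    hz.mono (sampleSigma_mono (pastSamples_subset k t)) le_rfl
  have hum : ∀ t ≤ T, ∀ a, u t a ∈ S.p.X := fun t ht a => (tr a).mem (hu₀m a) t ht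
  intro t
  induction t with
  | zero =>
    intro _
    have h1 : Measurable[sampleSigma ξ (iterSamples k 0)] (u 0) := by
      have : u 0 = u₀ := funext fun a => (tr a).init_primal
      rw [this]
      exact hu₀.mono (sampleSigma_mono (pastSamples_subset k 0)) le_rfl
    have h2 : Measurable[sampleSigma ξ (iterSamples k 0)] (y 0) := by
      have : y 0 = fun _ => 0 := funext fun a => (tr a).init_dual
      rw [this]
      exact measurable_const
    have h3 := measurable_linVal_zero (sbar := fun t => ξ (k, t, true)) V H O (hz' 0) hzm h1
      (hum 0 (Nat.zero_le _)) (measurable_sample (Or.inr ⟨rfl, Or.inr ⟨rfl, rfl⟩⟩))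
    exact ⟨h1, h2, h3, fun ht => measurable_dual_step tr ht h2 h3 h3⟩
  | succ t ih =>
    intro ht
    have hle := sampleSigma_mono (ξ := ξ) (iterSamples_subset (k := k) (Nat.le_succ t))
    obtain ⟨h1, -, h3, h4⟩ := ih (by omega)
    have h1' := h1.mono hle le_rfl
    have h3' := fun i => (h3 i).mono hle le_rfl
    have h4' := (h4 ht).mono hle le_rfl
    have h5 : Measurable[sampleSigma ξ (iterSamples k (t + 1))] (u (t + 1)) :=
      measurable_primal_step V H O hB (hz' (t + 1)) hzm tr hu₀m ht h1' h4'
        (measurable_sample (Or.inr ⟨rfl, Or.inl (Nat.lt_succ_self t)⟩))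
    have h6 := measurable_linVal_succ (sbar := fun t => ξ (k, t, true)) V H O (hz' (t + 1)) hzm h1'
      h5 (hum (t + 1) ht) (measurable_sample (Or.inr ⟨rfl, Or.inl (Nat.lt_succ_self t)⟩))
    exact ⟨h5, h4', h6, fun ht' => measurable_dual_step tr ht' h4' h6 h3'⟩

omit [IsProbabilityMeasure P] in
/-- A run on a subproblem whose data depend on earlier samples only satisfies the independence
requirements of a stochastic trace. -/
lemma stochasticTrace_of_samples (V : S.Valid) (H : S.p.Standing) (O : S.IsOracle ν G F)
    (hB : 0 ≤ B) {k : ℕ} (hξ : ∀ j, Measurable (ξ j)) (hlaw : ∀ j, P.map (ξ j) = ν)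
    (hind : iIndepFun ξ P)
    (hz : Measurable[sampleSigma ξ (pastSamples k)] z) (hzm : ∀ a, z a ∈ S.p.X)
    (hxs : Measurable[sampleSigma ξ (pastSamples k)] xs) (hxsm : ∀ a, xs a ∈ S.p.X)
    (hu₀ : Measurable[sampleSigma ξ (pastSamples k)] u₀) (hu₀m : ∀ a, u₀ a ∈ S.p.X)
    (tr : ∀ a, S.IsConExTrace G F B T (z a) (u₀ a) (fun t => ξ (k, t, false) a)
      (fun t => ξ (k, t, true) a) (fun t => u t a) (fun t => y t a)) :
    StochasticTrace S P ν G F B T z xs u₀ (fun t => ξ (k, t, false)) (fun t => ξ (k, t, true))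
      u y := by
  have hit := measurable_iterates V H O hB hz hzm hu₀ hu₀m tr
  have hle := sampleSigma_le hξ
  have hpast := fun t => sampleSigma_mono (ξ := ξ) (pastSamples_subset k t)
  have hum : ∀ t ≤ T, ∀ a, u t a ∈ S.p.X := fun t ht a => (tr a).mem (hu₀m a) t ht
  refine
    { oracle := O
      trace := tr
      z_mem := hzm
      xs_mem := hxsm
      u₀_mem := hu₀m
      meas_z := hz.mono (hle _) le_rfl
      meas_xs := hxs.mono (hle _) le_rfl
      meas_u := fun t ht => (hit t ht).1.mono (hle _) le_rfl
      meas_y := fun t ht => (hit t ht).2.1.mono (hle _) le_rfl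
      meas_s := fun t => hξ _
      meas_sbar := fun t => hξ _
      law_s := fun t => hlaw _
      law_sbar := fun t => hlaw _
      indep_s := fun t ht => ?_
      indep_sbar := fun t ht => ?_
      indep_sbar' := fun t ht h1 => ?_ }
  · obtain ⟨h1, h2, h3, h4⟩ := hit t ht.le
    refine indepFun_of_measurable_sampleSigma hξ hind (J := iterSamples k t)
      ((hz.mono (hpast t) le_rfl).prodMk (h1.prodMk ((h4 ht).prodMk (hxs.mono (hpast t) le_rfl))))
      ?_
    simp [iterSamples]
  · rcases Nat.eq_zero_or_pos t with h0 | h0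
    · subst h0
      have h1 : Measurable[sampleSigma ξ (pastSamples k)] (u 0) := by
        have : u 0 = u₀ := funext fun a => (tr a).init_primal
        rwa [this]
      refine indepFun_of_measurable_sampleSigma hξ hind (hz.prodMk h1) ?_
      simp [pastSamples]
    · refine indepFun_of_measurable_sampleSigma hξ hind
        ((hz.mono (hpast t) le_rfl).prodMk (hit t ht.le).1) ?_
      simp [iterSamples]
      omega
  · set J := insert (k, t, false) (iterSamples k t) with hJ
    have hsub : ∀ r ≤ t, sampleSigma ξ (iterSamples k r) ≤ sampleSigma ξ J := fun r hr =>
      sampleSigma_mono ((iterSamples_subset hr).trans (Set.subset_insert _ _))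
    have hzJ : Measurable[sampleSigma ξ J] z :=
      hz.mono ((hpast t).trans (hsub t le_rfl)) le_rfl
    have huJ : ∀ r ≤ t, Measurable[sampleSigma ξ J] (u r) := fun r hr =>
      (hit r (by omega)).1.mono (hsub r hr) le_rfl
    have hyJ : Measurable[sampleSigma ξ J] (y (t + 1)) :=
      ((hit t ht.le).2.2.2 ht).mono (hsub t le_rfl) le_rfl
    have hu'J : Measurable[sampleSigma ξ J] (u (t + 1)) :=
      measurable_primal_step V H O hB hzJ hzm tr hu₀m ht (huJ t le_rfl) hyJ
        (measurable_sample (Set.mem_insert _ _))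
    refine indepFun_of_measurable_sampleSigma hξ hind (J := J)
      (hzJ.prodMk ((huJ t le_rfl).prodMk (hu'J.prodMk (hyJ.prodMk
        (Finset.measurable_sum _ fun r hr => ?_))))) ?_
    · have hr' : r < t := Finset.mem_range.mp hr
      have h2 := measurable_linErr_succ (sbar := fun t => ξ (k, t, true)) (t := r) O hzJ hzm
        (huJ r hr'.le) (hum r (by omega)) (huJ (r + 1) hr')
        (measurable_sample (Set.mem_insert_of_mem _ (Or.inr ⟨rfl, Or.inl hr'⟩)))
      exact h2.const_smul ((r : ℝ) + S.t₀ B + 2)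
    · simp [hJ, iterSamples]
      omega

omit [MeasurableSpace Ω] [IsProbabilityMeasure ν] in
/-- Before each subproblem is treated, its centre depends on earlier samples only. -/
lemma measurable_centre (V : S.Valid) (H : S.p.Standing) (O : S.IsOracle ν G F) (hB : 0 ≤ B)
    {K : ℕ} {x0 : Rn n} (hx0 : x0 ∈ S.p.X) {x : ℕ → Ω → Rn n} (hstart : ∀ a, x 0 a = x0)
    {init : Rn n → Rn n} (hinit : Measurable init) (hinitm : Set.MapsTo init S.p.X S.p.X)
    (hT : 1 ≤ T)
    (hout : ∀ k < K, ∀ a, S.IsConExOutput G F B T (x k a) (init (x k a))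
      (fun t => ξ (k, t, false) a) (fun t => ξ (k, t, true) a) (x (k + 1) a)) :
    ∀ k ≤ K, Measurable[sampleSigma ξ (pastSamples k)] (x k) ∧ ∀ a, x k a ∈ S.p.X := by
  intro k
  induction k with
  | zero =>
    intro _
    have : x 0 = fun _ => x0 := funext hstart
    rw [this]
    exact ⟨measurable_const, fun _ => hx0⟩
  | succ k ih =>
    intro hk
    obtain ⟨h1, h2⟩ := ih (by omega)
    choose u y tr hx using hout k hk
    have hit := measurable_iterates (u := fun t a => u a t) (y := fun t a => y a t) V H O hB h1 h2
      (hinit.comp h1) (fun a => hinitm (h2 a)) tr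
    refine ⟨?_, fun a => ?_⟩
    · have : x (k + 1) = fun a => (∑ t ∈ Finset.range T, S.γ B t)⁻¹
          • ∑ t ∈ Finset.range T, S.γ B t • u a (t + 1) := funext hx
      rw [this]
      have hsum : Measurable[sampleSigma ξ (pastSamples (k + 1))]
          fun a => ∑ t ∈ Finset.range T, S.γ B t • u a (t + 1) := by
        refine Finset.measurable_sum _ fun t ht => ?_
        have ht' : t + 1 ≤ T := Finset.mem_range.mp ht
        exact ((hit (t + 1) ht').1.mono (sampleSigma_mono (iterSamples_subset_past k (t + 1)))
          le_rfl).const_smul (S.γ B t)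
      exact hsum.const_smul (∑ t ∈ Finset.range T, S.γ B t)⁻¹
    · rw [hx a]
      exact (tr a).output_mem V H hB hT

/-- Each subproblem is solved to the accuracy that follows from the bound for the expected
remainder. -/
theorem isStochSubOpt_of_run (V : S.Valid) (H : S.p.Standing) (O : S.IsOracle ν G F)
    {Y : ℝ} (hY : 0 ≤ Y) (hYB : Y + 1 ≤ B) {K : ℕ} {x0 : Rn n} (hx0 : x0 ∈ S.p.X)
    {x xs : ℕ → Ω → Rn n} {ys : ℕ → Ω → Fin m → ℝ} {khat : Ω → ℕ}
    {init : Rn n → Rn n} (hinit : Measurable init) (hinitm : Set.MapsTo init S.p.X S.p.X)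
    (R : S.p.IsProxRun P x0 B K x xs ys khat)
    (hys : ∀ k < K, ∀ a, Real.sqrt (∑ i, ys (k + 1) a i ^ 2) ≤ Y)
    (hξ : ∀ j, Measurable (ξ j)) (hlaw : ∀ j, P.map (ξ j) = ν) (hind : iIndepFun ξ P)
    (hT : 1 ≤ T)
    (hout : ∀ k < K, ∀ a, S.IsConExOutput G F B T (x k a) (init (x k a))
      (fun t => ξ (k, t, false) a) (fun t => ξ (k, t, true) a) (x (k + 1) a))
    {δo δc : ℝ}
    (hδ : ∀ yM : ℝ, 0 ≤ yM →
      (0 < S.τbase B T → yM ≤ 2 * Y ^ 2 + 8 / S.τbase B T * S.remainderBound B Y T yM) →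
      S.remainderBound B Y T yM ≤ S.Γ B T * δo ∧ S.remainderBound B Y T yM ≤ S.Γ B T * δc) :
    ∀ k < K, S.p.IsStochSubOpt P δo δc (x k) (x (k + 1)) := by
  have hB : 0 ≤ B := by linarith
  intro k hk
  obtain ⟨hz, hzm⟩ := measurable_centre V H O hB hx0 R.start hinit hinitm hT hout k hk.le
  obtain ⟨C, hC⟩ := H.exists_sq_dist_subKKT_le B
  have hxs : Measurable[sampleSigma ξ (pastSamples k)] (xs (k + 1)) :=
    measurable_of_sq_dist_le (C := C) hz fun a b => hC _ (hzm a) _ (hzm b) _ _ _ _ (R.kkt k hk a)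
      (R.kkt k hk b) (R.dual_bound k hk a) (R.dual_bound k hk b)
  choose u y tr hx using hout k hk
  have hst := stochasticTrace_of_samples (P := P) (u := fun t a => u a t) (y := fun t a => y a t)
    V H O hB hξ hlaw hind hz hzm hxs (fun a => (R.kkt k hk a).mem) (hinit.comp hz)
    (fun a => hinitm (hzm a)) tr
  exact hst.isStochSubOpt V H hT hY hYB (R.kkt k hk) (hys k hk) (R.meas_x (k + 1)) hx hδ

end ConExSetup

/-! ### Choice of the number of iterations -/

namespace ConExSetup

variable {n m : ℕ} {S : ConExSetup n m}

lemma sqrt_le_Teps (S : ConExSetup n m) (B Y ε : ℝ) :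
    Real.sqrt (5 * S.α₀ * (S.t₀ B + 2) * (S.t₀ B + 1) * S.p.DX ^ 2 / ε
      + 960 * (S.t₀ B + 2) * (Y + 1) ^ 2 * S.Mcal ^ 2 / (S.α₀ * ε)) ≤ S.Teps B Y ε :=
  le_max_of_le_left (le_max_of_le_left (le_max_of_le_left (le_max_left _ _)))

lemma div_le_Teps (S : ConExSetup n m) (B Y ε : ℝ) :
    80 * (S.ζ B Y ^ 2 + S.Hstar B Y ^ 2 + 144 * (S.t₀ B + 2) * (Y + 1) ^ 2 * S.σt ^ 2)
      / (S.α₀ * ε) ≤ S.Teps B Y ε :=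
  le_max_of_le_left (le_max_of_le_left (le_max_right _ _))

lemma sq_mul_le_Teps (S : ConExSetup n m) (B Y ε : ℝ) :
    (130 * B * S.σXf / 3) ^ 2 * ((S.t₀ B + 2) / ε ^ 2) ≤ S.Teps B Y ε := le_max_right _ _

lemma exists_pos_le_Teps (V : S.Valid) (H : S.p.Standing) (hD : 0 < S.p.DX) {B : ℝ}
    (hB : 0 ≤ B) (Y : ℝ) :
    ∃ κ : ℝ, 0 < κ ∧ ∀ ε, 0 < ε → ε ≤ 1 → κ ≤ S.Teps B Y ε ∧ κ ^ 2 / ε ≤ S.Teps B Y ε ^ 2 := by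
  have ht0 := two_le_t₀ V H hB
  have hα : 0 < S.α₀ := H.μ_zero
  set q := 5 * S.α₀ * (S.t₀ B + 2) * (S.t₀ B + 1) * S.p.DX ^ 2 with hq
  have hq0 : 0 < q := by positivity
  refine ⟨Real.sqrt q, Real.sqrt_pos.mpr hq0, fun ε hε hε1 => ?_⟩
  have h1 : Real.sqrt (q / ε) ≤ S.Teps B Y ε := by
    refine le_trans (Real.sqrt_le_sqrt ?_) (S.sqrt_le_Teps B Y ε)
    have : 0 ≤ 960 * (S.t₀ B + 2) * (Y + 1) ^ 2 * S.Mcal ^ 2 / (S.α₀ * ε) := by positivity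
    linarith
  refine ⟨(Real.sqrt_le_sqrt ?_).trans h1, ?_⟩
  · rw [le_div_iff₀ hε]
    nlinarith
  · have h2 := pow_le_pow_left₀ (Real.sqrt_nonneg _) h1 2
    rwa [Real.sq_sqrt (by positivity)] at h2 ⊢

/-- Without noise in the constraints the expected remainder grows at most linearly. -/
lemma exists_remainderBound_le_of_σXf_eq_zero (V : S.Valid) (H : S.p.Standing)
    (hD : 0 < S.p.DX) {B : ℝ} (hB : 0 < B) (Y : ℝ) (hσ : S.σXf = 0) :
    ∃ a : ℝ, 0 ≤ a ∧ ∀ (T : ℕ) (yM : ℝ), S.remainderBound B Y T yM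
      = a + T * (16 * S.t₀ B / S.α₀ * (S.Hstar B Y ^ 2 + 2 * S.σ 0 ^ 2)) := by
  have ht0 := two_le_t₀ V H hB.le
  have hα : 0 < S.α₀ := H.μ_zero
  have hσt : S.σt = 0 := by
    have h1 := S.sq_σXf
    rw [hσ] at h1
    have h2 : S.p.DX ^ 2 * S.σt ^ 2 = 0 := by
      have := sq_nonneg S.σf
      have : 0 ≤ S.p.DX ^ 2 * S.σt ^ 2 := by positivity
      linarith
    have h3 : S.p.DX ^ 2 ≠ 0 := by positivity
    exact pow_eq_zero_iff two_ne_zero |>.mp ((mul_eq_zero.mp h2).resolve_left h3)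
  have hτ : ∀ T, S.τbase B T = 32 * S.Mcal ^ 2 / S.α₀ := fun T => by
    unfold τbase
    rw [hσ, hσt]
    have : 0 ≤ 32 * S.Mcal ^ 2 / S.α₀ := by positivity
    simp [this]
  refine ⟨S.α₀ * (S.t₀ B + 2) * (S.t₀ B + 1) / 4 * S.p.DX ^ 2
    + (S.t₀ B + 2) * (32 * S.Mcal ^ 2 / S.α₀) / 2 * (Y + 1) ^ 2, by positivity, fun T yM => ?_⟩
  unfold remainderBound
  rw [hτ, hσ, hσt]
  ring

/-- Separation of the expected remainder into a part of order `T ^ (3 / 2)` and a part that is linear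
in the second moments of the dual iterates. -/
lemma exists_remainderBound_le_add (V : S.Valid) (H : S.p.Standing) {B Y : ℝ} (hB : 0 < B)
    (hY : 0 ≤ Y) :
    ∃ K₁ K₂ : ℝ, 0 ≤ K₁ ∧ 0 ≤ K₂ ∧ ∀ T : ℕ, 1 ≤ T → ∀ yM : ℝ, 0 ≤ yM →
      S.remainderBound B Y T yM ≤ K₁ * (T * Real.sqrt T) + K₂ * T * yM := by
  have hσ := S.σXf_nonneg
  have ht0 := two_le_t₀ V H hB.le
  have hα : 0 < S.α₀ := H.μ_zero
  set g := S.t₀ B + 2 with hg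
  have hg0 : 0 < g := by linarith
  have hsg : 0 < Real.sqrt g := Real.sqrt_pos.mpr hg0
  set K0 := 16 * S.t₀ B / S.α₀ with hK0
  have hK0' : 0 ≤ K0 := by positivity
  set a0 := S.α₀ * g * (S.t₀ B + 1) / 4 * S.p.DX ^ 2 with ha0
  have ha0' : 0 ≤ a0 := by positivity
  set q := 32 * S.Mcal ^ 2 / S.α₀ + 384 * S.σt ^ 2 / S.α₀ + S.σXf / (B * Real.sqrt g) with hq
  have hq0 : 0 ≤ q := by positivity
  set K1 := a0 + g * q / 2 * (Y + 1) ^ 2 + g * S.σXf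
    + K0 * (S.Hstar B Y ^ 2 + 2 * S.σ 0 ^ 2) + (Y + 1) * (2 * g * S.σXf)
    + 32 * (g * Real.sqrt g) * S.σXf * B with hK1
  set K2 := g * S.σXf / 2 + 2 * K0 * S.σt ^ 2 with hK2
  have hK1' : 0 ≤ K1 := by positivity
  have hK2' : 0 ≤ K2 := by positivity
  refine ⟨K1, K2, hK1', hK2', ?_⟩
  intro T hT yM hyM
  have hT1 : (1 : ℝ) ≤ T := by exact_mod_cast hT
  have hs1 : 1 ≤ Real.sqrt T := by
    rw [← Real.sqrt_one]
    exact Real.sqrt_le_sqrt hT1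
  set r := (T : ℝ) * Real.sqrt T with hr
  have hTr : (T : ℝ) ≤ r := by rw [hr]; nlinarith
  have h1r : 1 ≤ r := hT1.trans hTr
  have hτ : S.τbase B T ≤ q * r := by
    unfold τbase
    rw [rpow_three_halves (Nat.cast_nonneg T)]
    have e1 : 0 ≤ 32 * S.Mcal ^ 2 / S.α₀ := by positivity
    have e2 : 0 ≤ 384 * S.σt ^ 2 / S.α₀ := by positivity
    have e3 : 384 * S.σt ^ 2 * T / S.α₀ = 384 * S.σt ^ 2 / S.α₀ * T := by ring
    have e4 : S.σXf * (T * Real.sqrt T) / (B * Real.sqrt (S.t₀ B + 2)) = S.σXf / (B * Real.sqrt g) * r := by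
      rw [hr, hg]; ring
    rw [e3, e4, hq, add_mul, add_mul]
    have f1 : 32 * S.Mcal ^ 2 / S.α₀ ≤ 32 * S.Mcal ^ 2 / S.α₀ * r := le_mul_of_one_le_right e1 h1r
    have f2 : 384 * S.σt ^ 2 / S.α₀ * T ≤ 384 * S.σt ^ 2 / S.α₀ * r :=
      mul_le_mul_of_nonneg_left hTr e2
    have f3 : 0 ≤ 384 * S.σt ^ 2 / S.α₀ * T := by positivity
    have f4 : 0 ≤ S.σXf / (B * Real.sqrt g) * r := by positivity
    refine max_le (max_le ?_ ?_) ?_ <;> linarith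
  have b1 : a0 ≤ a0 * r := le_mul_of_one_le_right ha0' h1r
  have b2 : g * S.τbase B T / 2 * (Y + 1) ^ 2 ≤ g * q / 2 * (Y + 1) ^ 2 * r := by
    calc g * S.τbase B T / 2 * (Y + 1) ^ 2 ≤ g * (q * r) / 2 * (Y + 1) ^ 2 := by gcongr
      _ = _ := by ring
  have b3 : g * (S.σXf * (yM / 2 + 1)) ≤ g * S.σXf * r + g * S.σXf / 2 * T * yM := by
    have f1 : g * S.σXf ≤ g * S.σXf * r := le_mul_of_one_le_right (by positivity) h1r
    have f2 : g * S.σXf / 2 * yM ≤ g * S.σXf / 2 * yM * T :=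
      le_mul_of_one_le_right (by positivity) hT1
    linarith
  have b4 : T * (K0 * (S.Hstar B Y ^ 2 + (2 * S.σ 0 ^ 2 + 2 * S.σt ^ 2 * yM)))
      ≤ K0 * (S.Hstar B Y ^ 2 + 2 * S.σ 0 ^ 2) * r + 2 * K0 * S.σt ^ 2 * T * yM := by
    have f1 : K0 * (S.Hstar B Y ^ 2 + 2 * S.σ 0 ^ 2) * T
        ≤ K0 * (S.Hstar B Y ^ 2 + 2 * S.σ 0 ^ 2) * r :=
      mul_le_mul_of_nonneg_left hTr (by positivity)
    linarith
  unfold remainderBound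
  rw [hK1, hK2]
  linarith

/-- With noise in the constraints the dual iterates are stable for long runs, and the expected
remainder then grows like `T ^ (3 / 2)`. -/
lemma exists_remainderBound_le_of_σXf_pos (V : S.Valid) (H : S.p.Standing)
    {B Y : ℝ} (hB : 0 < B) (hY : 0 ≤ Y) (hσ : 0 < S.σXf) :
    ∃ T₀ K : ℝ, 0 ≤ T₀ ∧ 0 ≤ K ∧ ∀ T : ℕ, 1 ≤ T → T₀ ≤ Real.sqrt T → ∀ yM : ℝ, 0 ≤ yM →
      (0 < S.τbase B T → yM ≤ 2 * Y ^ 2 + 8 / S.τbase B T * S.remainderBound B Y T yM) →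
      S.remainderBound B Y T yM ≤ K * (T * Real.sqrt T) := by
  obtain ⟨K1, K2, hK1', hK2', hbound⟩ := exists_remainderBound_le_add V H hB hY
  obtain ⟨c, hc0, hcτ⟩ : ∃ c : ℝ, 0 < c ∧ ∀ T : ℕ, c * (T * Real.sqrt T) ≤ S.τbase B T := by
    have ht0 := two_le_t₀ V H hB.le
    have hsg : 0 < Real.sqrt (S.t₀ B + 2) := Real.sqrt_pos.mpr (by linarith)
    refine ⟨S.σXf / (B * Real.sqrt (S.t₀ B + 2)), by positivity, fun T => ?_⟩
    refine le_trans (le_of_eq ?_) (S.σXf_mul_le_τbase (B := B) T)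
    ring
  refine ⟨16 * K2 / c, K1 + K2 * (4 * Y ^ 2 + 16 * K1 / c), by positivity, by positivity, ?_⟩
  intro T hT hT0 yM hyM hself
  have hT1 : (1 : ℝ) ≤ T := by exact_mod_cast hT
  have hs1 : 1 ≤ Real.sqrt T := by
    rw [← Real.sqrt_one]
    exact Real.sqrt_le_sqrt hT1
  have hsT : 0 < Real.sqrt T := by linarith
  have hb := hbound T hT yM hyM
  have hτ := hcτ T
  have hcr : 0 < c * (T * Real.sqrt T) := by positivity
  have hτ0 : 0 < S.τbase B T := hcr.trans_le hτ
  have hyM' : yM ≤ 4 * Y ^ 2 + 16 * K1 / c := by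
    have h1 := hself hτ0
    have h2 : 8 / S.τbase B T * S.remainderBound B Y T yM
        ≤ 8 / (c * (T * Real.sqrt T)) * (K1 * (T * Real.sqrt T) + K2 * T * yM) := by
      calc _ ≤ 8 / S.τbase B T * (K1 * (T * Real.sqrt T) + K2 * T * yM) := by gcongr
        _ ≤ _ := by gcongr
    have h3 : 8 / (c * (T * Real.sqrt T)) * (K1 * (T * Real.sqrt T) + K2 * T * yM)
        = 8 * K1 / c + (8 * K2 / c) / Real.sqrt T * yM := by
      field_simp
    have h4 : (8 * K2 / c) / Real.sqrt T * yM ≤ 1 / 2 * yM := by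
      refine mul_le_mul_of_nonneg_right ?_ hyM
      rw [div_le_iff₀ hsT]
      have : 16 * K2 / c = 2 * (8 * K2 / c) := by ring
      linarith
    have h5 : 16 * K1 / c = 2 * (8 * K1 / c) := by ring
    linarith
  have h1 : K2 * T * yM ≤ K2 * (4 * Y ^ 2 + 16 * K1 / c) * (T * Real.sqrt T) := by
    have h2 : (T : ℝ) ≤ T * Real.sqrt T := by nlinarith
    calc K2 * T * yM ≤ K2 * (T * Real.sqrt T) * (4 * Y ^ 2 + 16 * K1 / c) := by gcongr
      _ = _ := by ring
  linarith

/-- A number of iterations proportional to `T_ε` makes the expected remainder a small multiple of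
the total weight of the iterates. -/
lemma exists_remainderBound_le (V : S.Valid) (H : S.p.Standing) (hD : 0 < S.p.DX)
    {B Y : ℝ} (hY : 0 ≤ Y) (hYB : Y + 1 ≤ B) {q : ℝ} (hq : 0 < q) :
    ∃ A : ℝ, 0 < A ∧ ∀ ε, 0 < ε → ε ≤ 1 → ∀ T : ℕ, 1 ≤ T → A * S.Teps B Y ε ≤ T →
      ∀ yM : ℝ, 0 ≤ yM →
      (0 < S.τbase B T → yM ≤ 2 * Y ^ 2 + 8 / S.τbase B T * S.remainderBound B Y T yM) →
      S.remainderBound B Y T yM ≤ S.Γ B T * (q * ε) := by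
  have hB : 0 < B := by linarith
  have ht0 := two_le_t₀ V H hB.le
  have hα : 0 < S.α₀ := H.μ_zero
  suffices h : ∃ A : ℝ, 0 < A ∧ ∀ ε, 0 < ε → ε ≤ 1 → ∀ T : ℕ, 1 ≤ T → A * S.Teps B Y ε ≤ T →
      ∀ yM : ℝ, 0 ≤ yM →
      (0 < S.τbase B T → yM ≤ 2 * Y ^ 2 + 8 / S.τbase B T * S.remainderBound B Y T yM) →
      S.remainderBound B Y T yM ≤ (T : ℝ) ^ 2 / 2 * (q * ε) by
    obtain ⟨A, hA, h⟩ := h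
    refine ⟨A, hA, fun ε hε hε1 T hT hAT yM hyM hself => ?_⟩
    refine (h ε hε hε1 T hT hAT yM hyM hself).trans ?_
    exact mul_le_mul_of_nonneg_right (sq_le_Γ V H hB.le T) (by positivity)
  rcases S.σXf_nonneg.eq_or_lt with hσ | hσ
  · obtain ⟨a, ha, hrem⟩ := exists_remainderBound_le_of_σXf_eq_zero V H hD hB Y hσ.symm
    obtain ⟨κ, hκ, hκT⟩ := exists_pos_le_Teps V H hD hB.le Y
    set b := 16 * S.t₀ B / S.α₀ * (S.Hstar B Y ^ 2 + 2 * S.σ 0 ^ 2) with hb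
    have hb0 : 0 ≤ b := by positivity
    set κ' := 80 * (S.ζ B Y ^ 2 + S.Hstar B Y ^ 2 + 144 * (S.t₀ B + 2) * (Y + 1) ^ 2 * S.σt ^ 2)
      / S.α₀ with hκ'
    have hκ'0 : 0 ≤ κ' := by positivity
    have hζ : b ≠ 0 → κ' ≠ 0 := by
      intro hb1 h0
      apply hb1
      have h1 : S.ζ B Y ^ 2 + S.Hstar B Y ^ 2
          + 144 * (S.t₀ B + 2) * (Y + 1) ^ 2 * S.σt ^ 2 = 0 := by
        have := (div_eq_zero_iff.mp h0).resolve_right hα.ne'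
        linarith
      have h2 : 0 ≤ 144 * (S.t₀ B + 2) * (Y + 1) ^ 2 * S.σt ^ 2 := by positivity
      have h3 : S.ζ B Y ^ 2 = 0 := by
        nlinarith [sq_nonneg (S.ζ B Y), sq_nonneg (S.Hstar B Y)]
      have h4 : S.Hstar B Y ^ 2 = 0 := by nlinarith [sq_nonneg (S.Hstar B Y)]
      have h5 : S.σ 0 ^ 2 = 0 := by
        have h6 : S.ζ B Y = 0 := pow_eq_zero_iff two_ne_zero |>.mp h3
        unfold ζ at h6
        have h7 := (mul_eq_zero.mp h6).resolve_left (by positivity)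
        rw [Real.sqrt_eq_zero'] at h7
        have e1 : 0 ≤ 12 * (S.t₀ B + 3) * S.σt ^ 2 * Y ^ 2 := by positivity
        have e2 : 0 ≤ 96 * (S.t₀ B + 2) * B ^ 2 * S.σt ^ 2 := by positivity
        have e3 : 0 ≤ 3 * S.α₀ * B * S.σXf * (S.t₀ B + 2) ^ (3 / 2 : ℝ) / 2 := by
          have := S.σXf_nonneg
          positivity
        nlinarith [sq_nonneg (S.σ 0), sq_nonneg (S.Hstar B Y)]
      rw [hb, h4, h5]
      ring
    -- the two requirements on the number of iterations
    set A := Real.sqrt (4 * a / q) / κ + 4 * b / (q * κ') + 1 with hA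
    have hA1 : 0 ≤ Real.sqrt (4 * a / q) / κ := by positivity
    have hA2 : 0 ≤ 4 * b / (q * κ') := by positivity
    refine ⟨A, by positivity, fun ε hε hε1 T hT hAT yM hyM _ => ?_⟩
    obtain ⟨hT1, hT2⟩ := hκT ε hε hε1
    have hTe : 0 < S.Teps B Y ε := hκ.trans_le hT1
    have hTpos : (0 : ℝ) < T := by exact_mod_cast hT
    rw [hrem]
    have h1 : a ≤ (T : ℝ) ^ 2 / 4 * (q * ε) := by
      have e1 : Real.sqrt (4 * a / q) / κ * S.Teps B Y ε ≤ T :=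
        le_trans (mul_le_mul_of_nonneg_right (by rw [hA]; linarith) hTe.le) hAT
      have e2 := pow_le_pow_left₀ (by positivity) e1 2
      rw [mul_pow, div_pow, Real.sq_sqrt (by positivity)] at e2
      have e3 : 4 * a / q / κ ^ 2 * (κ ^ 2 / ε) ≤ T ^ 2 :=
        le_trans (mul_le_mul_of_nonneg_left hT2 (by positivity)) e2
      have e4 : 4 * a / q / κ ^ 2 * (κ ^ 2 / ε) = 4 * a / (q * ε) := by field_simp
      rw [e4, div_le_iff₀ (by positivity)] at e3
      linarith
    have h2 : T * b ≤ (T : ℝ) ^ 2 / 4 * (q * ε) := by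
      by_cases hb1 : b = 0
      · rw [hb1, mul_zero]
        positivity
      have hκ'1 : 0 < κ' := lt_of_le_of_ne hκ'0 (Ne.symm (hζ hb1))
      have e1 : 4 * b / (q * κ') * S.Teps B Y ε ≤ T :=
        le_trans (mul_le_mul_of_nonneg_right (by rw [hA]; linarith) hTe.le) hAT
      have e2 : κ' / ε ≤ S.Teps B Y ε := by
        refine le_trans (le_of_eq ?_) (S.div_le_Teps B Y ε)
        rw [hκ', div_div]
      have e3 : 4 * b / (q * κ') * (κ' / ε) ≤ T :=
        le_trans (mul_le_mul_of_nonneg_left e2 hA2) e1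
      have e4 : 4 * b / (q * κ') * (κ' / ε) = 4 * b / (q * ε) := by field_simp
      rw [e4, div_le_iff₀ (by positivity)] at e3
      nlinarith
    linarith
  · obtain ⟨T₀, K, hT₀, hK, hrem⟩ := exists_remainderBound_le_of_σXf_pos V H hB hY hσ
    set κ := (130 * B * S.σXf / 3) ^ 2 * (S.t₀ B + 2) with hκ
    have hκ0 : 0 < κ := by positivity
    refine ⟨(T₀ ^ 2 + (2 * K / q) ^ 2 + 1) / κ, by positivity,
      fun ε hε hε1 T hT hAT yM hyM hself => ?_⟩
    have hTpos : (0 : ℝ) < T := by exact_mod_cast hT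
    have h1 : κ / ε ^ 2 ≤ S.Teps B Y ε := by
      refine le_trans (le_of_eq ?_) (S.sq_mul_le_Teps B Y ε)
      rw [hκ]
      ring
    have h2 : (T₀ ^ 2 + (2 * K / q) ^ 2 + 1) / ε ^ 2 ≤ T := by
      refine le_trans (le_of_eq ?_) (le_trans (mul_le_mul_of_nonneg_left h1
        (by positivity : 0 ≤ (T₀ ^ 2 + (2 * K / q) ^ 2 + 1) / κ)) hAT)
      field_simp
    have h3 : ∀ v : ℝ, 0 ≤ v → v ^ 2 ≤ T₀ ^ 2 + (2 * K / q) ^ 2 + 1 → v / ε ≤ Real.sqrt T := by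
      intro v hv hle
      refine Real.le_sqrt_of_sq_le (le_trans ?_ h2)
      rw [div_pow]
      exact div_le_div_of_nonneg_right hle (sq_nonneg ε)
    clear_value κ
    have h4 : T₀ ≤ Real.sqrt T := by
      refine le_trans ?_ (h3 T₀ hT₀ (by linarith [sq_nonneg (2 * K / q)]))
      rw [le_div_iff₀ hε]
      exact mul_le_of_le_one_right hT₀ hε1
    have h5 : 2 * K / q / ε ≤ Real.sqrt T :=
      h3 (2 * K / q) (by positivity) (by linarith [sq_nonneg T₀])
    refine (hrem T hT h4 yM hyM hself).trans ?_
    rw [div_div, div_le_iff₀ (by positivity)] at h5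
    have h6 : (T : ℝ) ^ 2 = T * (Real.sqrt T * Real.sqrt T) := by
      rw [Real.mul_self_sqrt hTpos.le]
      ring
    rw [h6]
    have h7 : K ≤ Real.sqrt T * (q * ε) / 2 := by linarith
    calc K * (T * Real.sqrt T) ≤ (Real.sqrt T * (q * ε) / 2) * (T * Real.sqrt T) := by gcongr
      _ = _ := by ring

end ConExSetup

theorem corollary3p19 {n m : ℕ} :
    -- outer iteration count, with any inexact solver of the subproblems
    (∀ (p : Problem n m), p.Standing → ∀ x0 ∈ p.X, ∀ (B c ε : ℝ), 0 < B → 0 < c → 0 < ε →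
      ∀ K : ℕ, 1 ≤ K → p.outerBound B ε x0 ≤ K →
      ∀ (Ω : Type*) [MeasurableSpace Ω] (P : Measure Ω) [IsProbabilityMeasure P]
        (x xs : ℕ → Ω → Rn n) (ys : ℕ → Ω → Fin m → ℝ) (khat : Ω → ℕ),
        p.IsProxRun P x0 B K x xs ys khat →
        (∀ k < K, p.IsStochSubOpt P (c * p.acc B c ε) (p.acc B c ε) (x k) (x (k + 1))) →
        p.IsStochKKT P ε (2 * ε / (p.μ 0 * p.c1 B)) (fun a => x (khat a) a)) ∧
    -- overall complexity, with `T` iterations of ConEx for every subproblem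
    (∀ (S : ConExSetup n m), S.p.Standing → S.Valid → S.p.X.Nontrivial →
      ∀ x0 ∈ S.p.X, ∀ (B Y c : ℝ), 0 ≤ Y → Y + 1 ≤ B → 0 < c →
      ∃ C : ℝ, 0 < C ∧ ∀ ε : ℝ, 0 < ε → ε ≤ 1 →
        ∃ K T : ℕ, K = max 1 ⌈S.p.outerBound B ε x0⌉₊ ∧ 1 ≤ T ∧
          ((K * T : ℕ) : ℝ) ≤ C * (S.Teps B Y ε / ε) ∧
          ∀ (Ξ : Type*) [MeasurableSpace Ξ] (ν : Measure Ξ) [IsProbabilityMeasure ν]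
            (G : Rn n → Fin (m + 1) → Rn n → Ξ → Rn n) (F : Rn n → Fin m → Rn n → Ξ → ℝ),
            S.IsOracle ν G F →
          ∀ init : Rn n → Rn n, Measurable init → Set.MapsTo init S.p.X S.p.X →
          ∀ (Ω : Type*) [MeasurableSpace Ω] (P : Measure Ω) [IsProbabilityMeasure P]
            (x xs : ℕ → Ω → Rn n) (ys : ℕ → Ω → Fin m → ℝ) (khat : Ω → ℕ)
            (ξ : ℕ × ℕ × Bool → Ω → Ξ),
            S.p.IsProxRun P x0 B K x xs ys khat →
            (∀ k < K, ∀ a, Real.sqrt (∑ i, ys (k + 1) a i ^ 2) ≤ Y) →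
            (∀ j, Measurable (ξ j)) → (∀ j, P.map (ξ j) = ν) → iIndepFun ξ P →
            (∀ k < K, ∀ a, S.IsConExOutput G F B T (x k a) (init (x k a))
              (fun t => ξ (k, t, false) a) (fun t => ξ (k, t, true) a) (x (k + 1) a)) →
            (∀ k < K, S.p.IsStochSubOpt P (c * S.p.acc B c ε) (S.p.acc B c ε)
              (x k) (x (k + 1))) ∧
            S.p.IsStochKKT P ε (2 * ε / (S.p.μ 0 * S.p.c1 B)) (fun a => x (khat a) a)) := by
  refine ⟨fun p H x0 hx0 B c ε hB hc hε K hK1 hK Ω _ P _ x xs ys khat R hopt =>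
    R.isStochKKT H hx0 hB hc hε hK1 hK hopt, ?_⟩
  intro S H V hX x0 hx0 B Y c hY hYB hc
  have hB : 0 < B := by linarith
  have hD := H.DX_pos hX
  have hc1 : 0 < S.p.c1 B := H.c1_pos B
  -- both accuracies are multiples of `ε`
  set q := min c 1 / (2 * S.p.c1 B * (c + B)) with hq
  have hq0 : 0 < q := by
    have : 0 < min c 1 := lt_min hc one_pos
    positivity
  obtain ⟨A, hA, hrem⟩ := ConExSetup.exists_remainderBound_le V H hD hY hYB hq0
  obtain ⟨κ, hκ, hκT⟩ := ConExSetup.exists_pos_le_Teps V H hD hB.le Y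
  set D := 2 * S.p.c1 B * (S.p.Δ x0 + B * S.p.Δbar x0) with hDdef
  refine ⟨(|D| + 2) * (A + 1 / κ), by positivity, fun ε hε hε1 => ?_⟩
  obtain ⟨hT1, -⟩ := hκT ε hε hε1
  have hTe : 0 < S.Teps B Y ε := hκ.trans_le hT1
  set T := ⌈A * S.Teps B Y ε⌉₊ with hT
  have hT1' : 1 ≤ T := Nat.one_le_iff_ne_zero.mpr (Nat.ceil_pos.mpr (by positivity)).ne'
  have hTle : (T : ℝ) ≤ (A + 1 / κ) * S.Teps B Y ε := by
    have h1 := (Nat.ceil_lt_add_one (by positivity : 0 ≤ A * S.Teps B Y ε)).le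
    have h2 : 1 ≤ 1 / κ * S.Teps B Y ε := by
      rw [one_div_mul_eq_div, le_div_iff₀ hκ]
      linarith
    rw [add_mul]
    linarith
  set K := max 1 ⌈S.p.outerBound B ε x0⌉₊ with hK
  have hKle : (K : ℝ) ≤ (|D| + 2) / ε := by
    have h1 : S.p.outerBound B ε x0 ≤ |D| / ε := by
      unfold Problem.outerBound
      exact div_le_div_of_nonneg_right (le_abs_self _) hε.le
    have h2 : ((⌈S.p.outerBound B ε x0⌉₊ : ℕ) : ℝ) ≤ |D| / ε + 1 :=
      (Nat.cast_le.mpr (Nat.ceil_le_ceil h1)).trans (Nat.ceil_lt_add_one (by positivity)).le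
    have h3 : 1 ≤ 1 / ε := by rwa [le_div_iff₀ hε, one_mul]
    have h4 : 0 ≤ |D| / ε := by positivity
    have h5 : (|D| + 2) / ε = |D| / ε + 2 * (1 / ε) := by ring
    rw [hK, Nat.cast_max, h5]
    refine max_le ?_ ?_
    · push_cast; linarith
    · linarith
  refine ⟨K, T, rfl, hT1', ?_, ?_⟩
  · push_cast
    calc (K : ℝ) * T ≤ ((|D| + 2) / ε) * ((A + 1 / κ) * S.Teps B Y ε) := by gcongr
      _ = _ := by ring
  intro Ξ _ ν _ G F O init hinit hinitm Ω _ P _ x xs ys khat ξ R hys hξ hlaw hind hout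
  have hopt := ConExSetup.isStochSubOpt_of_run V H O hY hYB hx0 hinit hinitm R hys hξ hlaw hind
    hT1' hout (δo := c * S.p.acc B c ε) (δc := S.p.acc B c ε) fun yM hyM hself => by
      have h1 := hrem ε hε hε1 T hT1' (Nat.le_ceil _) yM hyM hself
      have hΓ := (ConExSetup.Γ_pos V H hB.le hT1').le
      have e : q * ε = min c 1 * S.p.acc B c ε := by
        unfold Problem.acc
        rw [hq]
        ring
      have ha : 0 ≤ S.p.acc B c ε := by
        unfold Problem.acc
        positivity
      rw [e] at h1
      refine ⟨h1.trans (mul_le_mul_of_nonneg_left ?_ hΓ), h1.trans (mul_le_mul_of_nonneg_left ?_ hΓ)⟩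
      · exact mul_le_mul_of_nonneg_right (min_le_left _ _) ha
      · exact (mul_le_mul_of_nonneg_right (min_le_right _ _) ha).trans_eq (one_mul _)
  refine ⟨hopt, R.isStochKKT H hx0 hB hc hε (le_max_left _ _) ?_ hopt⟩
  exact (Nat.le_ceil _).trans (Nat.cast_le.mpr (le_max_right _ _))

end
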